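/- Identify $\mathbb R^4$ with the pairs $(x_0,x)$, $x_0\in\mathbb R$, $x\in\mathbb R^3$, and let $\mathbb R^4_{+}=\{x_0>0\}$, $\mathbb R^4_{-}=\{x_0<0\}$. Let $A$ be one of the two complex algebras * $A=\mathbb H\otimes\mathbb C$, with quaternion units $e_1,e_2,e_3=e_1e_2$, or * $A=\mathrm{Cl}_3\otimes\mathbb C$, the complexified Clifford algebra with generators $e_1,e_2,e_3$, $e_j^2=-1$, $e_je_k=-e_ke_j$ for $j\ne k$, and identify $x\in\mathbb R^3$ with $x_1e_1+x_2e_2+x_3e_3\in A$. Let $\mathrm{Spin}(3)=\{uv: u,v\in\mathbb R^3,\ |u|=|v|=1\}\subset A$, and let $\gamma:S^2\to\mathrm{Spin}(3)$ be any measurable map with $\gamma(\omega)e_3\gamma(\omega)^{-1}=\omega$ for all $\omega\in S^2$. For $w\in A$ put $$\tilde H_w=\{\,y\mapsto \beta(y)\,\gamma(y/|y|)\,w\ :\ \beta\in L^2(\mathbb R^3,\mathbb C)\,\}\subset L^2(\mathbb R^3,A).$$ Define finite sets $W^{\pm}\subset A$ as follows. For $A=\mathbb H\otimes\mathbb C$: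 $$W^+=\{e_1+ie_2,\ 1+ie_3\},\qquad W^-=\{1-ie_3,\ e_1-ie_2\}.$$ For $A=\mathrm{Cl}_3\otimes\mathbb C$, with $p=e_3e_1e_2$: $$W^+=\{(1-p)(e_1+ie_2),\ (1-p)(1+ie_1e_2),\ (1+p)(e_1-ie_2),\ (1+p)(1-ie_1e_2)\},$$ $$W^-=\{(1-p)(1-ie_1e_2),\ (1-p)(e_1-ie_2),\ (1+p)(1+ie_1e_2),\ (1+p)(e_1+ie_2)\}.$$ Fix a sign $\sigma\in\{1,-1\}$, let $\mathfrak F_\sigma g(x)=\int_{\mathbb R^3}e^{2\pi i\sigma\langle x,\xi\rangle}g(\xi)\,d\xi$ be the corresponding Fourier transform on $L^2(\mathbb R^3,A)$, let $D_\sigma=\partial_{x_0}+\sigma\sum_{k=1}^3e_k\partial_{x_k}$, and put $$H^{\pm}_\sigma=\sum_{w\in W^{\pm}}\mathfrak F_\sigma\tilde H_w .$$ Let $\mathcal H^2_\sigma(\mathbb R^4_{\pm})$ be the monogenic Hardy space of smooth functions $F:\mathbb R^4_{\pm}\to A$ with $D_\sigma F=0$ and $\sup_{t>0}\int_{\mathbb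 R^3}|F(\pm t,x)|^2\,dx<\infty$. Then, in both algebras, for both signs $\sigma$ and for the upper and the lower half-space: every $F\in\mathcal H^2_\sigma(\mathbb R^4_{\pm})$ has at almost every boundary point a non-tangential limit (through cones of every aperture), and the boundary function lies in $L^2(\mathbb R^3,A)$; $F$ is determined by its boundary function; and the space of all boundary functions of $\mathcal H^2_\sigma(\mathbb R^4_{\pm})$ is exactly $H^{\pm}_\sigma$. That is, $H^+_\sigma$ and $H^-_\sigma$ are the upper and the lower monogenic Hardy spaces, respectively. -/

import Mathlib

open MeasureTheory Filter Topology
open scoped FourierTransform ContDiff NNReal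

noncomputable section

/-! ### Norms on finite-dimensional complex algebras

The two value algebras carry no norm in Mathlib. They are finite-dimensional, so that all norms on
them are equivalent and square integrability, smoothness and limits do not depend on the choice;
we take the operator norm of the left regular representation. -/

section Norm

variable (A : Type*) [Ring A] [Algebra ℂ A] [FiniteDimensional ℂ A]

/-- The left regular representation, in some basis of `A`. -/
def regRep : A →ₐ[ℂ]
    (EuclideanSpace ℂ (Fin (Module.finrank ℂ A)) →L[ℂ]
      EuclideanSpace ℂ (Fin (Module.finrank ℂ A))) :=
  ((Module.End.toContinuousLinearMap
      (EuclideanSpace ℂ (Fin (Module.finrank ℂ A)))).toAlgHom.comp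
    (((Module.finBasis ℂ A).equivFun.trans
      (WithLp.linearEquiv 2 ℂ (Fin (Module.finrank ℂ A) → ℂ)).symm).conjAlgEquiv ℂ).toAlgHom).comp
    (Algebra.lmul ℂ A)

theorem regRep_injective : Function.Injective (regRep A) := by
  unfold regRep
  simp only [AlgHom.coe_comp]
  refine Function.Injective.comp (Function.Injective.comp ?_ ?_) Algebra.lmul_injective
  · exact AlgEquiv.injective _
  · exact AlgEquiv.injective _

/-- The normed ring structure given by the left regular representation. -/
abbrev regNormedRing : NormedRing A :=
  NormedRing.induced A _ (regRep A) (regRep_injective A)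

/-- The corresponding normed algebra structure. -/
abbrev regNormedAlgebra : @NormedAlgebra ℂ A _ (regNormedRing A).toSeminormedRing :=
  @NormedAlgebra.induced _ ℂ A _ _ _ _ _ _ _ _ (regRep A)

end Norm

/-! ### The two value algebras -/

/-- Complex quaternions, `ℍ ⊗ ℂ`. -/
abbrev CQuat : Type := Quaternion ℂ

instance : NormedRing CQuat := regNormedRing CQuat
instance : NormedAlgebra ℂ CQuat := regNormedAlgebra CQuat

/-- The quaternion units `e₁, e₂, e₃ = e₁e₂`. -/
def quatGen : Fin 3 → CQuat := ![⟨0, 1, 0, 0⟩, ⟨0, 0, 1, 0⟩, ⟨0, 0, 0, 1⟩]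

/-- The quadratic form `z ↦ -(z₁² + z₂² + z₃²)`. -/
def cliffForm : QuadraticForm ℂ (Fin 3 → ℂ) :=
  QuadraticMap.weightedSumSquares ℂ (fun _ : Fin 3 => (-1 : ℂ))

/-- The complexification of the real Clifford algebra with `e_j² = -1`, `e_j e_k = -e_k e_j`. -/
abbrev CCl3 : Type := CliffordAlgebra cliffForm

instance : FiniteDimensional ℂ CCl3 :=
  haveI : Invertible (2 : ℂ) := invertibleOfNonzero two_ne_zero
  haveI : Module.Finite ℂ (ExteriorAlgebra ℂ (Fin 3 → ℂ)) :=
    Module.Finite.of_basis (Pi.basisFun ℂ (Fin 3)).ExteriorAlgebra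
  Module.Finite.equiv (CliffordAlgebra.equivExterior cliffForm).symm

instance : NormedRing CCl3 := regNormedRing CCl3
instance : NormedAlgebra ℂ CCl3 := regNormedAlgebra CCl3

/-- The generators `e₁, e₂, e₃` of the Clifford algebra. -/
def cliffGen : Fin 3 → CCl3 := fun j => CliffordAlgebra.ι cliffForm (Pi.single j 1)

/-! ### Half-spaces, monogenic functions and Hardy spaces

Points of `ℝ⁴` are pairs `(x₀, x)` with `x₀ : ℝ` and `x : ℝ³`. A sign is an element of `ℤˣ`. -/

/-- The space `ℝ³`. -/
abbrev E3 : Type := EuclideanSpace ℝ (Fin 3)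

/-- A sign as a real number. -/
def sgn (τ : ℤˣ) : ℝ := ((τ : ℤ) : ℝ)

/-- The open upper (`τ = 1`) or lower (`τ = -1`) half-space of `ℝ⁴`. -/
def halfSpace (τ : ℤˣ) : Set (ℝ × E3) := {p | 0 < sgn τ * p.1}

/-- The part in the half-space of the cone with vertex `(0, x)` and aperture `a`. -/
def cone (τ : ℤˣ) (a : ℝ) (x : E3) : Set (ℝ × E3) :=
  {p | p ∈ halfSpace τ ∧ ‖p.2 - x‖ < a * |p.1|}

section Generic

variable {A : Type*} [NormedRing A] [NormedAlgebra ℂ A]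

/-- The vector `x₁e₁ + x₂e₂ + x₃e₃`. -/
def vec (e : Fin 3 → A) (x : E3) : A := ∑ j, ((x j : ℝ) : ℂ) • e j

/-- `D_σ F = ∂₀F + σ ∑ e_k ∂_k F`: for `σ = 1` the operator `D = ∑ e_k ∂_k` with `e₀ = 1`, for
`σ = -1` its conjugate. -/
def diracOp (e : Fin 3 → A) (σ : ℤˣ) (F : ℝ × E3 → A) (p : ℝ × E3) : A :=
  fderiv ℝ F p (1, 0) +
    (sgn σ : ℂ) • ∑ k, e k * fderiv ℝ F p (0, EuclideanSpace.single k (1 : ℝ))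

/-- `F` belongs to the monogenic Hardy space `H²` of the half-space of sign `τ`; only the values of
`F` in that half-space matter. -/
structure IsMonogenicHardy (e : Fin 3 → A) (σ τ : ℤˣ) (F : ℝ × E3 → A) : Prop where
  smooth : ContDiffOn ℝ ∞ F (halfSpace τ)
  monogenic : ∀ p ∈ halfSpace τ, diracOp e σ F p = 0
  bounded : ∃ C : ℝ≥0, ∀ t : ℝ, 0 < t →
    eLpNorm (fun x : E3 => F (sgn τ * t, x)) 2 volume ≤ C

/-- `F` has the non-tangential limit `f` (through cones of every aperture) at almost every boundary
point of the half-space of sign `τ`. -/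
def HasBoundaryValue (τ : ℤˣ) (F : ℝ × E3 → A) (f : Lp A 2 (volume : Measure E3)) : Prop :=
  ∀ᵐ x : E3, ∀ a : ℝ, 0 < a → Tendsto F (𝓝[cone τ a x] (0, x)) (𝓝 (f x))

/-- The space of boundary values in `L²(ℝ³, A)` of the monogenic Hardy space. -/
def hardyBoundarySpace (e : Fin 3 → A) (σ τ : ℤˣ) : Set (Lp A 2 (volume : Measure E3)) :=
  {f | ∃ F : ℝ × E3 → A, IsMonogenicHardy e σ τ F ∧ HasBoundaryValue τ F f}

/-! ### The spinor subspaces -/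

/-- `Spin(3)`: the products of two unit vectors. -/
def spin3 (e : Fin 3 → A) : Set A :=
  {s | ∃ u v : E3, ‖u‖ = 1 ∧ ‖v‖ = 1 ∧ s = vec e u * vec e v}

/-- `γ` is a measurable choice, for `u` in the unit sphere, of `γ(u) ∈ Spin(3)` with
`γ(u) e₃ γ(u)⁻¹ = u` (elements of `Spin(3)` are invertible). Values of `γ` off the sphere are
irrelevant. -/
structure IsSpinSection (e : Fin 3 → A) (γ : E3 → A) : Prop where
  measurable : StronglyMeasurable γ
  mem_spin : ∀ u : E3, ‖u‖ = 1 → γ u ∈ spin3 e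
  rotates : ∀ u : E3, ‖u‖ = 1 → γ u * e 2 = vec e u * γ u

/-- The functions `y ↦ γ(y/|y|) β(y) w` in `L²(ℝ³, A)` with `β ∈ L²(ℝ³, ℂ)`. -/
def spinorSpace (γ : E3 → A) (w : A) : Submodule ℂ (Lp A 2 (volume : Measure E3)) where
  carrier := {g | ∃ β : Lp ℂ 2 (volume : Measure E3),
    ∀ᵐ y : E3, g y = β y • (γ (‖y‖⁻¹ • y) * w)}
  zero_mem' := ⟨0, by
    filter_upwards [Lp.coeFn_zero A 2 (volume : Measure E3),
      Lp.coeFn_zero ℂ 2 (volume : Measure E3)] with y h1 h2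
    rw [h1, h2, Pi.zero_apply, Pi.zero_apply, zero_smul]⟩
  add_mem' := by
    rintro g g' ⟨β, h⟩ ⟨β', h'⟩
    refine ⟨β + β', ?_⟩
    filter_upwards [h, h', Lp.coeFn_add g g', Lp.coeFn_add β β'] with y h1 h2 h3 h4
    rw [h3, h4, Pi.add_apply, Pi.add_apply, h1, h2, add_smul]
  smul_mem' := by
    rintro c g ⟨β, h⟩
    refine ⟨c • β, ?_⟩
    filter_upwards [h, Lp.coeFn_smul c g, Lp.coeFn_smul c β] with y h1 h2 h3
    rw [h2, h3, Pi.smul_apply, Pi.smul_apply, h1, smul_eq_mul, mul_smul]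

/-- The Fourier transform `g ↦ ∫ e^{2πiσ⟨x,ξ⟩} g(ξ) dξ` of scalar `L²` functions. -/
def scalarFourier (σ : ℤˣ) : Lp ℂ 2 (volume : Measure E3) ≃ₗᵢ[ℂ] Lp ℂ 2 (volume : Measure E3) :=
  if σ = 1 then (Lp.fourierTransformₗᵢ E3 ℂ).symm else Lp.fourierTransformₗᵢ E3 ℂ

/-- The image of a subspace of `L²(ℝ³, A)` under the Fourier transform, which acts on `A`-valued
functions componentwise. -/
def fourierImage (σ : ℤˣ) (S : Submodule ℂ (Lp A 2 (volume : Measure E3))) :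
    Submodule ℂ (Lp A 2 (volume : Measure E3)) where
  carrier := {f | ∃ g ∈ S, ∀ l : A →L[ℂ] ℂ,
    l.compLpL 2 volume f = scalarFourier σ (l.compLpL 2 volume g)}
  zero_mem' := ⟨0, S.zero_mem, fun l => by simp⟩
  add_mem' := by
    rintro f f' ⟨g, hg, h⟩ ⟨g', hg', h'⟩
    exact ⟨g + g', S.add_mem hg hg', fun l => by simp only [map_add, h l, h' l]⟩
  smul_mem' := by
    rintro c f ⟨g, hg, h⟩
    exact ⟨c • g, S.smul_mem c hg, fun l => by simp only [map_smul, h l]⟩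

end Generic

/-- The quaternionic spinors: `e₁ + ie₂, 1 + ie₃` for the sign `+` and `1 - ie₃, e₁ - ie₂` for the
sign `-`. -/
def quatSpinor (τ : ℤˣ) : Fin 2 → CQuat :=
  let e := quatGen
  if τ = 1 then ![e 0 + Complex.I • e 1, 1 + Complex.I • e 2]
  else ![1 - Complex.I • e 2, e 0 - Complex.I • e 1]

/-- The Clifford spinors. The first two of each sign lie in the two-sided ideal generated by
`1 - e₃e₁e₂`, the last two in the complementary one. -/
def cliffSpinor (τ : ℤˣ) : Fin 4 → CCl3 :=
  let e := cliffGen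
  let p := e 2 * e 0 * e 1
  if τ = 1 then
    ![(1 - p) * (e 0 + Complex.I • e 1), (1 - p) * (1 + Complex.I • (e 0 * e 1)),
      (1 + p) * (e 0 - Complex.I • e 1), (1 + p) * (1 - Complex.I • (e 0 * e 1))]
  else
    ![(1 - p) * (1 - Complex.I • (e 0 * e 1)), (1 - p) * (e 0 - Complex.I • e 1),
      (1 + p) * (1 + Complex.I • (e 0 * e 1)), (1 + p) * (e 0 + Complex.I • e 1)]

/-- The subspace `H^τ` of `L²(ℝ³, ℍ ⊗ ℂ)`. -/
def quatH (γ : E3 → CQuat) (σ τ : ℤˣ) : Submodule ℂ (Lp CQuat 2 (volume : Measure E3)) :=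
  ⨆ j, fourierImage σ (spinorSpace γ (quatSpinor τ j))

/-- The subspace `H^τ` of `L²(ℝ³, Cl₃ ⊗ ℂ)`. -/
def cliffH (γ : E3 → CCl3) (σ τ : ℤˣ) : Submodule ℂ (Lp CCl3 2 (volume : Measure E3)) :=
  ⨆ j, fourierImage σ (spinorSpace γ (cliffSpinor τ j))

end

noncomputable section

open scoped SchwartzMap InnerProductSpace

/-! ### The Fourier transform of square-integrable vector-valued functions -/

/-! Under the Fourier transform in x, the equation D_σ F = 0 becomes an ordinary differential
equation in x₀ for almost every ξ: ∂₀ acts as -2π times left multiplication by iξ, whatever σ is,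
since the sign in the kernel cancels the one in D_σ. As ξ² = -|ξ|², the element iξ has eigenvalues
±|ξ|, with projections (1 ± iξ/|ξ|)/2. Solutions are exponentials e^{∓2πx₀|ξ|}, and a uniform L²
bound on the slices leaves only the one decaying away from the boundary. Hence the Hardy functions
of the half-space of sign τ are exactly the integrals of e^{2πiσ⟨x,ξ⟩} e^{-2π|x₀||ξ|} g(ξ) with g in
L² and iξ g(ξ) = τ|ξ| g(ξ); see `isMonogenicHardy_hardyExt` and `exists_eq_hardyExt`.

The second of these avoids differentiating the transform of F in x₀. Instead, F is paired with right
monogenic test functions whose transforms are explicit. The product has a divergence-free flux, so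
the slice integrals are constant in time (`integral_slice_mul_eq`), and Parseval turns this into the
evolution law of each spectral component (`spectral_slices_ae_eq`).

The exponential e^{-2πt|ξ|} is the transform of the Poisson kernel, so F is the Poisson integral of
the Fourier transform f of g (`fourierInt_exp_smul_eq_poisson`). It converges non-tangentially to f
at Lebesgue points (`ae_tendsto_poisson`). Since f determines g and g determines F, the boundary
space consists of the Fourier transforms of such spectral g (`mem_hardyBoundarySpace_iff`).

Finally, γ(ω)e₃ = ωγ(ω) turns the condition on g into the constant condition i e₃ v = τ v for v =
γ⁻¹g. The listed spinors span this eigenspace: their span is a right ideal containing 1 + τ i e₃,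
and (1 + τ i e₃)a = 2a for every eigenvector a (`mem_span_of_eigen`). Expanding v in them with L²
coefficients gives `iSup_spinorSpace_eq_hardyBoundarySpace`. -/

/-- The kernel `e^{2πiσ⟨x,ξ⟩}`. -/
def expKer (σ : ℤˣ) (x ξ : E3) : ℂ :=
  Complex.exp (2 * Real.pi * Complex.I * sgn σ * (⟪x, ξ⟫_ℝ : ℝ))

@[simp] theorem sgn_one : sgn 1 = 1 := by simp [sgn]

@[simp] theorem sgn_neg (σ : ℤˣ) : sgn (-σ) = -sgn σ := by simp [sgn]

@[simp] theorem sgn_mul_self (σ : ℤˣ) : sgn σ * sgn σ = 1 := by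
  rcases Int.units_eq_one_or σ with rfl | rfl <;> simp [sgn]

theorem sgn_mul (σ τ : ℤˣ) : sgn (σ * τ) = sgn σ * sgn τ := by simp [sgn]

@[simp] theorem abs_sgn (σ : ℤˣ) : |sgn σ| = 1 := by
  rcases Int.units_eq_one_or σ with rfl | rfl <;> simp [sgn]

@[simp] theorem norm_expKer (σ : ℤˣ) (x ξ : E3) : ‖expKer σ x ξ‖ = 1 := by
  rw [expKer, show 2 * (Real.pi : ℂ) * Complex.I * sgn σ * (⟪x, ξ⟫_ℝ : ℝ) =
    ((2 * Real.pi * sgn σ * ⟪x, ξ⟫_ℝ : ℝ) : ℂ) * Complex.I by push_cast; ring]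
  exact Complex.norm_exp_ofReal_mul_I _

theorem continuous_expKer (σ : ℤˣ) : Continuous fun p : E3 × E3 => expKer σ p.1 p.2 := by
  unfold expKer
  fun_prop

theorem expKer_comm (σ : ℤˣ) (x ξ : E3) : expKer σ x ξ = expKer σ ξ x := by
  rw [expKer, expKer, real_inner_comm]

/-! ### Fourier integrals of integrable functions -/

section FourierInt

variable {V : Type*} [NormedAddCommGroup V] [NormedSpace ℂ V]

/-- The Fourier integral `∫ e^{2πiσ⟨x,ξ⟩} g(ξ) dξ`. -/
def fourierInt (σ : ℤˣ) (g : E3 → V) (x : E3) : V := ∫ ξ, expKer σ x ξ • g ξ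

theorem fourierInt_one (g : E3 → V) : fourierInt 1 g = 𝓕⁻ g := by
  ext x
  rw [Real.fourierInv_eq', fourierInt]
  refine integral_congr_ae (.of_forall fun ξ => ?_)
  simp only [expKer, sgn_one, real_inner_comm]
  congr 2
  push_cast
  ring

theorem fourierInt_neg_one (g : E3 → V) : fourierInt (-1) g = 𝓕 g := by
  ext x
  rw [Real.fourier_eq', fourierInt]
  refine integral_congr_ae (.of_forall fun ξ => ?_)
  simp only [expKer, sgn_neg, sgn_one, real_inner_comm]
  congr 2
  push_cast
  ring

theorem integrable_expKer_smul {g : E3 → V} (hg : Integrable g) (σ : ℤˣ) (x : E3) :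
    Integrable fun ξ => expKer σ x ξ • g ξ := by
  refine hg.bdd_smul 1 ?_ (.of_forall fun ξ => (norm_expKer σ x ξ).le)
  exact ((continuous_expKer σ).comp (by fun_prop : Continuous fun ξ : E3 => (x, ξ))).aestronglyMeasurable

theorem continuous_fourierInt [CompleteSpace V] {g : E3 → V} (hg : Integrable g) (σ : ℤˣ) :
    Continuous (fourierInt σ g) := by
  refine continuous_of_dominated (bound := fun ξ => ‖g ξ‖) ?_ ?_ hg.norm ?_
  · exact fun x => (integrable_expKer_smul hg σ x).aestronglyMeasurable
  · exact fun x => .of_forall fun ξ => by simp [norm_smul]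
  · refine .of_forall fun ξ => ?_
    have := (continuous_expKer σ).comp (by fun_prop : Continuous fun x : E3 => (x, ξ))
    exact this.smul continuous_const

theorem map_fourierInt {W : Type*} [NormedAddCommGroup W] [NormedSpace ℂ W] [CompleteSpace V]
    [CompleteSpace W] (l : V →L[ℂ] W) {g : E3 → V} (hg : Integrable g) (σ : ℤˣ) (x : E3) :
    l (fourierInt σ g x) = fourierInt σ (fun ξ => l (g ξ)) x := by
  rw [fourierInt, fourierInt, ← l.integral_comp_comm (integrable_expKer_smul hg σ x)]
  simp

/-- Fubini and the symmetry of the kernel in its two arguments. The pairing is bilinear, without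
conjugation, so the same sign σ appears on both sides. -/
theorem integral_fourierInt_mul {g h : E3 → ℂ} (hg : Integrable g) (hh : Integrable h) (σ : ℤˣ) :
    ∫ x, fourierInt σ g x * h x = ∫ x, g x * fourierInt σ h x := by
  have key : ∀ σ : ℤˣ, Integrable (Function.uncurry fun x y : E3 => expKer σ x y * g y * h x) := by
    intro σ
    have h1 := (hh.mul_prod hg).bdd_mul (c := 1) (f := fun p : E3 × E3 => expKer σ p.1 p.2)
      (continuous_expKer σ).aestronglyMeasurable (.of_forall fun p => (norm_expKer σ _ _).le)
    refine h1.congr (.of_forall fun p => ?_)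
    simp only [Function.uncurry]
    ring
  calc ∫ x, fourierInt σ g x * h x = ∫ x, ∫ y, expKer σ x y * g y * h x := by
        simp only [fourierInt, smul_eq_mul, integral_mul_const]
    _ = ∫ y, ∫ x, expKer σ x y * g y * h x := integral_integral_swap (key σ)
    _ = ∫ y, g y * fourierInt σ h y := by
        refine integral_congr_ae (.of_forall fun y => ?_)
        simp only [fourierInt, smul_eq_mul, ← integral_const_mul]
        refine integral_congr_ae (.of_forall fun x => ?_)
        simp only [expKer_comm σ y x]
        ring

end FourierInt

/-! ### The scalar L² transform: duality and agreement with the integral -/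

section Scalar

theorem scalarFourier_neg (σ : ℤˣ) : scalarFourier (-σ) = (scalarFourier σ).symm := by
  rcases Int.units_eq_one_or σ with rfl | rfl <;> simp [scalarFourier]

theorem scalarFourier_toLp (σ : ℤˣ) (φ : 𝓢(E3, ℂ)) :
    ∃ ψ : 𝓢(E3, ℂ), scalarFourier σ (φ.toLp 2) = ψ.toLp 2 ∧ ⇑ψ = fourierInt σ φ := by
  rcases Int.units_eq_one_or σ with rfl | rfl
  · refine ⟨𝓕⁻ φ, ?_, ?_⟩
    · rw [← SchwartzMap.toLp_fourierInv_eq]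
      simp only [scalarFourier, if_true]
      rfl
    · rw [fourierInt_one, SchwartzMap.fourierInv_coe]
  · refine ⟨𝓕 φ, ?_, ?_⟩
    · rw [← SchwartzMap.toLp_fourier_eq]
      simp only [scalarFourier, show ¬ ((-1 : ℤˣ) = 1) by decide, if_false]
      rfl
    · rw [fourierInt_neg_one, SchwartzMap.fourier_coe]

/-- Writes the bilinear pairing through the inner product, so that its continuity on L² is available
for density arguments. -/
theorem inner_star_Lp (u v : Lp ℂ 2 (volume : Measure E3)) :
    ⟪star u, v⟫_ℂ = ∫ x, u x * v x := by
  rw [L2.inner_def]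
  refine integral_congr_ae ?_
  filter_upwards [Lp.coeFn_star u] with x hx
  rw [hx]
  simp [mul_comm]

/-- Both sides are continuous in the pair of functions, and for Schwartz functions, which are dense,
the identity is `integral_fourierInt_mul`. -/
theorem integral_scalarFourier_mul (σ : ℤˣ) (u v : Lp ℂ 2 (volume : Measure E3)) :
    ∫ x, scalarFourier σ u x * v x = ∫ x, u x * scalarFourier σ v x := by
  have hd : DenseRange (SchwartzMap.toLpCLM ℂ (E := E3) ℂ 2 volume) :=
    SchwartzMap.denseRange_toLpCLM ENNReal.ofNat_ne_top
  simp only [← inner_star_Lp]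
  have hc : Continuous fun p : Lp ℂ 2 (volume : Measure E3) × Lp ℂ 2 (volume : Measure E3) =>
      ⟪star (scalarFourier σ p.1), p.2⟫_ℂ - ⟪star p.1, scalarFourier σ p.2⟫_ℂ := by
    have h := (scalarFourier σ).continuous
    have h1 : Continuous fun u : Lp ℂ 2 (volume : Measure E3) => star u := by
      refine Isometry.continuous fun u v => ?_
      rw [Lp.edist_def, Lp.edist_def]
      refine eLpNorm_congr_norm_ae ?_
      filter_upwards [Lp.coeFn_star u, Lp.coeFn_star v] with x h1 h2
      simp only [Pi.sub_apply, h1, h2, Pi.star_apply, ← star_sub, norm_star]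
    exact ((h1.comp (h.comp continuous_fst)).inner continuous_snd).sub
      ((h1.comp continuous_fst).inner (h.comp continuous_snd))
  have := DenseRange.induction_on₂ (p := fun u v : Lp ℂ 2 (volume : Measure E3) =>
    ⟪star (scalarFourier σ u), v⟫_ℂ - ⟪star u, scalarFourier σ v⟫_ℂ = 0) hd ?_ ?_ u v
  · exact sub_eq_zero.1 this
  · exact isClosed_eq hc continuous_const
  · intro φ ψ
    obtain ⟨φ', h1, h2⟩ := scalarFourier_toLp σ φ
    obtain ⟨ψ', h3, h4⟩ := scalarFourier_toLp σ ψ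
    simp only [SchwartzMap.toLpCLM_apply]
    rw [h1, h3, sub_eq_zero, inner_star_Lp, inner_star_Lp]
    calc _ = ∫ x, φ' x * ψ x := integral_congr_ae (by
            filter_upwards [φ'.coeFn_toLp 2 volume, ψ.coeFn_toLp 2 volume] with x h5 h6
            rw [h5, h6])
      _ = ∫ x, φ x * ψ' x := by
            rw [h2, h4]
            exact integral_fourierInt_mul φ.integrable ψ.integrable σ
      _ = _ := integral_congr_ae (by
            filter_upwards [φ.coeFn_toLp 2 volume, ψ'.coeFn_toLp 2 volume] with x h5 h6
            rw [h5, h6])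

/-- On integrable functions the Fourier transform is given by the Fourier integral. -/
theorem scalarFourier_eq_fourierInt (σ : ℤˣ) {g : E3 → ℂ} (h1 : Integrable g) (h2 : MemLp g 2) :
    scalarFourier σ (h2.toLp g) =ᵐ[volume] fourierInt σ g := by
  refine ae_eq_of_integral_contDiff_smul_eq ?_ ?_ ?_
  · exact (Lp.memLp _).locallyIntegrable (by norm_num)
  · exact (continuous_fourierInt h1 σ).locallyIntegrable
  -- A test function χ is Schwartz, so duality moves the transform onto it on both sides: L² duality
  -- on the left, Fubini on the right.
  · intro χ hχ hχ'
    have hs : HasCompactSupport fun x => (χ x : ℂ) :=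
      hχ'.comp_left (g := fun r : ℝ => (r : ℂ)) (by simp)
    have hd : ContDiff ℝ ∞ fun x => (χ x : ℂ) := Complex.ofRealCLM.contDiff.comp hχ
    set φ : 𝓢(E3, ℂ) := hs.toSchwartzMap hd with hφ
    have hφa : ∀ x, φ x = (χ x : ℂ) := fun x => rfl
    obtain ⟨φ', h3, h4⟩ := scalarFourier_toLp σ φ
    calc _ = ∫ x, scalarFourier σ (h2.toLp g) x * φ.toLp 2 volume x := integral_congr_ae (by
            filter_upwards [φ.coeFn_toLp 2 volume] with x h5
            rw [h5, hφa, mul_comm, Complex.real_smul])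
      _ = ∫ x, g x * φ' x := by
            rw [integral_scalarFourier_mul, h3]
            refine integral_congr_ae ?_
            filter_upwards [φ'.coeFn_toLp 2 volume, h2.coeFn_toLp] with x h5 h6
            rw [h5, h6]
      _ = ∫ x, fourierInt σ g x * φ x := by
            rw [h4, integral_fourierInt_mul h1 φ.integrable]
      _ = _ := integral_congr_ae (.of_forall fun x => by
            simp only [hφa, mul_comm, Complex.real_smul])

end Scalar

/-! ### Fourier pairs with values in a finite-dimensional space -/

section Vector

variable {V W : Type*} [NormedAddCommGroup V] [NormedSpace ℂ V] [NormedAddCommGroup W]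
  [NormedSpace ℂ W]

/-- `f` is the Fourier transform of `g`, both square integrable with values in `V`. -/
structure IsFourierPair (σ : ℤˣ) (g f : E3 → V) : Prop where
  left : MemLp g 2
  right : MemLp f 2
  eq : ∀ l : V →L[ℂ] ℂ, ∀ (h : MemLp (fun x => l (g x)) 2),
    (fun x => l (f x)) =ᵐ[volume] scalarFourier σ (h.toLp _)

theorem MemLp.clm_comp {g : E3 → V} (hg : MemLp g 2) (l : V →L[ℂ] W) :
    MemLp (fun x => l (g x)) 2 := l.comp_memLp' hg

theorem IsFourierPair.map {σ : ℤˣ} {g f : E3 → V} (h : IsFourierPair σ g f) (T : V →L[ℂ] W) :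
    IsFourierPair σ (fun x => T (g x)) (fun x => T (f x)) where
  left := MemLp.clm_comp h.left T
  right := MemLp.clm_comp h.right T
  eq l hl := h.eq (l.comp T) hl

theorem IsFourierPair.congr {σ : ℤˣ} {g g' f f' : E3 → V} (h : IsFourierPair σ g f)
    (hg : g =ᵐ[volume] g') (hf : f =ᵐ[volume] f') : IsFourierPair σ g' f' where
  left := h.left.ae_eq hg
  right := h.right.ae_eq hf
  eq l hl := by
    have h1 : (MemLp.clm_comp h.left l).toLp _ = hl.toLp _ := by
      rw [MemLp.toLp_eq_toLp_iff]
      filter_upwards [hg] with x hx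
      rw [hx]
    rw [← h1]
    refine EventuallyEq.trans ?_ (h.eq l _)
    filter_upwards [hf] with x hx
    rw [hx]

/-- The inverse of the transform with sign σ is the transform with sign -σ. -/
theorem IsFourierPair.symm {σ : ℤˣ} {g f : E3 → V} (h : IsFourierPair σ g f) :
    IsFourierPair (-σ) f g where
  left := h.right
  right := h.left
  eq l hl := by
    have h1 := MemLp.clm_comp h.left l
    have h2 : hl.toLp _ = scalarFourier σ (h1.toLp _) := by
      refine Lp.ext (hl.coeFn_toLp.trans (h.eq l h1))
    rw [h2, scalarFourier_neg, LinearIsometryEquiv.symm_apply_apply]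
    exact h1.coeFn_toLp.symm

theorem IsFourierPair.add {σ : ℤˣ} {g f g' f' : E3 → V} (h : IsFourierPair σ g f)
    (h' : IsFourierPair σ g' f') : IsFourierPair σ (fun x => g x + g' x) (fun x => f x + f' x) where
  left := h.left.add h'.left
  right := h.right.add h'.right
  eq l hl := by
    have h1 := MemLp.clm_comp h.left l
    have h2 := MemLp.clm_comp h'.left l
    have h3 : hl.toLp _ = h1.toLp _ + h2.toLp _ := by
      rw [← MemLp.toLp_add, MemLp.toLp_eq_toLp_iff]
      exact .of_forall fun x => by simp
    rw [h3, map_add]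
    filter_upwards [h.eq l h1, h'.eq l h2, Lp.coeFn_add (scalarFourier σ (h1.toLp _))
      (scalarFourier σ (h2.toLp _))] with x h4 h5 h6
    rw [h6, Pi.add_apply, ← h4, ← h5, map_add]

theorem IsFourierPair.zero (σ : ℤˣ) : IsFourierPair σ (fun _ => (0 : V)) (fun _ => (0 : V)) where
  left := MemLp.zero
  right := MemLp.zero
  eq l hl := by
    have h3 : hl.toLp _ = 0 := by
      refine Lp.ext ?_
      filter_upwards [hl.coeFn_toLp, Lp.coeFn_zero ℂ 2 (volume : Measure E3)] with x h1 h2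
      rw [h1, h2, map_zero, Pi.zero_apply]
    rw [h3]
    filter_upwards [Lp.coeFn_zero ℂ 2 (volume : Measure E3)] with x h2
    rw [map_zero, map_zero, h2, Pi.zero_apply]

theorem IsFourierPair.sum {ι : Type*} (s : Finset ι) {σ : ℤˣ} {g f : ι → E3 → V}
    (h : ∀ i ∈ s, IsFourierPair σ (g i) (f i)) :
    IsFourierPair σ (fun x => ∑ i ∈ s, g i x) (fun x => ∑ i ∈ s, f i x) := by
  classical
  induction s using Finset.induction_on with
  | empty => simpa using IsFourierPair.zero σ
  | insert i s hi ih =>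
    simp only [Finset.sum_insert hi]
    exact (h i (by simp)).add (ih fun j hj => h j (by simp [hj]))

theorem isFourierPair_scalarFourier (σ : ℤˣ) (u : Lp ℂ 2 (volume : Measure E3)) :
    IsFourierPair σ u (scalarFourier σ u) where
  left := Lp.memLp _
  right := Lp.memLp _
  eq l hl := by
    have h1 : ∀ z : ℂ, l z = l 1 * z := fun z => by
      conv_lhs => rw [← mul_one z, ← smul_eq_mul, map_smul, smul_eq_mul, mul_comm]
    have h2 : hl.toLp _ = l 1 • u := by
      refine Lp.ext ?_
      filter_upwards [hl.coeFn_toLp, Lp.coeFn_smul (l 1) u] with x h3 h4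
      rw [h3, h4, h1, Pi.smul_apply, smul_eq_mul]
    rw [h2, map_smul]
    filter_upwards [Lp.coeFn_smul (l 1) (scalarFourier σ u)] with x h3
    rw [h3, h1, Pi.smul_apply, smul_eq_mul]

theorem IsFourierPair.of_scalar {σ : ℤˣ} {g : E3 → ℂ} (hg : MemLp g 2) :
    IsFourierPair σ g (scalarFourier σ (hg.toLp g)) :=
  (isFourierPair_scalarFourier σ (hg.toLp g)).congr hg.coeFn_toLp .rfl

theorem IsFourierPair.ae_eq_scalar {σ : ℤˣ} {g f : E3 → ℂ} (h : IsFourierPair σ g f) :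
    f =ᵐ[volume] scalarFourier σ (h.left.toLp g) :=
  h.eq (ContinuousLinearMap.id ℂ ℂ) h.left

theorem IsFourierPair.eLpNorm_eq {σ : ℤˣ} {g f : E3 → ℂ} (h : IsFourierPair σ g f) :
    eLpNorm f 2 volume = eLpNorm g 2 volume := by
  rw [eLpNorm_congr_ae h.ae_eq_scalar, ← eLpNorm_congr_ae h.left.coeFn_toLp]
  have := (scalarFourier σ).norm_map (h.left.toLp g)
  rw [Lp.norm_def, Lp.norm_def, ENNReal.toReal_eq_toReal_iff' (Lp.eLpNorm_ne_top _)
    (Lp.eLpNorm_ne_top _)] at this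
  exact this

variable [FiniteDimensional ℂ V] [FiniteDimensional ℂ W]

/-- The coordinate functionals of a finite-dimensional space. -/
def coordCLM (V : Type*) [NormedAddCommGroup V] [NormedSpace ℂ V] [FiniteDimensional ℂ V]
    (i : Fin (Module.finrank ℂ V)) : V →L[ℂ] ℂ :=
  LinearMap.toContinuousLinearMap ((Module.finBasis ℂ V).coord i)

theorem sum_coordCLM_smul (v : V) : ∑ i, coordCLM V i v • Module.finBasis ℂ V i = v :=
  (Module.finBasis ℂ V).sum_repr v

theorem ae_eq_of_forall_clm {f f' : E3 → V}
    (h : ∀ l : V →L[ℂ] ℂ, (fun x => l (f x)) =ᵐ[volume] fun x => l (f' x)) :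
    f =ᵐ[volume] f' := by
  filter_upwards [ae_all_iff.2 fun i => h (coordCLM V i)] with x hx
  rw [← sum_coordCLM_smul (f x), ← sum_coordCLM_smul (f' x)]
  simp only [hx]

theorem isFourierPair_of_coord {σ : ℤˣ} {g f : E3 → V}
    (h : ∀ i, IsFourierPair σ (fun x => coordCLM V i (g x)) (fun x => coordCLM V i (f x))) :
    IsFourierPair σ g f := by
  have := IsFourierPair.sum Finset.univ fun i _ => (h i).map
    (ContinuousLinearMap.toSpanSingleton ℂ (Module.finBasis ℂ V i))
  refine this.congr (.of_forall fun x => ?_) (.of_forall fun x => ?_) <;>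
  simpa using sum_coordCLM_smul _

theorem exists_isFourierPair (σ : ℤˣ) {g : E3 → V} (hg : MemLp g 2) :
    ∃ f, IsFourierPair σ g f := by
  have := IsFourierPair.sum Finset.univ fun i _ =>
    (IsFourierPair.of_scalar (σ := σ) (MemLp.clm_comp hg (coordCLM V i))).map
    (ContinuousLinearMap.toSpanSingleton ℂ (Module.finBasis ℂ V i))
  refine ⟨_, this.congr (.of_forall fun x => ?_) .rfl⟩
  simpa using sum_coordCLM_smul _

theorem IsFourierPair.unique {σ : ℤˣ} {g g' f f' : E3 → V} (h : IsFourierPair σ g f)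
    (h' : IsFourierPair σ g' f') (hg : g =ᵐ[volume] g') : f =ᵐ[volume] f' := by
  refine ae_eq_of_forall_clm fun l => ?_
  have h1 := h.congr hg .rfl
  exact (h1.eq l (MemLp.clm_comp h'.left l)).trans (h'.eq l _).symm

theorem isFourierPair_fourierInt (σ : ℤˣ) {g : E3 → V} (h1 : Integrable g) (h2 : MemLp g 2) :
    IsFourierPair σ g (fourierInt σ g) := by
  refine isFourierPair_of_coord fun i => ?_
  have h3 := MemLp.clm_comp h2 (coordCLM V i)
  refine (IsFourierPair.of_scalar h3).congr .rfl ?_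
  refine (scalarFourier_eq_fourierInt σ ((coordCLM V i).integrable_comp h1) h3).trans ?_
  refine .of_forall fun x => (map_fourierInt _ h1 σ x).symm

omit [FiniteDimensional ℂ V] in
theorem MemLp.integrable_smul_two {u : E3 → ℂ} {g : E3 → V} (hu : MemLp u 2) (hg : MemLp g 2) :
    Integrable fun x => u x • g x :=
  memLp_one_iff_integrable.1 (hg.smul hu)

/-- Parseval's formula. -/
theorem IsFourierPair.integral_smul {σ : ℤˣ} {u v : E3 → ℂ} {g f : E3 → V}
    (h : IsFourierPair σ u v) (h' : IsFourierPair σ g f) :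
    ∫ x, v x • g x = ∫ x, u x • f x := by
  have hl : ∀ l : V →L[ℂ] ℂ, l (∫ x, v x • g x) = l (∫ x, u x • f x) := by
    intro l
    rw [← l.integral_comp_comm (MemLp.integrable_smul_two h.right h'.left),
      ← l.integral_comp_comm (MemLp.integrable_smul_two h.left h'.right)]
    have h1 := MemLp.clm_comp h'.left l
    have := integral_scalarFourier_mul σ (h.left.toLp u) (h1.toLp _)
    refine Eq.trans ?_ (this.trans ?_)
    · refine integral_congr_ae ?_
      filter_upwards [h.ae_eq_scalar, h1.coeFn_toLp] with x h2 h3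
      rw [map_smul, h2, h3, smul_eq_mul]
    · refine integral_congr_ae ?_
      filter_upwards [h'.eq l h1, h.left.coeFn_toLp] with x h2 h3
      rw [map_smul, ← h2, h3, smul_eq_mul]
  rw [← sum_coordCLM_smul (∫ x, v x • g x), ← sum_coordCLM_smul (∫ x, u x • f x)]
  simp only [hl]

theorem eLpNorm_le_sum_coord {f : E3 → V} (hf : AEStronglyMeasurable f) :
    eLpNorm f 2 volume ≤ ∑ i, ENNReal.ofReal ‖Module.finBasis ℂ V i‖ *
      eLpNorm (fun x => coordCLM V i (f x)) 2 volume := by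
  have h1 : f = ∑ i, fun x => coordCLM V i (f x) • Module.finBasis ℂ V i := by
    ext x
    rw [Finset.sum_apply, sum_coordCLM_smul]
  conv_lhs => rw [h1]
  refine (eLpNorm_sum_le (fun i _ => ?_) (by norm_num)).trans (Finset.sum_le_sum fun i _ => ?_)
  · exact ((coordCLM V i).continuous.comp_aestronglyMeasurable hf).smul_const _
  · refine eLpNorm_le_mul_eLpNorm_of_ae_le_mul (.of_forall fun x => ?_) 2
    rw [norm_smul, mul_comm]

/-- The Fourier transform is bounded. -/
theorem exists_eLpNorm_le_of_isFourierPair (V : Type*) [NormedAddCommGroup V] [NormedSpace ℂ V]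
    [FiniteDimensional ℂ V] : ∃ C : ℝ≥0, ∀ (σ : ℤˣ) (g f : E3 → V), IsFourierPair σ g f →
      eLpNorm f 2 volume ≤ C * eLpNorm g 2 volume := by
  -- The norm of V need not come from an inner product. Only the coordinates are transformed
  -- isometrically, and the constant compares the norm with them.
  refine ⟨∑ i, Real.toNNReal ‖Module.finBasis ℂ V i‖ * ‖coordCLM V i‖₊, fun σ g f h => ?_⟩
  refine (eLpNorm_le_sum_coord h.right.1).trans ?_
  rw [ENNReal.ofNNReal_finsetSum, Finset.sum_mul]
  refine Finset.sum_le_sum fun i _ => ?_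
  rw [(h.map (coordCLM V i)).eLpNorm_eq, ENNReal.coe_mul, mul_assoc]
  gcongr
  · rfl
  · exact eLpNorm_le_nnreal_smul_eLpNorm_of_ae_le_mul
      (.of_forall fun x => (coordCLM V i).le_opNNNorm _) 2

end Vector

/-! ### Parseval's formula for products in the algebra -/

section Algebra

variable {A : Type*} [NormedRing A] [NormedAlgebra ℂ A] [FiniteDimensional ℂ A]

omit [NormedAlgebra ℂ A] [FiniteDimensional ℂ A] in
theorem MemLp.integrable_mul_two {u g : E3 → A} (hu : MemLp u 2) (hg : MemLp g 2) :
    Integrable fun x => u x * g x :=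
  memLp_one_iff_integrable.1 (hg.mul hu)

/-- Expanding the left factor in a basis of A reduces this to Parseval for a scalar times a vector;
the order of the factors is kept throughout. -/
theorem IsFourierPair.integral_mul {σ : ℤˣ} {u v g f : E3 → A}
    (h : IsFourierPair σ u v) (h' : IsFourierPair σ g f) :
    ∫ x, v x * g x = ∫ x, u x * f x := by
  have key : ∀ {a b : E3 → A}, MemLp a 2 → MemLp b 2 → ∫ x, a x * b x =
      ∑ i, ∫ x, coordCLM A i (a x) •
        (ContinuousLinearMap.mul ℂ A (Module.finBasis ℂ A i) (b x)) := by
    intro a b ha hb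
    rw [← integral_finsetSum _ fun i _ => MemLp.integrable_smul_two
      (MemLp.clm_comp ha (coordCLM A i)) (MemLp.clm_comp hb _)]
    refine integral_congr_ae (.of_forall fun x => ?_)
    simp only [ContinuousLinearMap.mul_apply', ← smul_mul_assoc, ← Finset.sum_mul,
      sum_coordCLM_smul]
  rw [key h.right h'.left, key h.left h'.right]
  exact Finset.sum_congr rfl fun i _ => (h.map (coordCLM A i)).integral_smul (h'.map _)

end Algebra

/-! ### The Poisson kernel of the half-space and its Fourier transform -/

theorem image_mul_sub_div_Ioi {t b : ℝ} (ht : 0 < t) (hb : 0 < b) :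
    (fun u : ℝ => t * u - b / u) '' Set.Ioi 0 = Set.univ := by
  refine Set.eq_univ_of_forall fun v => ?_
  have h1 : |v| < √(v ^ 2 + 4 * t * b) := by
    rw [← Real.sqrt_sq_eq_abs]
    exact Real.sqrt_lt_sqrt (sq_nonneg v) (by nlinarith [mul_pos ht hb])
  have h2 : √(v ^ 2 + 4 * t * b) ^ 2 = v ^ 2 + 4 * t * b :=
    Real.sq_sqrt (by nlinarith [mul_pos ht hb, sq_nonneg v])
  have h3 : 0 < v + √(v ^ 2 + 4 * t * b) := by linarith [neg_abs_le v]
  -- The positive root of tu² - vu - b = 0.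
  refine ⟨(v + √(v ^ 2 + 4 * t * b)) / (2 * t), by simpa using by positivity, ?_⟩
  set s := √(v ^ 2 + 4 * t * b)
  field_simp
  nlinarith

theorem injOn_mul_sub_div_Ioi {t b : ℝ} (ht : 0 < t) (hb : 0 < b) :
    Set.InjOn (fun u : ℝ => t * u - b / u) (Set.Ioi 0) := by
  refine StrictMonoOn.injOn fun u hu v hv huv => ?_
  simp only [Set.mem_Ioi] at hu hv
  have h1 : b / v < b / u := div_lt_div_of_pos_left hb hu huv
  have h2 : t * u < t * v := by gcongr
  linarith

theorem hasDerivAt_mul_sub_div (t b : ℝ) {u : ℝ} (hu : 0 < u) :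
    HasDerivAt (fun u : ℝ => t * u - b / u) (t + b / u ^ 2) u := by
  have h1 := ((hasDerivAt_id u).const_mul t).sub ((hasDerivAt_inv hu.ne').const_mul b)
  refine (h1.congr_deriv ?_).congr_of_eventuallyEq (.of_forall fun v => ?_)
  · field_simp
    ring
  · simp [div_eq_mul_inv]

/-- The substitution v = tu - b/u maps (0, ∞) onto ℝ with derivative t + b/u², so the integral
weighted by t + b/u² is Gaussian. The inversion u ↦ b/(tu) shows that the weights t and b/u²
contribute equally, so each gives half of √π. -/
theorem integral_exp_neg_sub_sq_Ioi {t b : ℝ} (ht : 0 < t) (hb : 0 < b) :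
    ∫ u in Set.Ioi 0, Real.exp (-(t * u - b / u) ^ 2) = √Real.pi / (2 * t) := by
  set f : ℝ → ℝ := fun u => Real.exp (-(t * u - b / u) ^ 2) with hf
  have hd : ∀ u ∈ Set.Ioi (0 : ℝ), HasDerivWithinAt (fun u : ℝ => t * u - b / u)
    (t + b / u ^ 2) (Set.Ioi 0) u := fun u hu => (hasDerivAt_mul_sub_div t b hu).hasDerivWithinAt
  have hg : Integrable fun v : ℝ => Real.exp (-v ^ 2) := by
    simpa using integrable_exp_neg_mul_sq one_pos
  have hcong : ∀ u ∈ Set.Ioi (0 : ℝ),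
      |t + b / u ^ 2| • Real.exp (-(t * u - b / u) ^ 2) = t * f u + b / u ^ 2 * f u := by
    intro u hu
    rw [abs_of_pos (by have := Set.mem_Ioi.1 hu; positivity), smul_eq_mul, add_mul]
  have hint : IntegrableOn (fun u => t * f u + b / u ^ 2 * f u) (Set.Ioi 0) := by
    have := (integrableOn_image_iff_integrableOn_abs_deriv_smul measurableSet_Ioi hd
      (injOn_mul_sub_div_Ioi ht hb) (fun v => Real.exp (-v ^ 2))).1
      (by rw [image_mul_sub_div_Ioi ht hb]; exact hg.integrableOn)
    exact this.congr_fun hcong measurableSet_Ioi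
  have h1 : ∫ u in Set.Ioi 0, (t * f u + b / u ^ 2 * f u) = √Real.pi := by
    have := integral_image_eq_integral_abs_deriv_smul measurableSet_Ioi hd
      (injOn_mul_sub_div_Ioi ht hb) (fun v => Real.exp (-v ^ 2))
    rw [image_mul_sub_div_Ioi ht hb, setIntegral_congr_fun measurableSet_Ioi hcong] at this
    rw [← this]
    simpa using integral_gaussian 1
  have hmeas : AEStronglyMeasurable f (volume.restrict (Set.Ioi 0)) := by
    refine ContinuousOn.aestronglyMeasurable (fun u hu => ?_) measurableSet_Ioi
    have : u ≠ 0 := (Set.mem_Ioi.1 hu).ne'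
    refine ContinuousAt.continuousWithinAt ?_
    fun_prop (disch := assumption)
  have hint1 : IntegrableOn (fun u => t * f u) (Set.Ioi 0) := by
    refine Integrable.mono' hint (hmeas.const_mul t) ?_
    refine (ae_restrict_iff' measurableSet_Ioi).2 (.of_forall fun u hu => ?_)
    have h3 : 0 < f u := Real.exp_pos _
    rw [Real.norm_of_nonneg (by positivity)]
    have : 0 ≤ b / u ^ 2 * f u := by positivity
    linarith
  have hint2 : IntegrableOn (fun u => b / u ^ 2 * f u) (Set.Ioi 0) := by
    refine (hint.sub hint1).congr_fun (fun u _ => ?_) measurableSet_Ioi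
    simp
  -- The inversion u ↦ b/(tu) only changes the sign of tu - b/u, hence preserves f, and its Jacobian
  -- turns the weight t into b/u².
  have h2 : ∫ u in Set.Ioi 0, t * f u = ∫ u in Set.Ioi 0, b / u ^ 2 * f u := by
    have himg : (fun u : ℝ => b / t * u⁻¹) '' Set.Ioi 0 = Set.Ioi 0 := by
      ext v
      constructor
      · rintro ⟨u, hu, rfl⟩
        have := Set.mem_Ioi.1 hu
        exact Set.mem_Ioi.2 (by positivity)
      · intro hv
        have := Set.mem_Ioi.1 hv
        refine ⟨b / t * v⁻¹, Set.mem_Ioi.2 (by positivity), ?_⟩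
        field_simp
    have hinj : Set.InjOn (fun u : ℝ => b / t * u⁻¹) (Set.Ioi 0) := by
      intro u _ v _ huv
      exact inv_injective (mul_left_cancel₀ (by positivity) huv)
    have hd2 : ∀ u ∈ Set.Ioi (0 : ℝ), HasDerivWithinAt (fun u : ℝ => b / t * u⁻¹)
        (b / t * -(u ^ 2)⁻¹) (Set.Ioi 0) u := fun u hu =>
      ((hasDerivAt_inv (Set.mem_Ioi.1 hu).ne').const_mul _).hasDerivWithinAt
    have := integral_image_eq_integral_abs_deriv_smul measurableSet_Ioi hd2 hinj (fun v => t * f v)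
    rw [himg] at this
    rw [this]
    refine setIntegral_congr_fun measurableSet_Ioi fun u hu => ?_
    have hu := Set.mem_Ioi.1 hu
    have h4 : f (b / t * u⁻¹) = f u := by
      simp only [hf]
      congr 2
      field_simp
      ring
    rw [h4, mul_neg, abs_neg, abs_of_pos (by positivity), smul_eq_mul]
    field_simp
  have h3 := integral_add hint1 hint2
  rw [h1, ← h2, integral_const_mul] at h3
  rw [eq_div_iff (by positivity)]
  linarith

/-- Completing the square, t²u² + b²/u² = (tu - b/u)² + 2tb. The case b = 0, needed at frequency
zero, is a plain Gaussian because the substitution degenerates there. -/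
theorem integral_exp_neg_sq_add_inv_sq_Ioi {t b : ℝ} (ht : 0 < t) (hb : 0 ≤ b) :
    ∫ u in Set.Ioi 0, Real.exp (-(t ^ 2 * u ^ 2 + b ^ 2 / u ^ 2)) =
      √Real.pi / (2 * t) * Real.exp (-(2 * t * b)) := by
  rcases hb.eq_or_lt with rfl | hb
  · have := integral_gaussian_Ioi (t ^ 2)
    simp only [ne_eq, OfNat.ofNat_ne_zero, not_false_eq_true, zero_pow, zero_div, add_zero,
      mul_zero, neg_zero, Real.exp_zero, mul_one, ← neg_mul]
    rw [this, Real.sqrt_div Real.pi_pos.le, Real.sqrt_sq ht.le]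
    field_simp
  · rw [← integral_exp_neg_sub_sq_Ioi ht hb, ← integral_mul_const]
    refine setIntegral_congr_fun measurableSet_Ioi fun u hu => ?_
    have hu := Set.mem_Ioi.1 hu
    rw [← Real.exp_add]
    congr 1
    field_simp
    ring

/-- The Poisson kernel of the half-space over `ℝ³`. -/
def poissonKer (t : ℝ) (z : E3) : ℝ := t / (Real.pi ^ 2 * (t ^ 2 + ‖z‖ ^ 2) ^ 2)

theorem poissonKer_nonneg {t : ℝ} (ht : 0 ≤ t) (z : E3) : 0 ≤ poissonKer t z := by
  unfold poissonKer
  positivity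

/-- Subordination: the Gamma integral for (t² + |z|²)⁻² exhibits the Poisson kernel as a
superposition of Gaussians in z, whose Fourier transforms are known. -/
theorem poissonKer_eq_integral {t : ℝ} (ht : 0 < t) (z : E3) :
    poissonKer t z = ∫ u in Set.Ioi (0 : ℝ), 2 * t / Real.pi ^ 2 *
      (u ^ 3 * Real.exp (-(t ^ 2 + ‖z‖ ^ 2) * u ^ 2)) := by
  have hb : 0 < t ^ 2 + ‖z‖ ^ 2 := by positivity
  have h1 := integral_rpow_mul_exp_neg_mul_rpow (p := 2) (q := 3) (b := t ^ 2 + ‖z‖ ^ 2)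
    (by norm_num) (by norm_num) hb
  rw [integral_const_mul]
  have h2 : ∫ u in Set.Ioi (0 : ℝ), u ^ 3 * Real.exp (-(t ^ 2 + ‖z‖ ^ 2) * u ^ 2) =
      ((t ^ 2 + ‖z‖ ^ 2) ^ 2)⁻¹ / 2 := by
    have h3 : (-(3 + 1 : ℝ) / 2) = -(2 : ℕ) := by norm_num
    have h4 : ((3 : ℝ) + 1) / 2 = 1 + 1 := by norm_num
    rw [h3, Real.rpow_neg hb.le, Real.rpow_natCast, h4, Real.Gamma_add_one one_ne_zero,
      Real.Gamma_one] at h1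
    rw [show ((t ^ 2 + ‖z‖ ^ 2) ^ 2)⁻¹ / 2 = ((t ^ 2 + ‖z‖ ^ 2) ^ 2)⁻¹ * (1 / 2) * (1 * 1) by ring,
      ← h1]
    refine setIntegral_congr_fun measurableSet_Ioi fun u hu => ?_
    norm_cast
  rw [h2, poissonKer]
  field_simp

theorem integral_expKer_mul_gaussian (σ : ℤˣ) {u : ℝ} (hu : 0 < u) (ξ : E3) :
    ∫ y : E3, expKer σ y ξ * (Real.exp (-u ^ 2 * ‖y‖ ^ 2) : ℂ) =
      ((Real.pi * √Real.pi / u ^ 3 * Real.exp (-(Real.pi * ‖ξ‖) ^ 2 / u ^ 2) : ℝ) : ℂ) := by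
  have h1 := GaussianFourier.integral_cexp_neg_mul_sq_norm_add (V := E3) (b := (u : ℂ) ^ 2)
    (by rw [← Complex.ofReal_pow, Complex.ofReal_re]; positivity)
    (2 * Real.pi * Complex.I * sgn σ) ξ
  have h2 : ∀ y : E3, expKer σ y ξ * (Real.exp (-u ^ 2 * ‖y‖ ^ 2) : ℂ) =
      Complex.exp (-(u : ℂ) ^ 2 * ‖y‖ ^ 2 + 2 * Real.pi * Complex.I * sgn σ * ⟪ξ, y⟫_ℝ) := by
    intro y
    rw [expKer, Complex.ofReal_exp, ← Complex.exp_add, real_inner_comm]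
    push_cast
    ring_nf
  simp only [h2]
  rw [h1]
  have h3 : ((Real.pi : ℂ) / (u : ℂ) ^ 2) ^ ((Module.finrank ℝ E3 : ℂ) / 2) =
      ((Real.pi * √Real.pi / u ^ 3 : ℝ) : ℂ) := by
    rw [finrank_euclideanSpace_fin, ← Complex.ofReal_pow, ← Complex.ofReal_div]
    have : (((3 : ℕ) : ℂ) / 2) = ((3 / 2 : ℝ) : ℂ) := by push_cast; rfl
    rw [this, ← Complex.ofReal_cpow (by positivity)]
    congr 1
    rw [show (3 / 2 : ℝ) = 1 + 1 / 2 by norm_num, Real.rpow_add (by positivity), Real.rpow_one,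
      ← Real.sqrt_eq_rpow, Real.sqrt_div Real.pi_pos.le, Real.sqrt_sq hu.le]
    field_simp
  rw [h3, Complex.ofReal_mul (_ / _), Complex.ofReal_exp]
  congr 2
  have hs : (sgn σ : ℂ) ^ 2 = 1 := by
    rw [sq]; exact_mod_cast sgn_mul_self σ
  have hu' : (u : ℂ) ≠ 0 := by exact_mod_cast hu.ne'
  push_cast
  have hu2 : (u : ℂ) ^ 2 ≠ 0 := pow_ne_zero 2 hu'
  rw [div_eq_div_iff (mul_ne_zero (by norm_num) hu2) hu2]
  linear_combination ((2 * Real.pi * Complex.I) ^ 2 * (‖ξ‖ : ℂ) ^ 2 * (u : ℂ) ^ 2) * hs +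
    4 * (Real.pi : ℂ) ^ 2 * (‖ξ‖ : ℂ) ^ 2 * (u : ℂ) ^ 2 * Complex.I_sq

theorem integral_gaussian_E3 {u : ℝ} (hu : 0 < u) :
    ∫ y : E3, Real.exp (-u ^ 2 * ‖y‖ ^ 2) = Real.pi * √Real.pi / u ^ 3 := by
  have h := integral_expKer_mul_gaussian 1 hu 0
  simp only [expKer, inner_zero_right, Complex.ofReal_zero, mul_zero, Complex.exp_zero, one_mul,
    norm_zero] at h
  rw [integral_complex_ofReal, Complex.ofReal_inj] at h
  simpa using h

theorem integrable_gaussian_E3 {u : ℝ} (hu : 0 < u) :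
    Integrable fun y : E3 => Real.exp (-u ^ 2 * ‖y‖ ^ 2) := by
  refine Integrable.of_integral_ne_zero ?_
  rw [integral_gaussian_E3 hu]
  have := Real.sqrt_pos.2 Real.pi_pos
  positivity

/-- Justifies exchanging the subordination integral with integration over ℝ³. Integrating in y
first, the Gaussian contributes a multiple of u⁻³, which cancels u³ and leaves a Gaussian in u. -/
theorem integrable_poisson_prod {t : ℝ} (ht : 0 < t) :
    Integrable (fun p : ℝ × E3 => 2 * t / Real.pi ^ 2 *
      (p.1 ^ 3 * Real.exp (-(t ^ 2 + ‖p.2‖ ^ 2) * p.1 ^ 2)))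
      ((volume.restrict (Set.Ioi 0)).prod volume) := by
  refine Integrable.const_mul ?_ _
  have hsplit : ∀ u : ℝ, ∀ y : E3, u ^ 3 * Real.exp (-(t ^ 2 + ‖y‖ ^ 2) * u ^ 2) =
      u ^ 3 * Real.exp (-t ^ 2 * u ^ 2) * Real.exp (-u ^ 2 * ‖y‖ ^ 2) := by
    intro u y
    rw [mul_assoc, ← Real.exp_add]
    ring_nf
  refine (integrable_prod_iff ?_).2 ⟨?_, ?_⟩
  · exact (by fun_prop : Continuous _).aestronglyMeasurable
  · refine (ae_restrict_iff' measurableSet_Ioi).2 (.of_forall fun u hu => ?_)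
    simp only [hsplit]
    exact (integrable_gaussian_E3 hu).const_mul _
  · have h1 : IntegrableOn (fun u : ℝ => Real.pi * √Real.pi * Real.exp (-t ^ 2 * u ^ 2))
        (Set.Ioi 0) := by
      exact ((integrable_exp_neg_mul_sq (sq_pos_of_pos ht)).const_mul _).integrableOn
    refine h1.congr_fun (fun u hu => ?_) measurableSet_Ioi
    have hu := Set.mem_Ioi.1 hu
    simp only [hsplit]
    have : ∀ y : E3, ‖u ^ 3 * Real.exp (-t ^ 2 * u ^ 2) * Real.exp (-u ^ 2 * ‖y‖ ^ 2)‖ =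
        u ^ 3 * Real.exp (-t ^ 2 * u ^ 2) * Real.exp (-u ^ 2 * ‖y‖ ^ 2) := fun y =>
      Real.norm_of_nonneg (by positivity)
    simp only [this]
    rw [integral_const_mul, integral_gaussian_E3 hu]
    field_simp

theorem integrable_poissonKer {t : ℝ} (ht : 0 < t) : Integrable (poissonKer t) := by
  refine (integrable_poisson_prod ht).integral_prod_right.congr (.of_forall fun y => ?_)
  exact (poissonKer_eq_integral ht y).symm

/-- The Fourier transform of the Poisson kernel. -/
theorem integral_expKer_mul_poissonKer (σ : ℤˣ) {t : ℝ} (ht : 0 < t) (ξ : E3) :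
    ∫ y, expKer σ y ξ * (poissonKer t y : ℂ) = (Real.exp (-(2 * Real.pi * t * ‖ξ‖)) : ℂ) := by
  set k : ℝ → E3 → ℝ := fun u y => 2 * t / Real.pi ^ 2 *
    (u ^ 3 * Real.exp (-(t ^ 2 + ‖y‖ ^ 2) * u ^ 2)) with hk
  have hprod : Integrable (Function.uncurry fun (u : ℝ) (y : E3) => expKer σ y ξ * (k u y : ℂ))
      ((volume.restrict (Set.Ioi 0)).prod volume) := by
    refine (integrable_poisson_prod ht).ofReal.bdd_mul (c := 1)
      (f := fun p : ℝ × E3 => expKer σ p.2 ξ) ?_ (.of_forall fun p => (norm_expKer σ _ _).le)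
    exact ((continuous_expKer σ).comp
      (by fun_prop : Continuous fun p : ℝ × E3 => (p.2, ξ))).aestronglyMeasurable
  calc ∫ y, expKer σ y ξ * (poissonKer t y : ℂ)
      = ∫ y, ∫ u in Set.Ioi (0 : ℝ), expKer σ y ξ * (k u y : ℂ) := by
        refine integral_congr_ae (.of_forall fun y => ?_)
        simp only
        rw [integral_const_mul, poissonKer_eq_integral ht y, integral_complex_ofReal]
    _ = ∫ u in Set.Ioi (0 : ℝ), ∫ y, expKer σ y ξ * (k u y : ℂ) :=
        (integral_integral_swap hprod).symm
    _ = ∫ u in Set.Ioi (0 : ℝ), ((2 * t / √Real.pi *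
          Real.exp (-(t ^ 2 * u ^ 2 + (Real.pi * ‖ξ‖) ^ 2 / u ^ 2)) : ℝ) : ℂ) := by
        refine setIntegral_congr_fun measurableSet_Ioi fun u hu => ?_
        have hu := Set.mem_Ioi.1 hu
        have h1 : ∀ y : E3, expKer σ y ξ * (k u y : ℂ) =
            ((2 * t / Real.pi ^ 2 * u ^ 3 * Real.exp (-t ^ 2 * u ^ 2) : ℝ) : ℂ) *
              (expKer σ y ξ * (Real.exp (-u ^ 2 * ‖y‖ ^ 2) : ℂ)) := by
          intro y
          have : k u y = 2 * t / Real.pi ^ 2 * u ^ 3 * Real.exp (-t ^ 2 * u ^ 2) *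
              Real.exp (-u ^ 2 * ‖y‖ ^ 2) := by
            simp only [hk]
            rw [mul_assoc (_ * _) (Real.exp _) (Real.exp _), ← Real.exp_add]
            ring_nf
          rw [this]
          push_cast
          ring
        simp only [h1]
        rw [integral_const_mul, integral_expKer_mul_gaussian σ hu, ← Complex.ofReal_mul]
        congr 1
        have h2 : Real.exp (-(t ^ 2 * u ^ 2 + (Real.pi * ‖ξ‖) ^ 2 / u ^ 2)) =
            Real.exp (-t ^ 2 * u ^ 2) * Real.exp (-(Real.pi * ‖ξ‖) ^ 2 / u ^ 2) := by
          rw [← Real.exp_add]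
          ring_nf
        rw [h2]
        have h3 : √Real.pi * √Real.pi = Real.pi := Real.mul_self_sqrt Real.pi_pos.le
        have h4 : 0 < √Real.pi := Real.sqrt_pos.2 Real.pi_pos
        field_simp
        rw [sq, h3]
    _ = _ := by
        -- Here b = π|ξ|, so the exponent 2tb is 2πt|ξ|.
        rw [integral_complex_ofReal, integral_const_mul, integral_exp_neg_sq_add_inv_sq_Ioi ht
          (by positivity)]
        have h4 : 0 < √Real.pi := Real.sqrt_pos.2 Real.pi_pos
        congr 1
        rw [← mul_assoc, show 2 * t / √Real.pi * (√Real.pi / (2 * t)) = 1 by field_simp, one_mul]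
        ring_nf

theorem integral_poissonKer {t : ℝ} (ht : 0 < t) : ∫ y, poissonKer t y = 1 := by
  have h := integral_expKer_mul_poissonKer 1 ht 0
  simp only [expKer, inner_zero_right, Complex.ofReal_zero, mul_zero, Complex.exp_zero, one_mul,
    norm_zero, neg_zero, Real.exp_zero] at h
  rw [integral_complex_ofReal] at h
  exact_mod_cast h

theorem fourierInt_poissonKer (σ : ℤˣ) {t : ℝ} (ht : 0 < t) (x ξ : E3) :
    fourierInt σ (fun y => (poissonKer t (x - y) : ℂ)) ξ =
      expKer σ x ξ * (Real.exp (-(2 * Real.pi * t * ‖ξ‖)) : ℂ) := by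
  rw [fourierInt, ← integral_expKer_mul_poissonKer (-σ) ht ξ, ← integral_const_mul,
    ← integral_sub_left_eq_self _ volume x]
  refine integral_congr_ae (.of_forall fun y => ?_)
  simp only [sub_sub_cancel, smul_eq_mul, ← mul_assoc]
  congr 1
  rw [expKer, expKer, expKer, ← Complex.exp_add, inner_sub_right, real_inner_comm y,
    real_inner_comm x, sgn_neg]
  push_cast
  ring_nf

theorem memLp_two_of_integrable_of_le {V : Type*} [NormedAddCommGroup V] {f : E3 → V} {C : ℝ}
    (hf : Integrable f) (hC : ∀ x, ‖f x‖ ≤ C) : MemLp f 2 := by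
  refine (memLp_two_iff_integrable_sq_norm hf.aestronglyMeasurable).2 ?_
  refine Integrable.mono' (hf.norm.const_mul C) (hf.norm.aestronglyMeasurable.pow 2)
    (.of_forall fun x => ?_)
  rw [Real.norm_of_nonneg (by positivity), sq]
  exact mul_le_mul_of_nonneg_right (hC x) (norm_nonneg _)

theorem poissonKer_le {t : ℝ} (ht : 0 < t) (z : E3) : poissonKer t z ≤ t / (t ^ 2) ^ 2 := by
  unfold poissonKer
  have h1 : (1 : ℝ) ≤ Real.pi ^ 2 := by nlinarith [Real.pi_gt_three]
  have h2 : (t ^ 2) ^ 2 ≤ (t ^ 2 + ‖z‖ ^ 2) ^ 2 := by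
    gcongr
    nlinarith [sq_nonneg ‖z‖]
  refine div_le_div_of_nonneg_left ht.le (by positivity) ?_
  nlinarith [sq_nonneg (t ^ 2 + ‖z‖ ^ 2)]

theorem memLp_poissonKer {t : ℝ} (ht : 0 < t) (x : E3) :
    MemLp (fun y => (poissonKer t (x - y) : ℂ)) 2 := by
  refine memLp_two_of_integrable_of_le (C := t / (t ^ 2) ^ 2)
    ((integrable_poissonKer ht).comp_sub_left x).ofReal fun y => ?_
  rw [Complex.norm_real, Real.norm_of_nonneg (poissonKer_nonneg ht.le _)]
  exact poissonKer_le ht _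

/-- The Poisson extension of an `L²` function in terms of its Fourier transform. -/
theorem fourierInt_exp_smul_eq_poisson {V : Type*} [NormedAddCommGroup V] [NormedSpace ℂ V]
    [FiniteDimensional ℂ V] {σ : ℤˣ} {g f : E3 → V} (h : IsFourierPair σ g f) {t : ℝ} (ht : 0 < t)
    (x : E3) :
    fourierInt σ (fun ξ => (Real.exp (-(2 * Real.pi * t * ‖ξ‖)) : ℂ) • g ξ) x =
      ∫ y, (poissonKer t (x - y) : ℂ) • f y := by
  have h1 := isFourierPair_fourierInt σ ((integrable_poissonKer ht).comp_sub_left x).ofReal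
    (memLp_poissonKer ht x)
  have h2 := h1.integral_smul h
  simp only [fourierInt_poissonKer σ ht] at h2
  refine Eq.trans ?_ h2
  rw [fourierInt]
  simp only [smul_smul]

/-! ### Non-tangential convergence of Poisson integrals -/

/-- Take the least k with |z| ≤ 2ᵏt. If k > 0 then |z| > 2ᵏ⁻¹t, and decay of order four in |z| gives
the factor 16⁻ᵏ, which outweighs the growth 8ᵏ of the volume of the ball of radius 2ᵏt. -/
theorem exists_poissonKer_le_dyadic {t : ℝ} (ht : 0 < t) (z : E3) :
    ∃ k : ℕ, ‖z‖ ≤ 2 ^ k * t ∧ poissonKer t z ≤ 16 * (t ^ 3)⁻¹ * ((16 : ℝ)⁻¹) ^ k := by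
  have hpi : (1 : ℝ) ≤ Real.pi ^ 2 := by nlinarith [Real.pi_gt_three]
  have hex : ∃ k : ℕ, ‖z‖ ≤ 2 ^ k * t := by
    obtain ⟨k, hk⟩ := pow_unbounded_of_one_lt (‖z‖ / t) (one_lt_two (α := ℝ))
    exact ⟨k, ((div_lt_iff₀ ht).1 hk).le⟩
  classical
  refine ⟨Nat.find hex, Nat.find_spec hex, ?_⟩
  rcases hk : Nat.find hex with _ | k
  · refine (poissonKer_le ht z).trans ?_
    rw [pow_zero, mul_one, ← pow_mul]
    have : t / t ^ (2 * 2) = (t ^ 3)⁻¹ := by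
      field_simp
    rw [this]
    have : 0 < (t ^ 3)⁻¹ := by positivity
    linarith
  · have h1 : 2 ^ k * t < ‖z‖ := not_le.1 (Nat.find_min hex (hk ▸ Nat.lt_succ_self k))
    have h2 : 16 * (t ^ 3)⁻¹ * ((16 : ℝ)⁻¹) ^ (k + 1) = t / (2 ^ k * t) ^ 4 := by
      rw [mul_pow, ← pow_mul, mul_comm k 4, pow_mul, inv_pow, pow_succ]
      norm_num
      field_simp
      ring
    rw [h2, poissonKer]
    refine div_le_div_of_nonneg_left ht.le (by positivity) ?_
    have h3 : (2 ^ k * t) ^ 4 ≤ ‖z‖ ^ 4 := by gcongr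
    have h4 : ‖z‖ ^ 4 ≤ (t ^ 2 + ‖z‖ ^ 2) ^ 2 := by
      nlinarith [sq_nonneg (t ^ 2), mul_nonneg (sq_nonneg t) (sq_nonneg ‖z‖)]
    nlinarith [sq_nonneg (t ^ 2 + ‖z‖ ^ 2)]

open Metric in
-- Summing the dyadic bounds, the k-th ball contributes at most 16·t⁻³·16⁻ᵏ·ε(2ᵏt)³ = 16ε·2⁻ᵏ, and
-- the geometric series adds up to 32ε.
theorem lintegral_ball_poissonKer_le {t δ ε : ℝ} (ht : 0 < t) (hε : 0 ≤ ε) (x : E3)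
    {H : E3 → ENNReal} (hH : AEMeasurable H)
    (h : ∀ ρ, 0 < ρ → ∫⁻ y in ball x δ ∩ closedBall x ρ, H y ≤ ENNReal.ofReal (ε * ρ ^ 3)) :
    ∫⁻ y in ball x δ, ENNReal.ofReal (poissonKer t (x - y)) * H y ≤ ENNReal.ofReal (32 * ε) := by
  set c : ℕ → ENNReal := fun k => ENNReal.ofReal (16 * (t ^ 3)⁻¹ * ((16 : ℝ)⁻¹) ^ k) with hc
  calc ∫⁻ y in ball x δ, ENNReal.ofReal (poissonKer t (x - y)) * H y
      ≤ ∫⁻ y in ball x δ, ∑' k, (closedBall x (2 ^ k * t)).indicator (fun y => c k * H y) y := by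
        refine lintegral_mono fun y => ?_
        obtain ⟨k, hk1, hk2⟩ := exists_poissonKer_le_dyadic ht (x - y)
        refine le_trans ?_ (ENNReal.le_tsum k)
        rw [Set.indicator_of_mem (by rwa [mem_closedBall, dist_comm, dist_eq_norm])]
        gcongr
        exact ENNReal.ofReal_le_ofReal hk2
    _ = ∑' k, ∫⁻ y in ball x δ, (closedBall x (2 ^ k * t)).indicator (fun y => c k * H y) y := by
        refine lintegral_tsum fun k => ?_
        exact ((hH.const_mul _).indicator measurableSet_closedBall).restrict
    _ ≤ ∑' k : ℕ, ENNReal.ofReal (16 * ε * ((2 : ℝ)⁻¹) ^ k) := by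
        refine ENNReal.tsum_le_tsum fun k => ?_
        rw [lintegral_indicator measurableSet_closedBall, Measure.restrict_restrict
          measurableSet_closedBall, Set.inter_comm, lintegral_const_mul'' _ hH.restrict]
        refine (mul_le_mul_right (h (2 ^ k * t) (by positivity)) _).trans_eq ?_
        rw [hc, ← ENNReal.ofReal_mul (by positivity)]
        congr 1
        rw [mul_pow, inv_pow, inv_pow]
        have : (16 : ℝ) ^ k = (2 ^ k) ^ 4 := by
          rw [← pow_mul, mul_comm, pow_mul]
          norm_num
        rw [this]
        field_simp
    _ = ENNReal.ofReal (32 * ε) := by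
        rw [← ENNReal.ofReal_tsum_of_nonneg (fun k => by positivity)
          ((summable_geometric_of_lt_one (by norm_num) (by norm_num)).mul_left _), tsum_mul_left,
          tsum_geometric_of_lt_one (by norm_num) (by norm_num)]
        congr 1
        ring

open Metric in
-- The small mean oscillation controls the ball of radius δ through the dyadic estimate. Outside
-- that ball the kernel at height t is at most 4t/δ times the kernel at the fixed height δ, whose
-- integral against H is finite.
theorem tendsto_lintegral_poissonKer (x : E3) {H : E3 → ENNReal} (hH : AEMeasurable H)
    (hfin : ∀ t, 0 < t → ∫⁻ y, ENNReal.ofReal (poissonKer t (x - y)) * H y ≠ ⊤)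
    (h : ∀ ε, 0 < ε → ∃ δ, 0 < δ ∧ ∀ ρ, 0 < ρ → ρ ≤ δ →
      ∫⁻ y in closedBall x ρ, H y ≤ ENNReal.ofReal (ε * ρ ^ 3)) :
    Tendsto (fun t => ∫⁻ y, ENNReal.ofReal (poissonKer t (x - y)) * H y) (𝓝[>] 0) (𝓝 0) := by
  refine ENNReal.tendsto_nhds_zero.2 fun η hη => ?_
  -- 33 = 32 + 1: the near part costs 32ε and the far part ε.
  obtain ⟨ε, hε, hεη⟩ : ∃ ε : ℝ, 0 < ε ∧ ENNReal.ofReal (33 * ε) ≤ η := by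
    rcases eq_or_ne η ⊤ with rfl | hη'
    · exact ⟨1, one_pos, le_top⟩
    · refine ⟨η.toReal / 33, div_pos (ENNReal.toReal_pos hη.ne' hη') (by norm_num), ?_⟩
      rw [mul_div_cancel₀ _ (by norm_num), ENNReal.ofReal_toReal hη']
  obtain ⟨δ, hδ, hδ'⟩ := h ε hε
  set K := ∫⁻ y, ENNReal.ofReal (poissonKer δ (x - y)) * H y with hK
  have hK' : K ≠ ⊤ := hfin δ hδ
  have hlim : Tendsto (fun t : ℝ => ENNReal.ofReal (4 * t / δ) * K) (𝓝[>] 0) (𝓝 0) := by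
    have h1 : Tendsto (fun t : ℝ => ENNReal.ofReal (4 * t / δ)) (𝓝 0) (𝓝 (ENNReal.ofReal (4 * 0 / δ))) :=
      (ENNReal.continuous_ofReal.comp (by fun_prop)).tendsto 0
    have h2 := ENNReal.Tendsto.mul_const h1 (Or.inr hK' : _ ∨ K ≠ ⊤)
    simp only [mul_zero, zero_div, ENNReal.ofReal_zero, zero_mul] at h2
    exact h2.mono_left nhdsWithin_le_nhds
  filter_upwards [ENNReal.tendsto_nhds_zero.1 hlim (ENNReal.ofReal ε) (by simpa using hε),
    Ioc_mem_nhdsGT hδ] with t ht1 ht2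
  obtain ⟨ht, htδ⟩ := ht2
  rw [← lintegral_add_compl _ (measurableSet_ball (x := x) (ε := δ))]
  refine le_trans (b := ENNReal.ofReal (32 * ε) + ENNReal.ofReal ε)
    (add_le_add (lintegral_ball_poissonKer_le ht hε.le x hH ?_) ?_) ?_
  · intro ρ hρ
    rcases le_total ρ δ with h1 | h1
    · exact (lintegral_mono_set Set.inter_subset_right).trans (hδ' ρ hρ h1)
    · refine (lintegral_mono_set (Set.inter_subset_left.trans ball_subset_closedBall)).trans
        ((hδ' δ hδ le_rfl).trans ?_)
      gcongr
  · refine le_trans ?_ ht1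
    rw [hK, ← lintegral_const_mul' _ _ ENNReal.ofReal_ne_top]
    refine le_trans ?_ (setLIntegral_le_lintegral (ball x δ)ᶜ _)
    refine setLIntegral_mono' measurableSet_ball.compl fun y hy => ?_
    rw [← mul_assoc, ← ENNReal.ofReal_mul (by positivity)]
    gcongr
    have hr : δ ≤ ‖x - y‖ := by
      rw [Set.mem_compl_iff, mem_ball, not_lt, dist_comm, dist_eq_norm] at hy
      exact hy
    have hr0 : 0 < ‖x - y‖ := hδ.trans_le hr
    -- The factor 4 puts the mean (δ² + |x - y|²)/2 into the denominator; as δ ≤ |x - y|, this mean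
    -- is at most |x - y|².
    have e1 : 4 * t / δ * poissonKer δ (x - y) =
        t / (Real.pi ^ 2 * ((δ ^ 2 + ‖x - y‖ ^ 2) / 2) ^ 2) := by
      rw [poissonKer]
      field_simp
      norm_num
    rw [e1, poissonKer]
    refine div_le_div_of_nonneg_left ht.le (by positivity) ?_
    gcongr
    nlinarith
  · rw [← ENNReal.ofReal_add (by positivity) hε.le]
    exact le_trans (by rw [show 32 * ε + ε = 33 * ε by ring]) hεη

variable {V : Type*} [NormedAddCommGroup V] [NormedSpace ℂ V] [FiniteDimensional ℂ V]

omit [FiniteDimensional ℂ V] in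
theorem integrable_poissonKer_smul {f : E3 → V} (hf : MemLp f 2) {t : ℝ} (ht : 0 < t) (x : E3) :
    Integrable fun y => (poissonKer t (x - y) : ℂ) • f y :=
  MemLp.integrable_smul_two (memLp_poissonKer ht x) hf

omit [NormedSpace ℂ V] [FiniteDimensional ℂ V] in
open Metric in
-- The Lebesgue point property, freed of averages: the volume of a ball is a constant times ρ³, and
-- the constant is absorbed into ε.
theorem ae_exists_setLIntegral_sub_le {f : E3 → V} (hf : MemLp f 2) :
    ∀ᵐ x : E3, ∀ ε, 0 < ε → ∃ δ, 0 < δ ∧ ∀ ρ, 0 < ρ → ρ ≤ δ →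
      ∫⁻ y in closedBall x ρ, ‖f y - f x‖ₑ ≤ ENNReal.ofReal (ε * ρ ^ 3) := by
  have hloc : LocallyIntegrable f := hf.locallyIntegrable (by norm_num)
  filter_upwards [IsUnifLocDoublingMeasure.ae_tendsto_average_norm_sub volume hloc 1] with x hx ε hε
  have h1 := hx (l := 𝓝[>] (0 : ℝ)) (fun _ => x) id tendsto_id (by
    filter_upwards [self_mem_nhdsWithin] with r hr
    simpa using (Set.mem_Ioi.1 hr).le)
  set c := volume.real (ball (0 : E3) 1) with hc
  have hc0 : 0 < c :=
    ENNReal.toReal_pos (measure_ball_pos volume (0 : E3) one_pos).ne' measure_ball_lt_top.ne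
  have h2 := (tendsto_order.1 h1).2 (ε / c) (by positivity)
  obtain ⟨δ, hδ, hδ'⟩ := (mem_nhdsGT_iff_exists_Ioc_subset).1 h2
  refine ⟨δ, hδ, fun ρ hρ hρδ => ?_⟩
  have h3 := hδ' ⟨hρ, hρδ⟩
  simp only [id, Set.mem_ofPred_eq, setAverage_eq, smul_eq_mul] at h3
  have hv : volume.real (closedBall x ρ) = ρ ^ 3 * c := by
    rw [hc, Measure.real, Measure.real, Measure.addHaar_closedBall _ _ hρ.le,
      finrank_euclideanSpace_fin, ENNReal.toReal_mul, ENNReal.toReal_ofReal (by positivity)]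
  have hint : IntegrableOn (fun y => f y - f x) (closedBall x ρ) :=
    (hloc.integrableOn_isCompact (isCompact_closedBall x ρ)).sub
      (integrableOn_const (measure_closedBall_lt_top.ne))
  rw [← ofReal_integral_norm_eq_lintegral_enorm hint]
  refine ENNReal.ofReal_le_ofReal ?_
  rw [hv, inv_mul_lt_iff₀ (by positivity)] at h3
  refine h3.le.trans_eq ?_
  field_simp

/-- Poisson integrals of square-integrable functions converge non-tangentially almost everywhere. -/
theorem ae_tendsto_poisson {f : E3 → V} (hf : MemLp f 2) :
    ∀ᵐ x : E3, ∀ (τ : ℤˣ) (a : ℝ), 0 < a →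
      Tendsto (fun p : ℝ × E3 => ∫ y, (poissonKer (sgn τ * p.1) (p.2 - y) : ℂ) • f y)
        (𝓝[cone τ a x] (0, x)) (𝓝 (f x)) := by
  filter_upwards [ae_exists_setLIntegral_sub_le hf] with x hx τ a ha
  have hm : AEMeasurable (fun y => ‖f y - f x‖ₑ) :=
    (hf.1.sub aestronglyMeasurable_const).enorm
  have hker : ∀ {t : ℝ}, 0 < t → ∀ z y : E3, ‖(poissonKer t (z - y) : ℂ) • (f y - f x)‖ₑ =
      ENNReal.ofReal (poissonKer t (z - y)) * ‖f y - f x‖ₑ := by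
    intro t ht z y
    rw [enorm_smul, ← ofReal_norm, Complex.norm_real,
      Real.norm_of_nonneg (poissonKer_nonneg ht.le _)]
  have hint : ∀ {t : ℝ}, 0 < t → ∀ z : E3,
      Integrable fun y => (poissonKer t (z - y) : ℂ) • (f y - f x) := by
    intro t ht z
    simp only [smul_sub]
    exact (integrable_poissonKer_smul hf ht z).sub
      (((integrable_poissonKer ht).comp_sub_left z).ofReal.smul_const _)
  have hfin : ∀ t, 0 < t → ∫⁻ y, ENNReal.ofReal (poissonKer t (x - y)) * ‖f y - f x‖ₑ ≠ ⊤ := by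
    intro t ht
    have := (hint ht x).2.ne
    simpa only [hker ht] using this
  have hlim := tendsto_lintegral_poissonKer x hm hfin hx
  -- Inside the cone, t² + |x - y|² ≤ M(t² + |p.2 - y|²), so the kernel centred at p.2 is at most M²
  -- times the one centred at the vertex x. This reduces non-tangential to vertical convergence.
  set M : ℝ := 2 + 2 * a ^ 2 with hM
  have hlim' : Tendsto (fun p : ℝ × E3 => ENNReal.ofReal (M ^ 2) *
      ∫⁻ y, ENNReal.ofReal (poissonKer (sgn τ * p.1) (x - y)) * ‖f y - f x‖ₑ)
      (𝓝[cone τ a x] (0, x)) (𝓝 0) := by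
    have h1 : Tendsto (fun p : ℝ × E3 => sgn τ * p.1) (𝓝[cone τ a x] (0, x)) (𝓝[>] 0) := by
      refine tendsto_nhdsWithin_iff.2 ⟨?_, ?_⟩
      · have : Continuous fun p : ℝ × E3 => sgn τ * p.1 := by fun_prop
        simpa using (this.tendsto (0, x)).mono_left nhdsWithin_le_nhds
      · filter_upwards [self_mem_nhdsWithin] with p hp using hp.1
    have := ENNReal.Tendsto.const_mul (a := ENNReal.ofReal (M ^ 2)) (hlim.comp h1)
      (Or.inr ENNReal.ofReal_ne_top)
    simpa using this
  rw [tendsto_iff_edist_tendsto_0]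
  refine tendsto_of_tendsto_of_tendsto_of_le_of_le' tendsto_const_nhds hlim'
    (.of_forall fun _ => zero_le) ?_
  filter_upwards [self_mem_nhdsWithin] with p hp
  obtain ⟨hp1, hp2⟩ := hp
  have ht : 0 < sgn τ * p.1 := hp1
  have habs : |p.1| = sgn τ * p.1 := by
    rw [← abs_of_pos ht, abs_mul, abs_sgn, one_mul]
  rw [habs] at hp2
  set t := sgn τ * p.1 with htdef
  have hone : ∫ y, (poissonKer t (p.2 - y) : ℂ) • f x = f x := by
    rw [integral_smul_const, integral_complex_ofReal,
      integral_sub_left_eq_self (poissonKer t) volume p.2, integral_poissonKer ht]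
    simp
  have hsub : (∫ y, (poissonKer t (p.2 - y) : ℂ) • f y) - f x =
      ∫ y, (poissonKer t (p.2 - y) : ℂ) • (f y - f x) := by
    have hi : Integrable fun y => (poissonKer t (p.2 - y) : ℂ) • f x :=
      ((integrable_poissonKer ht).comp_sub_left p.2).ofReal.smul_const _
    simp only [smul_sub]
    rw [integral_sub (integrable_poissonKer_smul hf ht p.2) hi, hone]
  rw [edist_eq_enorm_sub, hsub]
  refine (enorm_integral_le_lintegral_enorm _).trans ?_
  rw [← lintegral_const_mul' _ _ ENNReal.ofReal_ne_top]
  refine lintegral_mono fun y => ?_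
  rw [hker ht, ← mul_assoc, ← ENNReal.ofReal_mul (by positivity)]
  gcongr
  have h1 : ‖x - y‖ ≤ ‖p.2 - y‖ + a * t := by
    have : x - y = (p.2 - y) - (p.2 - x) := by abel
    rw [this]
    exact (norm_sub_le _ _).trans (by linarith)
  have h2 : t ^ 2 + ‖x - y‖ ^ 2 ≤ M * (t ^ 2 + ‖p.2 - y‖ ^ 2) := by
    have h3 : ‖x - y‖ ^ 2 ≤ (‖p.2 - y‖ + a * t) ^ 2 := by gcongr
    have h4 : 0 ≤ a ^ 2 * ‖p.2 - y‖ ^ 2 := by positivity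
    nlinarith [sq_nonneg (‖p.2 - y‖ - a * t), sq_nonneg t]
  rw [poissonKer, poissonKer, ← mul_div_assoc, div_le_div_iff₀ (by positivity) (by positivity)]
  have h5 : (t ^ 2 + ‖x - y‖ ^ 2) ^ 2 ≤ (M * (t ^ 2 + ‖p.2 - y‖ ^ 2)) ^ 2 := by gcongr
  calc t * (Real.pi ^ 2 * (t ^ 2 + ‖x - y‖ ^ 2) ^ 2)
      ≤ t * (Real.pi ^ 2 * (M * (t ^ 2 + ‖p.2 - y‖ ^ 2)) ^ 2) := by gcongr
    _ = _ := by ring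

/-! ### Smoothness of Poisson extensions -/

section Extension

variable {V : Type*} [NormedAddCommGroup V] [NormedSpace ℂ V]

/-- The extension `∫ e^{2πiσ⟨x,ξ⟩} e^{-2πt|ξ|} g(ξ) dξ` to the half-space `t > 0`. -/
def hardyExt (σ : ℤˣ) (g : E3 → V) (p : ℝ × E3) : V :=
  fourierInt σ (fun ξ => (Real.exp (-(2 * Real.pi * p.1 * ‖ξ‖)) : ℂ) • g ξ) p.2

/-- `g` is integrable against `e^{-ε|ξ|}` for every `ε > 0`. -/
structure ExpIntegrable {V : Type*} [NormedAddCommGroup V] (g : E3 → V) : Prop where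
  aesm : AEStronglyMeasurable g
  integrable : ∀ ε : ℝ, 0 < ε → Integrable fun ξ => Real.exp (-(ε * ‖ξ‖)) * ‖g ξ‖

theorem ExpIntegrable.integrable_smul {g : E3 → V} (hg : ExpIntegrable g) {ε : ℝ} (hε : 0 < ε) :
    Integrable fun ξ => (Real.exp (-(ε * ‖ξ‖)) : ℂ) • g ξ := by
  refine (hg.integrable ε hε).mono ?_ (.of_forall fun ξ => ?_)
  · exact (by fun_prop : Continuous fun ξ : E3 =>
      (Real.exp (-(ε * ‖ξ‖)) : ℂ)).aestronglyMeasurable.smul hg.aesm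
  · simp [norm_smul, Complex.norm_exp]

theorem integrable_exp_neg_mul_norm {ε : ℝ} (hε : 0 < ε) :
    Integrable fun ξ : E3 => Real.exp (-(ε * ‖ξ‖)) := by
  have h1 : Integrable fun ξ : E3 => (1 + ‖ξ‖) ^ (-4 : ℝ) :=
    integrable_one_add_norm (by rw [finrank_euclideanSpace_fin]; norm_num)
  -- From e^s ≥ s⁴/4! with s = ε(1 + |ξ|); the power 4 exceeds the dimension 3.
  refine Integrable.mono' (h1.const_mul (24 * Real.exp ε / ε ^ 4))
    (by fun_prop : Continuous fun ξ : E3 => Real.exp (-(ε * ‖ξ‖))).aestronglyMeasurable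
    (.of_forall fun ξ => ?_)
  rw [Real.norm_of_nonneg (Real.exp_pos _).le, Real.rpow_neg (by positivity)]
  have h2 := Real.pow_div_factorial_le_exp (ε * (1 + ‖ξ‖)) (by positivity) 4
  have h3 : Real.exp (ε * (1 + ‖ξ‖)) = Real.exp ε * (Real.exp (-(ε * ‖ξ‖)))⁻¹ := by
    rw [← Real.exp_neg, ← Real.exp_add]
    ring_nf
  have h4 : (1 + ‖ξ‖) ^ (4 : ℝ) = (1 + ‖ξ‖) ^ 4 := by norm_cast
  rw [h3, show ((Nat.factorial 4 : ℕ) : ℝ) = 24 by norm_num [Nat.factorial],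
    ← div_eq_mul_inv, le_div_iff₀ (Real.exp_pos _)] at h2
  rw [h4, ← div_eq_mul_inv, div_div, le_div_iff₀ (by positivity)]
  rw [mul_pow] at h2
  linarith

theorem memLp_exp_neg_mul_norm {ε : ℝ} (hε : 0 < ε) :
    MemLp (fun ξ : E3 => (Real.exp (-(ε * ‖ξ‖)) : ℂ)) 2 := by
  refine memLp_two_of_integrable_of_le (C := 1) (integrable_exp_neg_mul_norm hε).ofReal fun ξ => ?_
  rw [Complex.norm_real, Real.norm_of_nonneg (Real.exp_pos _).le]
  exact Real.exp_le_one_iff.2 (by have := norm_nonneg ξ; nlinarith [mul_nonneg hε.le this])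

theorem expIntegrable_of_memLp {g : E3 → V} (hg : MemLp g 2) : ExpIntegrable g where
  aesm := hg.1
  integrable ε hε := by
    refine (MemLp.integrable_smul_two (memLp_exp_neg_mul_norm hε) hg).norm.congr
      (.of_forall fun ξ => ?_)
    simp [norm_smul, Complex.norm_exp]

theorem memLp_exp_smul {g : E3 → V} (hg : MemLp g 2) {t : ℝ} (ht : 0 ≤ t) :
    MemLp (fun ξ => (Real.exp (-(2 * Real.pi * t * ‖ξ‖)) : ℂ) • g ξ) 2 := by
  refine hg.of_le ?_ (.of_forall fun ξ => ?_)
  · exact (by fun_prop : Continuous fun ξ : E3 =>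
      (Real.exp (-(2 * Real.pi * t * ‖ξ‖)) : ℂ)).aestronglyMeasurable.smul hg.1
  · rw [norm_smul, Complex.norm_real, Real.norm_of_nonneg (Real.exp_pos _).le]
    refine mul_le_of_le_one_left (norm_nonneg _) (Real.exp_le_one_iff.2 ?_)
    have := Real.pi_pos
    have : 0 ≤ 2 * Real.pi * t * ‖ξ‖ := by positivity
    linarith

omit [NormedSpace ℂ V] in
-- A factor |ξ| is absorbed by half of the exponential, since |ξ| ≤ (2/ε)e^{ε|ξ|/2}. As ε is
-- arbitrary, the class survives every differentiation of the kernel.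
theorem ExpIntegrable.mul_norm {W : Type*} [NormedAddCommGroup W] [NormedSpace ℂ W] {g : E3 → V}
    (hg : ExpIntegrable g) {g' : E3 → W} (h : AEStronglyMeasurable g') {C : ℝ}
    (hC : ∀ ξ, ‖g' ξ‖ ≤ C * ‖ξ‖ * ‖g ξ‖) : ExpIntegrable g' where
  aesm := h
  integrable ε hε := by
    refine Integrable.mono' ((hg.integrable (ε / 2) (half_pos hε)).const_mul (|C| * (2 / ε))) ?_
      (.of_forall fun ξ => ?_)
    · exact (by fun_prop : Continuous fun ξ : E3 =>
        Real.exp (-(ε * ‖ξ‖))).aestronglyMeasurable.mul h.norm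
    · rw [Real.norm_of_nonneg (by positivity)]
      have h1 : ‖ξ‖ ≤ 2 / ε * Real.exp (ε / 2 * ‖ξ‖) := by
        rw [div_mul_eq_mul_div, le_div_iff₀ hε]
        have := Real.add_one_le_exp (ε / 2 * ‖ξ‖)
        linarith
      have h2 : Real.exp (-(ε * ‖ξ‖)) * Real.exp (ε / 2 * ‖ξ‖) = Real.exp (-(ε / 2 * ‖ξ‖)) := by
        rw [← Real.exp_add]
        ring_nf
      calc Real.exp (-(ε * ‖ξ‖)) * ‖g' ξ‖
          ≤ Real.exp (-(ε * ‖ξ‖)) * (|C| * (2 / ε * Real.exp (ε / 2 * ‖ξ‖)) * ‖g ξ‖) := by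
            gcongr
            refine (hC ξ).trans ?_
            gcongr
            exact le_abs_self C
        _ = |C| * (2 / ε) * ((Real.exp (-(ε * ‖ξ‖)) * Real.exp (ε / 2 * ‖ξ‖)) * ‖g ξ‖) := by ring
        _ = _ := by rw [h2]

/-- The exponent of the kernel of `hardyExt`. -/
def extPhase (σ : ℤˣ) (ξ : E3) : ℝ × E3 →L[ℝ] ℂ :=
  (2 * Real.pi * sgn σ) • ((Complex.I • Complex.ofRealCLM).comp
    ((innerSL ℝ ξ).comp (ContinuousLinearMap.snd ℝ ℝ E3))) -
    (2 * Real.pi * ‖ξ‖) • (Complex.ofRealCLM.comp (ContinuousLinearMap.fst ℝ ℝ E3))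

theorem extPhase_apply (σ : ℤˣ) (ξ : E3) (p : ℝ × E3) :
    extPhase σ ξ p = 2 * Real.pi * Complex.I * sgn σ * (⟪p.2, ξ⟫_ℝ : ℝ) -
      2 * Real.pi * ‖ξ‖ * p.1 := by
  simp only [extPhase, sub_apply, smul_apply,
    ContinuousLinearMap.comp_apply, ContinuousLinearMap.coe_snd', ContinuousLinearMap.coe_fst',
    innerSL_apply_apply, Complex.ofRealCLM_apply, smul_eq_mul, Complex.real_smul, real_inner_comm]
  push_cast
  ring

theorem norm_extPhase_apply_le (σ : ℤˣ) (ξ : E3) (p : ℝ × E3) :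
    ‖extPhase σ ξ p‖ ≤ 4 * Real.pi * ‖ξ‖ * ‖p‖ := by
  rw [extPhase_apply]
  have h1 : |⟪p.2, ξ⟫_ℝ| ≤ ‖p‖ * ‖ξ‖ :=
    (abs_real_inner_le_norm _ _).trans (by gcongr; exact norm_snd_le p)
  have h2 : |p.1| ≤ ‖p‖ := norm_fst_le p
  refine (norm_sub_le _ _).trans ?_
  simp only [norm_mul, Complex.norm_real, Complex.norm_I, Complex.norm_ofNat, Real.norm_eq_abs,
    abs_sgn, mul_one, abs_of_pos Real.pi_pos, abs_norm]
  have := Real.pi_pos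
  have h3 : 2 * Real.pi * |⟪p.2, ξ⟫_ℝ| ≤ 2 * Real.pi * (‖p‖ * ‖ξ‖) := by gcongr
  have h4 : 2 * Real.pi * ‖ξ‖ * |p.1| ≤ 2 * Real.pi * ‖ξ‖ * ‖p‖ := by gcongr
  linarith

theorem continuous_extPhase (σ : ℤˣ) : Continuous (extPhase σ) := by
  unfold extPhase
  fun_prop

theorem exp_extPhase (σ : ℤˣ) (ξ : E3) (p : ℝ × E3) :
    Complex.exp (extPhase σ ξ p) =
      expKer σ p.2 ξ * (Real.exp (-(2 * Real.pi * p.1 * ‖ξ‖)) : ℂ) := by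
  rw [extPhase_apply, expKer, Complex.ofReal_exp, ← Complex.exp_add]
  push_cast
  ring_nf

theorem norm_exp_extPhase (σ : ℤˣ) (ξ : E3) (p : ℝ × E3) :
    ‖Complex.exp (extPhase σ ξ p)‖ = Real.exp (-(2 * Real.pi * p.1 * ‖ξ‖)) := by
  rw [exp_extPhase, norm_mul, norm_expKer, one_mul, Complex.norm_real,
    Real.norm_of_nonneg (Real.exp_pos _).le]

theorem hardyExt_eq (σ : ℤˣ) (g : E3 → V) (p : ℝ × E3) :
    hardyExt σ g p = ∫ ξ, Complex.exp (extPhase σ ξ p) • g ξ := by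
  simp only [exp_extPhase, hardyExt, fourierInt, smul_smul]

theorem ExpIntegrable.integrable_exp_extPhase {g : E3 → V} (hg : ExpIntegrable g) (σ : ℤˣ)
    {p : ℝ × E3} (hp : 0 < p.1) : Integrable fun ξ => Complex.exp (extPhase σ ξ p) • g ξ := by
  have h := integrable_expKer_smul
    (hg.integrable_smul (ε := 2 * Real.pi * p.1) (by have := Real.pi_pos; positivity)) σ p.2
  simpa only [exp_extPhase, smul_smul] using h

/-- The density of the derivative of `hardyExt σ g`. -/
def kerDeriv (σ : ℤˣ) (g : E3 → V) (ξ : E3) : ℝ × E3 →L[ℝ] V :=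
  ((ContinuousLinearMap.lsmul ℝ ℂ : ℂ →L[ℝ] V →L[ℝ] V).flip (g ξ)).comp (extPhase σ ξ)

@[simp] theorem kerDeriv_apply (σ : ℤˣ) (g : E3 → V) (ξ : E3) (p : ℝ × E3) :
    kerDeriv σ g ξ p = extPhase σ ξ p • g ξ := rfl

theorem ExpIntegrable.kerDeriv {g : E3 → V} (hg : ExpIntegrable g) (σ : ℤˣ) :
    ExpIntegrable (kerDeriv σ g) := by
  refine hg.mul_norm (C := 4 * Real.pi) ?_ fun ξ => ?_
  · have h1 := (ContinuousLinearMap.lsmul ℝ ℂ :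
      ℂ →L[ℝ] V →L[ℝ] V).flip.continuous.comp_aestronglyMeasurable hg.aesm
    have h2 := (continuous_extPhase σ).aestronglyMeasurable (μ := (volume : Measure E3))
    have hc : Continuous (Function.uncurry fun (a : ℂ →L[ℝ] V) (b : ℝ × E3 →L[ℝ] ℂ) => a.comp b) :=
      isBoundedBilinearMap_comp.continuous
    exact hc.comp_aestronglyMeasurable₂ h1 h2
  · refine ContinuousLinearMap.opNorm_le_bound _ (by have := Real.pi_pos; positivity) fun p => ?_
    rw [kerDeriv_apply, norm_smul]
    calc _ ≤ 4 * Real.pi * ‖ξ‖ * ‖p‖ * ‖g ξ‖ := by gcongr; exact norm_extPhase_apply_le σ ξ p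
      _ = _ := by ring

/-- Differentiation under the integral. The derivative is again an extension, of a density that is
still integrable against all decaying exponentials, so the statement can be iterated. -/
theorem hasFDerivAt_hardyExt [CompleteSpace V] {g : E3 → V} (hg : ExpIntegrable g) (σ : ℤˣ)
    {p : ℝ × E3} (hp : 0 < p.1) :
    HasFDerivAt (hardyExt σ g) (hardyExt σ (kerDeriv σ g) p) p := by
  have hpi := Real.pi_pos
  have hfun : hardyExt σ g = fun p => ∫ ξ, Complex.exp (extPhase σ ξ p) • g ξ :=
    funext fun p => hardyExt_eq σ g p
  rw [hfun, hardyExt_eq]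
  -- Staying above half the height of p gives one dominating function, with exponent πp.1|ξ|, for
  -- all nearby points.
  have hs : {q : ℝ × E3 | p.1 / 2 < q.1} ∈ 𝓝 p :=
    (isOpen_lt continuous_const continuous_fst).mem_nhds (by simpa using hp)
  have hmeas : ∀ q, Continuous fun ξ : E3 => Complex.exp (extPhase σ ξ q) := fun q =>
    Complex.continuous_exp.comp ((continuous_extPhase σ).clm_apply continuous_const)
  refine hasFDerivAt_integral_of_dominated_of_fderiv_le
    (bound := fun ξ => Real.exp (-(Real.pi * p.1 * ‖ξ‖)) * ‖kerDeriv σ g ξ‖)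
    (F' := fun q ξ => Complex.exp (extPhase σ ξ q) • kerDeriv σ g ξ) hs ?_ ?_ ?_ ?_ ?_ ?_
  · exact .of_forall fun q => (hmeas q).aestronglyMeasurable.smul hg.aesm
  · exact hg.integrable_exp_extPhase σ hp
  · exact (hmeas p).aestronglyMeasurable.smul (hg.kerDeriv σ).aesm
  · refine .of_forall fun ξ q hq => ?_
    rw [norm_smul, norm_exp_extPhase]
    refine mul_le_mul_of_nonneg_right (Real.exp_le_exp.2 ?_) (norm_nonneg _)
    have h1 : p.1 / 2 < q.1 := hq
    have h2 : Real.pi * ‖ξ‖ * p.1 ≤ Real.pi * ‖ξ‖ * (2 * q.1) := by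
      gcongr
      linarith
    linarith
  · exact (hg.kerDeriv σ).integrable _ (by positivity)
  · refine .of_forall fun ξ q _ => ?_
    have h1 : HasFDerivAt (fun q => Complex.exp (extPhase σ ξ q))
        (Complex.exp (extPhase σ ξ q) • extPhase σ ξ) q := (extPhase σ ξ).hasFDerivAt.cexp
    refine (h1.smul_const (g ξ)).congr_fderiv ?_
    ext v <;> simp [smul_smul]

/-- Induction on the order, with the value space quantified inside: the derivative takes values in
the continuous linear maps into V. -/
theorem contDiffOn_hardyExt_nat (n : ℕ) : ∀ {V : Type*} [NormedAddCommGroup V] [NormedSpace ℂ V]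
    [CompleteSpace V] {g : E3 → V}, ExpIntegrable g → ∀ σ : ℤˣ,
    ContDiffOn ℝ n (hardyExt σ g) {p | 0 < p.1} := by
  have ho : IsOpen {p : ℝ × E3 | 0 < p.1} := isOpen_lt continuous_const continuous_fst
  induction n with
  | zero =>
    intro V _ _ _ g hg σ
    rw [Nat.cast_zero, contDiffOn_zero]
    exact fun p hp => (hasFDerivAt_hardyExt hg σ hp).continuousAt.continuousWithinAt
  | succ n ih =>
    intro V _ _ _ g hg σ
    rw [Nat.cast_add, Nat.cast_one, contDiffOn_succ_iff_fderiv_of_isOpen ho]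
    refine ⟨fun p hp => (hasFDerivAt_hardyExt hg σ hp).differentiableAt.differentiableWithinAt,
      by simp, ?_⟩
    exact (ih (hg.kerDeriv σ) σ).congr fun p hp => (hasFDerivAt_hardyExt hg σ hp).fderiv

theorem contDiffOn_hardyExt [CompleteSpace V] {g : E3 → V} (hg : ExpIntegrable g) (σ : ℤˣ) :
    ContDiffOn ℝ ∞ (hardyExt σ g) {p | 0 < p.1} :=
  contDiffOn_infty.2 fun n => contDiffOn_hardyExt_nat n hg σ

theorem hardyExt_kerDeriv_apply [CompleteSpace V] {g : E3 → V} (hg : ExpIntegrable g) (σ : ℤˣ)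
    {p : ℝ × E3} (hp : 0 < p.1) (v : ℝ × E3) :
    hardyExt σ (kerDeriv σ g) p v = hardyExt σ (fun ξ => extPhase σ ξ v • g ξ) p := by
  rw [hardyExt_eq, hardyExt_eq,
    ContinuousLinearMap.integral_apply ((hg.kerDeriv σ).integrable_exp_extPhase σ hp)]
  rfl

theorem expIntegrable_extPhase_smul {g : E3 → V} (hg : ExpIntegrable g) (σ : ℤˣ) (v : ℝ × E3) :
    ExpIntegrable fun ξ => extPhase σ ξ v • g ξ := by
  refine hg.mul_norm (C := 4 * Real.pi * ‖v‖) ?_ fun ξ => ?_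
  · exact ((continuous_extPhase σ).clm_apply continuous_const).aestronglyMeasurable.smul hg.aesm
  · rw [norm_smul]
    calc _ ≤ 4 * Real.pi * ‖ξ‖ * ‖v‖ * ‖g ξ‖ := by gcongr; exact norm_extPhase_apply_le σ ξ v
      _ = _ := by ring

theorem isFourierPair_hardyExt [FiniteDimensional ℂ V] {g : E3 → V} (hg : MemLp g 2) (σ : ℤˣ)
    {t : ℝ} (ht : 0 < t) :
    IsFourierPair σ (fun ξ => (Real.exp (-(2 * Real.pi * t * ‖ξ‖)) : ℂ) • g ξ)
      (fun x => hardyExt σ g (t, x)) :=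
  isFourierPair_fourierInt σ ((expIntegrable_of_memLp hg).integrable_smul
    (ε := 2 * Real.pi * t) (by have := Real.pi_pos; positivity)) (memLp_exp_smul hg ht.le)

theorem eLpNorm_exp_smul_le {g : E3 → V} {t : ℝ} (ht : 0 ≤ t) :
    eLpNorm (fun ξ => (Real.exp (-(2 * Real.pi * t * ‖ξ‖)) : ℂ) • g ξ) 2 volume ≤
      eLpNorm g 2 volume := by
  refine eLpNorm_mono fun ξ => ?_
  rw [norm_smul, Complex.norm_real, Real.norm_of_nonneg (Real.exp_pos _).le]
  refine mul_le_of_le_one_left (norm_nonneg _) (Real.exp_le_one_iff.2 ?_)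
  have := Real.pi_pos
  have : 0 ≤ 2 * Real.pi * t * ‖ξ‖ := by positivity
  linarith

end Extension

/-! ### Conservation laws -/

section Conservation

variable {V : Type*} [NormedAddCommGroup V] [NormedSpace ℝ V]

/-- The strip `a < t < b` in `ℝ × ℝ³`. -/
def strip (a b : ℝ) : Set (ℝ × E3) := {p | p.1 ∈ Set.Ioo a b}

theorem isOpen_strip (a b : ℝ) : IsOpen (strip a b) := isOpen_Ioo.preimage continuous_fst

theorem hasFDerivAt_slice {h : ℝ × E3 → V} {t : ℝ} {x : E3} (hd : DifferentiableAt ℝ h (t, x)) :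
    HasFDerivAt (fun y => h (t, y))
      ((fderiv ℝ h (t, x)).comp (ContinuousLinearMap.inr ℝ ℝ E3)) x :=
  hd.hasFDerivAt.comp x (hasFDerivAt_prodMk_right t x)

theorem hasDerivAt_time {h : ℝ × E3 → V} {t : ℝ} {x : E3} (hd : DifferentiableAt ℝ h (t, x)) :
    HasDerivAt (fun s => h (s, x)) (fderiv ℝ h (t, x) (1, 0)) t := by
  have := hd.hasFDerivAt.comp t (hasFDerivAt_prodMk_left (𝕜 := ℝ) t x)
  simpa [Function.comp_def] using this.hasDerivAt

/-- The cutoff confines x to a compact set, on which the time derivative is bounded for times near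
t; no decay of the derivatives of h is needed. -/
theorem hasDerivAt_integral_cutoff {a b : ℝ} {h : ℝ × E3 → V}
    (hh : ContDiffOn ℝ 1 h (strip a b)) {χ : E3 → ℝ} (hχ : Continuous χ)
    (hχc : HasCompactSupport χ) {t : ℝ} (ht : t ∈ Set.Ioo a b) :
    HasDerivAt (fun s => ∫ x, χ x • h (s, x)) (∫ x, χ x • fderiv ℝ h (t, x) (1, 0)) t := by
  have ho := isOpen_strip a b
  have hdiff : ∀ s ∈ Set.Ioo a b, ∀ x, DifferentiableAt ℝ h (s, x) := fun s hs x =>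
    (hh.differentiableOn one_ne_zero).differentiableAt (ho.mem_nhds hs)
  have hcont : ∀ s ∈ Set.Ioo a b, Continuous fun x => h (s, x) := fun s hs =>
    continuous_iff_continuousAt.2 fun x => (hasFDerivAt_slice (hdiff s hs x)).continuousAt
  have hfd : ContinuousOn (fun p => fderiv ℝ h p (1, 0)) (strip a b) :=
    (hh.continuousOn_fderiv_of_isOpen ho le_rfl).clm_apply continuousOn_const
  obtain ⟨r, hr, hrs⟩ := Metric.nhds_basis_closedBall.mem_iff.1 (isOpen_Ioo.mem_nhds ht)
  have hK : IsCompact (Metric.closedBall t r ×ˢ tsupport χ) :=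
    (isCompact_closedBall t r).prod hχc
  obtain ⟨B, hB⟩ := hK.exists_bound_of_continuousOn (hfd.mono fun p hp => hrs hp.1)
  have hfdt : Continuous fun x => fderiv ℝ h (t, x) (1, 0) :=
    hfd.comp_continuous (by fun_prop : Continuous fun x : E3 => (t, x)) fun x => ht
  refine (hasDerivAt_integral_of_dominated_loc_of_deriv_le (bound := fun x => B * ‖χ x‖)
    (F' := fun s x => χ x • fderiv ℝ h (s, x) (1, 0))
    (Metric.closedBall_mem_nhds t hr) ?_ ?_ ?_ ?_ ?_ ?_).2
  · filter_upwards [isOpen_Ioo.mem_nhds ht] with s hs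
    exact (hχ.smul (hcont s hs)).aestronglyMeasurable
  · exact (hχ.smul (hcont t ht)).integrable_of_hasCompactSupport hχc.smul_right
  · exact (hχ.smul hfdt).aestronglyMeasurable
  · refine .of_forall fun x s hs => ?_
    by_cases hx : x ∈ tsupport χ
    · rw [norm_smul, mul_comm]
      exact mul_le_mul_of_nonneg_right (hB (s, x) ⟨hs, hx⟩) (norm_nonneg _)
    · simp [image_eq_zero_of_notMem_tsupport hx]
  · exact (hχ.integrable_of_hasCompactSupport hχc).norm.const_mul B
  · exact .of_forall fun x s hs => (hasDerivAt_time (hdiff s (hrs hs) x)).const_smul (χ x)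

/-- Integration by parts on a slice moves the derivative from the flux to the cutoff, so that only
the flux itself has to be integrable later. -/
theorem integral_cutoff_fderiv {a b : ℝ} {H : ℝ × E3 → V}
    (hH : ContDiffOn ℝ 1 H (strip a b)) {χ : E3 → ℝ} (hχ : ContDiff ℝ 1 χ)
    (hχc : HasCompactSupport χ) {t : ℝ} (ht : t ∈ Set.Ioo a b) (v : E3) :
    Integrable (fun x => χ x • fderiv ℝ H (t, x) (0, v)) ∧
    ∫ x, χ x • fderiv ℝ H (t, x) (0, v) = -∫ x, fderiv ℝ χ x v • H (t, x) := by
  have ho := isOpen_strip a b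
  have hdiff : ∀ x, DifferentiableAt ℝ H (t, x) := fun x =>
    (hH.differentiableOn one_ne_zero).differentiableAt (ho.mem_nhds ht)
  have hcont : Continuous fun x => H (t, x) :=
    continuous_iff_continuousAt.2 fun x => (hasFDerivAt_slice (hdiff x)).continuousAt
  have hfd : Continuous fun x => fderiv ℝ H (t, x) (0, v) :=
    ((hH.continuousOn_fderiv_of_isOpen ho le_rfl).clm_apply continuousOn_const).comp_continuous
      (by fun_prop : Continuous fun x : E3 => (t, x)) fun x => ht
  have hfχ : Continuous fun x => fderiv ℝ χ x v :=
    (hχ.continuous_fderiv one_ne_zero).clm_apply continuous_const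
  have he : ∀ x, fderiv ℝ H (t, x) (0, v) = fderiv ℝ (fun y => H (t, y)) x v := fun x => by
    rw [(hasFDerivAt_slice (hdiff x)).fderiv]
    simp
  have hi : Integrable (fun x => χ x • fderiv ℝ H (t, x) (0, v)) :=
    (hχ.continuous.smul hfd).integrable_of_hasCompactSupport hχc.smul_right
  refine ⟨hi, ?_⟩
  simp only [he] at hi ⊢
  refine integral_smul_fderiv_eq_neg_fderiv_smul_of_integrable ?_ hi ?_ ?_ ?_
  · exact (hfχ.smul hcont).integrable_of_hasCompactSupport
      ((hχc.fderiv_apply (𝕜 := ℝ) v).smul_right)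
  · exact (hχ.continuous.smul hcont).integrable_of_hasCompactSupport hχc.smul_right
  · exact fun x _ => (hχ.differentiable one_ne_zero) x
  · exact fun x _ => (hasFDerivAt_slice (hdiff x)).differentiableAt

/-- If `∂ₜh + ∑ ∂ₖHₖ = 0` in a strip and the fluxes `Hₖ` are integrable over the slices, uniformly,
then the integral of `h` over the slices is constant. -/
theorem integral_slice_eq_of_divergence_eq_zero {a b : ℝ} {h : ℝ × E3 → V}
    {H : Fin 3 → ℝ × E3 → V} (hh : ContDiffOn ℝ 1 h (strip a b))
    (hH : ∀ k, ContDiffOn ℝ 1 (H k) (strip a b))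
    (hdiv : ∀ p ∈ strip a b, fderiv ℝ h p (1, 0) +
      ∑ k, fderiv ℝ (H k) p (0, EuclideanSpace.single k (1 : ℝ)) = 0)
    (hint : ∀ t ∈ Set.Ioo a b, Integrable fun x => h (t, x)) {K : ℝ}
    (hHint : ∀ k, ∀ t ∈ Set.Ioo a b, Integrable fun x => H k (t, x))
    (hK : ∀ k, ∀ t ∈ Set.Ioo a b, ∫ x, ‖H k (t, x)‖ ≤ K) {s t : ℝ} (hs : s ∈ Set.Ioo a b)
    (ht : t ∈ Set.Ioo a b) :
    ∫ x, h (s, x) = ∫ x, h (t, x) := by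
  -- Fluxes have no pointwise decay at infinity, so slices are cut off by φ(x/(n + 1)), whose
  -- gradient is of size 1/(n + 1).
  let φ : ContDiffBump (0 : E3) := ⟨1, 2, one_pos, one_lt_two⟩
  have hφ : ContDiff ℝ 1 φ := φ.contDiff
  obtain ⟨M, hM⟩ : ∃ M, ∀ x, ‖fderiv ℝ φ x‖ ≤ M :=
    (hφ.continuous_fderiv one_ne_zero).bounded_above_of_compact_support
      (φ.hasCompactSupport.fderiv (𝕜 := ℝ))
  have hM0 : 0 ≤ M := (norm_nonneg _).trans (hM 0)
  set χ : ℕ → E3 → ℝ := fun n x => φ (((n : ℝ) + 1)⁻¹ • x) with hχdef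
  have hn : ∀ n : ℕ, (0 : ℝ) < ((n : ℝ) + 1)⁻¹ := fun n => by positivity
  have hχ : ∀ n, ContDiff ℝ 1 (χ n) := fun n => hφ.comp (contDiff_const_smul _)
  have hχc : ∀ n, HasCompactSupport (χ n) := fun n =>
    φ.hasCompactSupport.comp_smul (hn n).ne'
  have hχ1 : ∀ n x, ‖χ n x‖ ≤ 1 := fun n x => by
    rw [Real.norm_of_nonneg φ.nonneg]
    exact φ.le_one
  have hχd : ∀ n x v, ‖fderiv ℝ (χ n) x v‖ ≤ ((n : ℝ) + 1)⁻¹ * (M * ‖v‖) := by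
    intro n x v
    have h1 : HasFDerivAt (χ n) ((fderiv ℝ φ (((n : ℝ) + 1)⁻¹ • x)).comp
        (((n : ℝ) + 1)⁻¹ • ContinuousLinearMap.id ℝ E3)) x :=
      ((hφ.differentiable one_ne_zero) _).hasFDerivAt.comp x
        ((hasFDerivAt_id x).const_smul ((n : ℝ) + 1)⁻¹)
    rw [h1.fderiv]
    simp only [ContinuousLinearMap.comp_apply, smul_apply, ContinuousLinearMap.id_apply, map_smul,
      norm_smul, Real.norm_of_nonneg (hn n).le]
    gcongr
    exact (fderiv ℝ φ _).le_of_opNorm_le (hM _) v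
  set J : ℕ → ℝ → V := fun n s => ∫ x, χ n x • h (s, x) with hJ
  have hderiv : ∀ n, ∀ r ∈ Set.Ioo a b, HasDerivAt (J n)
      (∑ k, ∫ x, fderiv ℝ (χ n) x (EuclideanSpace.single k (1 : ℝ)) • H k (r, x)) r := by
    intro n r hr
    refine (hasDerivAt_integral_cutoff hh (hχ n).continuous (hχc n) hr).congr_deriv ?_
    have h1 : ∀ x, χ n x • fderiv ℝ h (r, x) (1, 0) =
        -∑ k, χ n x • fderiv ℝ (H k) (r, x) (0, EuclideanSpace.single k (1 : ℝ)) := by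
      intro x
      rw [← Finset.smul_sum, ← smul_neg, eq_neg_of_add_eq_zero_left (hdiv (r, x) hr)]
    simp only [h1]
    rw [integral_neg, integral_finsetSum _ fun k _ =>
      (integral_cutoff_fderiv (hH k) (hχ n) (hχc n) hr _).1, ← Finset.sum_neg_distrib]
    exact Finset.sum_congr rfl fun k _ => by
      rw [(integral_cutoff_fderiv (hH k) (hχ n) (hχc n) hr _).2, neg_neg]
  -- The cut-off integral changes only through the gradient of the cutoff, at a rate O(1/n) uniform
  -- in time; the mean value inequality and n → ∞ then give constancy.
  have hbound : ∀ n, ∀ r ∈ Set.Ioo a b,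
      ‖∑ k, ∫ x, fderiv ℝ (χ n) x (EuclideanSpace.single k (1 : ℝ)) • H k (r, x)‖ ≤
        ((n : ℝ) + 1)⁻¹ * (3 * (M * K)) := by
    intro n r hr
    refine (norm_sum_le_of_le _ (f := fun k : Fin 3 =>
      ∫ x, fderiv ℝ (χ n) x (EuclideanSpace.single k (1 : ℝ)) • H k (r, x))
      (n := fun _ => ((n : ℝ) + 1)⁻¹ * (M * K)) fun k _ => ?_).trans_eq ?_
    · refine (norm_integral_le_of_norm_le (((hHint k r hr).norm).const_mul
        (((n : ℝ) + 1)⁻¹ * M)) (.of_forall fun x => ?_)).trans ?_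
      · rw [norm_smul]
        have := hχd n x (EuclideanSpace.single k (1 : ℝ))
        rw [show ‖EuclideanSpace.single k (1 : ℝ)‖ = 1 by simp, mul_one] at this
        gcongr
      · rw [integral_const_mul, mul_assoc]
        have := hn n
        gcongr
        exact hK k r hr
    · simp
      ring
  have hlip : ∀ n, ‖J n s - J n t‖ ≤ ((n : ℝ) + 1)⁻¹ * (3 * (M * K)) * ‖s - t‖ := fun n =>
    (convex_Ioo a b).norm_image_sub_le_of_norm_hasDerivWithin_le
      (fun r hr => (hderiv n r hr).hasDerivWithinAt) (hbound n) ht hs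
  have hinv : Tendsto (fun n : ℕ => ((n : ℝ) + 1)⁻¹) atTop (𝓝 0) :=
    tendsto_inv_atTop_zero.comp (tendsto_natCast_atTop_atTop.atTop_add tendsto_const_nhds)
  have hlim : ∀ r ∈ Set.Ioo a b, Tendsto (fun n => J n r) atTop (𝓝 (∫ x, h (r, x))) := by
    intro r hr
    refine tendsto_integral_of_dominated_convergence (fun x => ‖h (r, x)‖) (fun n => ?_)
      (hint r hr).norm (fun n => .of_forall fun x => ?_) (.of_forall fun x => ?_)
    · exact (hχ n).continuous.aestronglyMeasurable.smul (hint r hr).aestronglyMeasurable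
    · rw [norm_smul]
      exact mul_le_of_le_one_left (norm_nonneg _) (hχ1 n x)
    · have h1 : Tendsto (fun n : ℕ => χ n x) atTop (𝓝 1) := by
        have h2 : Tendsto (fun n : ℕ => φ (((n : ℝ) + 1)⁻¹ • x)) atTop (𝓝 (φ ((0 : ℝ) • x))) :=
          (hφ.continuous.tendsto _).comp (hinv.smul_const x)
        rwa [zero_smul, φ.one_of_mem_closedBall (by simp [φ])] at h2
      simpa using h1.smul_const (h (r, x))
  have h0 : Tendsto (fun n => J n s - J n t) atTop (𝓝 0) := by
    refine squeeze_zero_norm hlip ?_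
    simpa using ((hinv.mul_const (3 * (M * K))).mul_const ‖s - t‖)
  exact sub_eq_zero.1 (tendsto_nhds_unique ((hlim s hs).sub (hlim t ht)) h0)

end Conservation

/-! ### Monogenic functions -/

section Monogenic

variable {A : Type*} [NormedRing A] [NormedAlgebra ℂ A]

/-- The slice integrals of the product of a right and a left monogenic function are constant. -/
theorem integral_slice_mul_eq {c : Fin 3 → A} {Φ G : ℝ × E3 → A} {a b : ℝ}
    (hΦ : ContDiffOn ℝ 1 Φ (strip a b)) (hG : ContDiffOn ℝ 1 G (strip a b))
    (eqΦ : ∀ p ∈ strip a b, fderiv ℝ Φ p (1, 0) +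
      ∑ k, fderiv ℝ Φ p (0, EuclideanSpace.single k (1 : ℝ)) * c k = 0)
    (eqG : ∀ p ∈ strip a b, fderiv ℝ G p (1, 0) +
      ∑ k, c k * fderiv ℝ G p (0, EuclideanSpace.single k (1 : ℝ)) = 0)
    {C : ℝ≥0} (bΦ : ∀ t ∈ Set.Ioo a b, MemLp (fun x => Φ (t, x)) 2)
    (bΦ' : ∀ t ∈ Set.Ioo a b, eLpNorm (fun x => Φ (t, x)) 2 volume ≤ C)
    (bG : ∀ t ∈ Set.Ioo a b, MemLp (fun x => G (t, x)) 2)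
    (bG' : ∀ t ∈ Set.Ioo a b, eLpNorm (fun x => G (t, x)) 2 volume ≤ C) {s t : ℝ}
    (hs : s ∈ Set.Ioo a b) (ht : t ∈ Set.Ioo a b) :
    ∫ x, Φ (s, x) * G (s, x) = ∫ x, Φ (t, x) * G (t, x) := by
  have ho := isOpen_strip a b
  have dΦ : ∀ p ∈ strip a b, DifferentiableAt ℝ Φ p := fun p hp =>
    (hΦ.differentiableOn one_ne_zero).differentiableAt (ho.mem_nhds hp)
  have dG : ∀ p ∈ strip a b, DifferentiableAt ℝ G p := fun p hp =>
    (hG.differentiableOn one_ne_zero).differentiableAt (ho.mem_nhds hp)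
  have hmul : ∀ k, ∀ t ∈ Set.Ioo a b, MemLp (fun x => c k * G (t, x)) 2 := fun k t ht =>
    (bG t ht).const_mul (c k)
  refine integral_slice_eq_of_divergence_eq_zero (h := fun p => Φ p * G p)
    (H := fun k p => Φ p * (c k * G p)) (K := ∑ k, C * (‖c k‖ * C)) (hΦ.mul hG)
    (fun k => hΦ.mul (contDiffOn_const.mul hG)) (fun p hp => ?_)
    (fun t ht => MemLp.integrable_mul_two (bΦ t ht) (bG t ht))
    (fun k t ht => MemLp.integrable_mul_two (bΦ t ht) (hmul k t ht)) (fun k t ht => ?_) hs ht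
  · have h1 : fderiv ℝ (fun p => Φ p * G p) p = _ := ((dΦ p hp).hasFDerivAt.mul' (dG p hp).hasFDerivAt).fderiv
    have h2 : ∀ k, fderiv ℝ (fun p => Φ p * (c k * G p)) p = _ := fun k => ((dΦ p hp).hasFDerivAt.mul'
      ((dG p hp).hasFDerivAt.const_mul (c k))).fderiv
    have e1 := eqΦ p hp
    have e2 := eqG p hp
    rw [add_eq_zero_iff_eq_neg] at e1 e2
    rw [h1]
    simp only [h2]
    simp only [add_apply, smul_apply, smul_eq_mul, MulOpposite.smul_eq_mul_unop,
      MulOpposite.unop_op, e1, e2, Finset.sum_add_distrib, ← mul_assoc, ← Finset.sum_mul]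
    simp only [mul_neg, neg_mul]
    simp only [mul_assoc, ← Finset.mul_sum]
    abel
  · have h1 : ∫ x, ‖Φ (t, x) * (c k * G (t, x))‖ ≤ C * (‖c k‖ * C) := by
      rw [integral_norm_eq_lintegral_enorm
        (MemLp.integrable_mul_two (bΦ t ht) (hmul k t ht)).aestronglyMeasurable,
        ← eLpNorm_one_eq_lintegral_enorm]
      refine ENNReal.toReal_le_of_le_ofReal (by positivity) ?_
      refine (eLpNorm_smul_le_mul_eLpNorm (p := 2) (q := 2) (r := 1) (hmul k t ht).1
        (bΦ t ht).1).trans ?_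
      rw [ENNReal.ofReal_mul C.coe_nonneg, ENNReal.ofReal_coe_nnreal,
        ENNReal.ofReal_mul (norm_nonneg _), ENNReal.ofReal_coe_nnreal]
      gcongr
      · exact bΦ' t ht
      · refine (eLpNorm_le_mul_eLpNorm_of_ae_le_mul
          (.of_forall fun x => norm_mul_le (c k) (G (t, x))) 2).trans ?_
        gcongr
        exact bG' t ht
    exact h1.trans (Finset.single_le_sum (f := fun k => (C : ℝ) * (‖c k‖ * C))
      (fun _ _ => by positivity) (Finset.mem_univ k))

/-- `e` satisfies the relations `e_j² = -1`, `e_j e_k = -e_k e_j`. -/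
structure IsCliffordSystem (e : Fin 3 → A) : Prop where
  sq : ∀ j, e j * e j = -1
  anti : ∀ j k, j ≠ k → e j * e k = -(e k * e j)

theorem IsCliffordSystem.vec_mul_self {e : Fin 3 → A} (he : IsCliffordSystem e) (x : E3) :
    vec e x * vec e x = (-(‖x‖ ^ 2 : ℝ) : ℂ) • (1 : A) := by
  have h : (‖x‖ ^ 2 : ℝ) = x 0 ^ 2 + x 1 ^ 2 + x 2 ^ 2 := by
    rw [EuclideanSpace.real_norm_sq_eq, Fin.sum_univ_three]
  rw [h, vec, Fin.sum_univ_three]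
  simp only [add_mul, mul_add, smul_mul_smul_comm, he.sq, he.anti 1 0 (by decide),
    he.anti 2 0 (by decide), he.anti 2 1 (by decide)]
  push_cast
  module

theorem continuous_vec (e : Fin 3 → A) : Continuous (vec e) := by
  unfold vec
  fun_prop

theorem norm_vec_le (e : Fin 3 → A) (x : E3) : ‖vec e x‖ ≤ (∑ j, ‖e j‖) * ‖x‖ := by
  rw [vec, Finset.sum_mul]
  refine norm_sum_le_of_le _ fun j _ => ?_
  rw [norm_smul, Complex.norm_real, mul_comm]
  gcongr
  exact PiLp.norm_apply_le x j

theorem vec_smul (e : Fin 3 → A) (r : ℝ) (x : E3) : vec e (r • x) = (r : ℂ) • vec e x := by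
  simp only [vec, Finset.smul_sum, smul_smul, PiLp.smul_apply, smul_eq_mul, Complex.ofReal_mul]

/-- `g(ξ)` lies in the eigenspace of `iξ` for the eigenvalue `τ|ξ|`. -/
def IsSpectral (e : Fin 3 → A) (τ : ℤˣ) (g : E3 → A) : Prop :=
  ∀ᵐ ξ : E3, Complex.I • (vec e ξ * g ξ) = ((sgn τ * ‖ξ‖ : ℝ) : ℂ) • g ξ

theorem extPhase_time (σ : ℤˣ) (ξ : E3) (r : ℝ) :
    extPhase σ ξ (r, 0) = -(2 * Real.pi * ‖ξ‖ * r) := by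
  simp [extPhase_apply]

theorem extPhase_space (σ : ℤˣ) (ξ : E3) (k : Fin 3) :
    extPhase σ ξ (0, EuclideanSpace.single k (1 : ℝ)) =
      2 * Real.pi * Complex.I * sgn σ * (ξ k : ℝ) := by
  simp [extPhase_apply, EuclideanSpace.inner_single_left]

variable [FiniteDimensional ℂ A]

/-- Computes the symbol of a first-order operator with constant coefficients. The maps L k are
arbitrary so that both left multiplication (the operator D_σ) and right multiplication (the test
functions) are covered. -/
theorem hardyExt_combination {g : E3 → A} (hg : ExpIntegrable g) (σ : ℤˣ) {p : ℝ × E3}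
    (hp : 0 < p.1) (r : ℝ) (L : Fin 3 → A →L[ℂ] A) :
    hardyExt σ (kerDeriv σ g) p (r, 0) +
      ∑ k, L k (hardyExt σ (kerDeriv σ g) p (0, EuclideanSpace.single k (1 : ℝ))) =
    hardyExt σ (fun ξ => -(2 * Real.pi * ‖ξ‖ * r : ℂ) • g ξ + (2 * Real.pi * Complex.I * sgn σ) •
      ∑ k, (ξ k : ℂ) • L k (g ξ)) p := by
  have : CompleteSpace A := FiniteDimensional.complete ℂ A
  simp only [hardyExt_kerDeriv_apply hg σ hp]
  have hv := fun v => (expIntegrable_extPhase_smul hg σ v).integrable_exp_extPhase σ hp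
  have hk : ∀ k, L k (hardyExt σ (fun ξ => extPhase σ ξ (0, EuclideanSpace.single k (1 : ℝ)) • g ξ) p) =
      ∫ ξ, L k (Complex.exp (extPhase σ ξ p) •
        extPhase σ ξ (0, EuclideanSpace.single k (1 : ℝ)) • g ξ) := fun k => by
    rw [hardyExt_eq, ← (L k).integral_comp_comm (hv _)]
  simp only [hk]
  rw [hardyExt_eq, hardyExt_eq, ← integral_finsetSum _ fun k _ => (L k).integrable_comp (hv _),
    ← integral_add (hv _) (integrable_finsetSum _ fun k _ => (L k).integrable_comp (hv _))]
  refine integral_congr_ae (.of_forall fun ξ => ?_)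
  simp only [extPhase_time, extPhase_space, map_smul, smul_add, Finset.smul_sum, smul_smul]

omit [FiniteDimensional ℂ A] in
theorem hardyExt_eq_zero {g : E3 → A} (σ : ℤˣ) (p : ℝ × E3) (h : ∀ᵐ ξ, g ξ = 0) :
    hardyExt σ g p = 0 := by
  rw [hardyExt_eq]
  refine integral_eq_zero_of_ae ?_
  filter_upwards [h] with ξ hξ
  simp [hξ]

omit [FiniteDimensional ℂ A] in
theorem sum_smul_mul_eq_vec (e : Fin 3 → A) (ξ : E3) (a : A) :
    ∑ k, (ξ k : ℂ) • (e k * a) = vec e ξ * a := by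
  simp [vec, Finset.sum_mul]

omit [FiniteDimensional ℂ A] in
theorem sum_smul_mul_eq_vec' (e : Fin 3 → A) (ξ : E3) (a : A) :
    ∑ k, (ξ k : ℂ) • (a * e k) = a * vec e ξ := by
  simp [vec, Finset.mul_sum]

/-- The affine change of time `t ↦ d + rt`. -/
theorem hasFDerivAt_hardyExt_comp {g : E3 → A} (hg : ExpIntegrable g) (σ : ℤˣ) (d r : ℝ)
    {p : ℝ × E3} (hp : 0 < d + r * p.1) :
    HasFDerivAt (fun q : ℝ × E3 => hardyExt σ g (d + r * q.1, q.2))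
      ((hardyExt σ (kerDeriv σ g) (d + r * p.1, p.2)).comp
        ((r • ContinuousLinearMap.fst ℝ ℝ E3).prod (ContinuousLinearMap.snd ℝ ℝ E3))) p := by
  have : CompleteSpace A := FiniteDimensional.complete ℂ A
  have h1 : HasFDerivAt (fun q : ℝ × E3 => (d + r * q.1, q.2))
      ((r • ContinuousLinearMap.fst ℝ ℝ E3).prod (ContinuousLinearMap.snd ℝ ℝ E3)) p :=
    ((hasFDerivAt_fst.const_mul r).const_add d).prodMk hasFDerivAt_snd
  exact (hasFDerivAt_hardyExt hg σ (p := (d + r * p.1, p.2)) hp).comp p h1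

theorem contDiffOn_hardyExt_comp {g : E3 → A} (hg : ExpIntegrable g) (σ : ℤˣ) (d r : ℝ) :
    ContDiffOn ℝ ∞ (fun q : ℝ × E3 => hardyExt σ g (d + r * q.1, q.2))
      {q | 0 < d + r * q.1} := by
  have : CompleteSpace A := FiniteDimensional.complete ℂ A
  exact (contDiffOn_hardyExt hg σ).comp
    (by fun_prop : ContDiff ℝ ∞ fun q : ℝ × E3 => (d + r * q.1, q.2)).contDiffOn fun q hq => hq

/-- The extension of a spectral `L²` function is in the monogenic Hardy space. -/
theorem isMonogenicHardy_hardyExt {e : Fin 3 → A} {σ τ : ℤˣ} {g : E3 → A} (hg : MemLp g 2)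
    (hs : IsSpectral e τ g) :
    IsMonogenicHardy e σ τ fun p => hardyExt σ g (sgn τ * p.1, p.2) where
  smooth := by
    have := contDiffOn_hardyExt_comp (expIntegrable_of_memLp hg) σ 0 (sgn τ)
    simp only [zero_add] at this
    exact this
  monogenic p hp := by
    have h0 : 0 < 0 + sgn τ * p.1 := by
      rw [zero_add]
      exact hp
    have hd := hasFDerivAt_hardyExt_comp (expIntegrable_of_memLp hg) σ 0 (sgn τ) h0
    simp only [zero_add] at hd h0
    rw [diracOp, hd.fderiv, Finset.smul_sum]
    have := hardyExt_combination (expIntegrable_of_memLp hg) σ (p := (sgn τ * p.1, p.2)) h0 (sgn τ)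
      fun k => (sgn σ : ℂ) • ContinuousLinearMap.mul ℂ A (e k)
    simp only [smul_apply, ContinuousLinearMap.mul_apply'] at this
    simp only [ContinuousLinearMap.comp_apply, ContinuousLinearMap.prod_apply, smul_apply,
      ContinuousLinearMap.coe_fst', ContinuousLinearMap.coe_snd', smul_eq_mul, mul_one, mul_zero]
    rw [this]
    -- The symbol applied to g vanishes almost everywhere: time contributes -2πτ|ξ|g, space
    -- contributes 2πiξg, since σ² = 1, and the spectral condition makes them cancel.
    refine hardyExt_eq_zero _ _ ?_
    filter_upwards [hs] with ξ hξ
    have h1 : ∑ k, (ξ k : ℂ) • (sgn σ : ℂ) • (e k * g ξ) = (sgn σ : ℂ) • (vec e ξ * g ξ) := by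
      rw [← sum_smul_mul_eq_vec, Finset.smul_sum]
      exact Finset.sum_congr rfl fun k _ => smul_comm _ _ _
    have h2 : (sgn σ : ℂ) * sgn σ = 1 := by exact_mod_cast sgn_mul_self σ
    rw [h1, smul_smul, show 2 * (Real.pi : ℂ) * Complex.I * sgn σ * sgn σ =
      2 * Real.pi * Complex.I by rw [mul_assoc, h2, mul_one], mul_smul, hξ, smul_smul, ← add_smul]
    push_cast
    rw [show -(2 * (Real.pi : ℂ) * ‖ξ‖ * sgn τ) + 2 * Real.pi * (sgn τ * ‖ξ‖) = 0 by ring,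
      zero_smul]
  bounded := by
    obtain ⟨C, hC⟩ := exists_eLpNorm_le_of_isFourierPair A
    refine ⟨C * (eLpNorm g 2 volume).toNNReal, fun t ht => ?_⟩
    rw [ENNReal.coe_mul, ENNReal.coe_toNNReal hg.2.ne]
    simp only [← mul_assoc, sgn_mul_self, one_mul]
    refine (hC σ _ _ (isFourierPair_hardyExt hg σ ht)).trans ?_
    gcongr
    exact eLpNorm_exp_smul_le ht.le

/-- The boundary values of the extension are given by the Fourier transform. -/
theorem ae_tendsto_hardyExt {σ τ : ℤˣ} {g f : E3 → A} (h : IsFourierPair σ g f) :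
    ∀ᵐ x : E3, ∀ a : ℝ, 0 < a →
      Tendsto (fun p : ℝ × E3 => hardyExt σ g (sgn τ * p.1, p.2)) (𝓝[cone τ a x] (0, x))
        (𝓝 (f x)) := by
  filter_upwards [ae_tendsto_poisson h.right] with x hx a ha
  refine (hx τ a ha).congr' ?_
  filter_upwards [self_mem_nhdsWithin] with p hp
  exact (fourierInt_exp_smul_eq_poisson h hp.1 p.2).symm

end Monogenic

/-! ### Representation of monogenic Hardy functions -/

section Representation

variable {A : Type*} [NormedRing A] [NormedAlgebra ℂ A]

/-- The projection `(1 + iηξ/|ξ|)/2` onto the eigenspace of `iξ` for the eigenvalue `η|ξ|`. -/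
def spectralProj (e : Fin 3 → A) (η : ℤˣ) (ξ : E3) : A :=
  (2⁻¹ : ℂ) • (1 + ((sgn η * ‖ξ‖⁻¹ : ℝ) : ℂ) • Complex.I • vec e ξ)

theorem stronglyMeasurable_spectralProj (e : Fin 3 → A) (η : ℤˣ) :
    StronglyMeasurable (spectralProj e η) := by
  have h1 : StronglyMeasurable fun ξ : E3 => ((sgn η * ‖ξ‖⁻¹ : ℝ) : ℂ) :=
    (Complex.measurable_ofReal.comp (measurable_norm.inv.const_mul _)).stronglyMeasurable
  have h2 : StronglyMeasurable fun ξ : E3 => Complex.I • vec e ξ :=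
    ((continuous_vec e).const_smul Complex.I).stronglyMeasurable
  exact (stronglyMeasurable_const.add (h1.smul h2)).const_smul _

theorem norm_spectralProj_le (e : Fin 3 → A) (η : ℤˣ) (ξ : E3) :
    ‖spectralProj e η ξ‖ ≤ ‖(1 : A)‖ + ∑ j, ‖e j‖ := by
  have h1 : ‖((sgn η * ‖ξ‖⁻¹ : ℝ) : ℂ) • Complex.I • vec e ξ‖ ≤ ∑ j, ‖e j‖ := by
    rw [norm_smul, norm_smul, Complex.norm_I, one_mul, Complex.norm_real, norm_mul,
      Real.norm_eq_abs, abs_sgn, one_mul, norm_inv, norm_norm]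
    rcases eq_or_ne ξ 0 with rfl | hξ
    · simpa using Finset.sum_nonneg fun j _ => norm_nonneg (e j)
    · rw [inv_mul_le_iff₀ (norm_pos_iff.2 hξ), mul_comm]
      exact norm_vec_le e ξ
  rw [spectralProj, norm_smul]
  have h2 : ‖(2⁻¹ : ℂ)‖ ≤ 1 := by norm_num
  exact (mul_le_of_le_one_left (norm_nonneg _) h2).trans ((norm_add_le _ _).trans (by gcongr))

theorem memLp_spectralProj_mul (e : Fin 3 → A) (η : ℤˣ) {g : E3 → A} (hg : MemLp g 2) :
    MemLp (fun ξ => spectralProj e η ξ * g ξ) 2 := by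
  refine hg.of_le_mul ((stronglyMeasurable_spectralProj e η).aestronglyMeasurable.mul hg.1)
    (c := ‖(1 : A)‖ + ∑ j, ‖e j‖) (.of_forall fun ξ => ?_)
  exact (norm_mul_le _ _).trans (by gcongr; exact norm_spectralProj_le e η ξ)

theorem eLpNorm_spectralProj_mul_le (e : Fin 3 → A) (η : ℤˣ) (g : E3 → A) :
    eLpNorm (fun ξ => spectralProj e η ξ * g ξ) 2 volume ≤
      ENNReal.ofReal (‖(1 : A)‖ + ∑ j, ‖e j‖) * eLpNorm g 2 volume :=
  eLpNorm_le_mul_eLpNorm_of_ae_le_mul (.of_forall fun ξ => (norm_mul_le _ _).trans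
    (by gcongr; exact norm_spectralProj_le e η ξ)) 2

theorem spectralProj_add_neg (e : Fin 3 → A) (η : ℤˣ) (ξ : E3) :
    spectralProj e η ξ + spectralProj e (-η) ξ = 1 := by
  simp only [spectralProj, sgn_neg]
  push_cast
  module

/-- Follows from ξ² = -|ξ|². The vector acts on the right here because the projection serves as the
amplitude of right monogenic test functions. -/
theorem spectralProj_mul_vec {e : Fin 3 → A} (he : IsCliffordSystem e) (η : ℤˣ) (ξ : E3) :
    Complex.I • (spectralProj e η ξ * vec e ξ) =
      ((sgn η * ‖ξ‖ : ℝ) : ℂ) • spectralProj e η ξ := by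
  rcases eq_or_ne ξ 0 with rfl | hξ
  · have : vec e 0 = 0 := by simp [vec]
    simp [this]
  · have h1 : (‖ξ‖ : ℂ) ≠ 0 := by exact_mod_cast norm_ne_zero_iff.2 hξ
    have h2 : (sgn η : ℂ) * sgn η = 1 := by exact_mod_cast sgn_mul_self η
    have h3 : (sgn η : ℂ) * ‖ξ‖ * (sgn η * (‖ξ‖ : ℂ)⁻¹) = 1 := by
      field_simp
      rw [sq, h2]
    have h4 : Complex.I * ((sgn η : ℂ) * (‖ξ‖ : ℂ)⁻¹) * Complex.I * -(‖ξ‖ : ℂ) ^ 2 =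
        sgn η * ‖ξ‖ := by
      field_simp
      rw [Complex.I_sq]
      ring
    simp only [spectralProj, smul_mul_assoc, add_mul, one_mul, he.vec_mul_self]
    push_cast
    rw [smul_comm Complex.I (2⁻¹ : ℂ), smul_comm ((sgn η : ℂ) * ‖ξ‖) (2⁻¹ : ℂ)]
    congr 1
    rw [smul_add, smul_add, smul_smul, smul_smul, smul_smul _ (_ * _) (_ • vec e ξ), h3, one_smul,
      smul_smul, h4, add_comm]

/-- For ξ ≠ 0 the hypothesis is the eigenvalue equation divided by |ξ|, up to a factor; for ξ = 0
both sides vanish. -/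
theorem smul_vec_mul_of_spectralProj_eq_zero {e : Fin 3 → A} {τ : ℤˣ} {ξ : E3} {a : A}
    (h : spectralProj e (-τ) ξ * a = 0) :
    Complex.I • (vec e ξ * a) = ((sgn τ * ‖ξ‖ : ℝ) : ℂ) • a := by
  rcases eq_or_ne ξ 0 with rfl | hξ
  · have : vec e 0 = 0 := by simp [vec]
    simp [this]
  · have h1 : (‖ξ‖ : ℂ) ≠ 0 := by exact_mod_cast norm_ne_zero_iff.2 hξ
    have h2 : (sgn τ : ℂ) * sgn τ = 1 := by exact_mod_cast sgn_mul_self τ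
    rw [spectralProj, smul_mul_assoc, smul_eq_zero_iff_right (by norm_num), add_mul, one_mul,
      smul_mul_assoc, smul_mul_assoc, sgn_neg, add_eq_zero_iff_eq_neg] at h
    nth_rewrite 2 [h]
    rw [← neg_smul, smul_smul]
    push_cast
    have : (sgn τ : ℂ) * ‖ξ‖ * -(-sgn τ * (‖ξ‖ : ℂ)⁻¹) = 1 := by
      field_simp
      rw [sq, h2]
    rw [this, one_smul]

/-- A monogenic Hardy function on a half-space, transported to the upper half-space. -/
def timeFlip (τ : ℤˣ) (F : ℝ × E3 → A) (p : ℝ × E3) : A := F (sgn τ * p.1, p.2)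

theorem contDiffOn_timeFlip {e : Fin 3 → A} {σ τ : ℤˣ} {F : ℝ × E3 → A}
    (hF : IsMonogenicHardy e σ τ F) : ContDiffOn ℝ ∞ (timeFlip τ F) {p | 0 < p.1} := by
  refine hF.smooth.comp
    (by fun_prop : ContDiff ℝ ∞ fun q : ℝ × E3 => (sgn τ * q.1, q.2)).contDiffOn fun q hq => ?_
  have : 0 < sgn τ * (sgn τ * q.1) := by
    rw [← mul_assoc, sgn_mul_self, one_mul]
    exact hq
  exact this

theorem isOpen_halfSpace (τ : ℤˣ) : IsOpen (halfSpace τ) :=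
  isOpen_lt continuous_const (by fun_prop)

theorem fderiv_timeFlip {e : Fin 3 → A} {σ τ : ℤˣ} {F : ℝ × E3 → A}
    (hF : IsMonogenicHardy e σ τ F) {p : ℝ × E3} (hp : 0 < p.1) (v : ℝ × E3) :
    fderiv ℝ (timeFlip τ F) p v = fderiv ℝ F (sgn τ * p.1, p.2) (sgn τ * v.1, v.2) := by
  have hq : (sgn τ * p.1, p.2) ∈ halfSpace τ := by
    have : 0 < sgn τ * (sgn τ * p.1) := by rwa [← mul_assoc, sgn_mul_self, one_mul]
    exact this
  have h1 : HasFDerivAt (fun q : ℝ × E3 => (sgn τ * q.1, q.2))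
      ((sgn τ • ContinuousLinearMap.fst ℝ ℝ E3).prod (ContinuousLinearMap.snd ℝ ℝ E3)) p :=
    (hasFDerivAt_fst.const_mul (sgn τ)).prodMk hasFDerivAt_snd
  have h2 : DifferentiableAt ℝ F (sgn τ * p.1, p.2) :=
    (hF.smooth.differentiableOn (by simp)).differentiableAt ((isOpen_halfSpace τ).mem_nhds hq)
  rw [show fderiv ℝ (timeFlip τ F) p = _ from (h2.hasFDerivAt.comp p h1).fderiv]
  simp

/-- Reversing time changes the sign of ∂₀ relative to the spatial part, so τ joins σ in the
coefficients. -/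
theorem monogenic_timeFlip {e : Fin 3 → A} {σ τ : ℤˣ} {F : ℝ × E3 → A}
    (hF : IsMonogenicHardy e σ τ F) {p : ℝ × E3} (hp : 0 < p.1) :
    fderiv ℝ (timeFlip τ F) p (1, 0) + ∑ k, ((sgn τ * sgn σ : ℝ) : ℂ) • e k *
      fderiv ℝ (timeFlip τ F) p (0, EuclideanSpace.single k (1 : ℝ)) = 0 := by
  have hq : (sgn τ * p.1, p.2) ∈ halfSpace τ := by
    have : 0 < sgn τ * (sgn τ * p.1) := by rwa [← mul_assoc, sgn_mul_self, one_mul]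
    exact this
  have h := hF.monogenic _ hq
  rw [diracOp] at h
  simp only [fderiv_timeFlip hF hp, mul_zero, mul_one, smul_mul_assoc, ← Finset.smul_sum]
  have h1 : ((sgn τ, 0) : ℝ × E3) = sgn τ • (1, 0) := by simp
  have h2 : ∀ a : A, sgn τ • a = (sgn τ : ℂ) • a := fun a => (Complex.coe_smul _ _).symm
  rw [h1, map_smul, h2, Complex.ofReal_mul, mul_smul, ← smul_add, h, smul_zero]

theorem memLp_timeFlip {e : Fin 3 → A} {σ τ : ℤˣ} {F : ℝ × E3 → A}
    (hF : IsMonogenicHardy e σ τ F) {t : ℝ} (ht : 0 < t) :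
    Continuous (fun x => timeFlip τ F (t, x)) ∧ MemLp (fun x => timeFlip τ F (t, x)) 2 := by
  have hc : Continuous (fun x => timeFlip τ F (t, x)) :=
    (contDiffOn_timeFlip hF).continuousOn.comp_continuous
      (by fun_prop : Continuous fun x : E3 => (t, x)) fun x => ht
  obtain ⟨C, hC⟩ := hF.bounded
  exact ⟨hc, hc.aestronglyMeasurable, (hC t ht).trans_lt ENNReal.coe_lt_top⟩

variable [FiniteDimensional ℂ A]

theorem ae_eq_of_forall_integral_smul_eq {u v : E3 → A} (hu : MemLp u 2) (hv : MemLp v 2)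
    (h : ∀ ψ : E3 → ℂ, MemLp ψ 2 → ∫ ξ, ψ ξ • u ξ = ∫ ξ, ψ ξ • v ξ) : u =ᵐ[volume] v := by
  refine ae_eq_of_integral_contDiff_smul_eq (hu.locallyIntegrable (by norm_num))
    (hv.locallyIntegrable (by norm_num)) fun χ hχ hχc => ?_
  have hm : MemLp χ 2 := hχ.continuous.memLp_of_hasCompactSupport hχc
  simpa using h (fun x => (χ x : ℂ)) hm.ofReal

/-- The evolution law of one spectral component, in weak form. For any scalar ψ, the extension of
ψ·`spectralProj e (-(ρ * τ))` with sign -σ, evaluated at time d + ρt, is right monogenic, so its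
slice pairing with F is constant; Parseval rewrites the pairing as the integral of ψ against the
displayed function. Taking ρ = 1 handles the component growing like e^{2πt|ξ|}, and ρ = -1 the
decaying one. The shift d keeps the time of the extension positive on the interval. -/
theorem spectral_slices_ae_eq {e : Fin 3 → A} (he : IsCliffordSystem e) {σ τ : ℤˣ}
    {F : ℝ × E3 → A} (hF : IsMonogenicHardy e σ τ F) {g : ℝ → E3 → A}
    (hg : ∀ t, 0 < t → IsFourierPair σ (g t) fun x => timeFlip τ F (t, x))
    (ρ : ℤˣ) {b d : ℝ} (hd : ∀ t ∈ Set.Ioo 0 b, 0 < d + sgn ρ * t) {s t : ℝ}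
    (hs : s ∈ Set.Ioo 0 b) (ht : t ∈ Set.Ioo 0 b) :
    (fun ξ => (Real.exp (-(2 * Real.pi * (d + sgn ρ * s) * ‖ξ‖)) : ℂ) •
      (spectralProj e (-(ρ * τ)) ξ * g s ξ)) =ᵐ[volume]
    (fun ξ => (Real.exp (-(2 * Real.pi * (d + sgn ρ * t) * ‖ξ‖)) : ℂ) •
      (spectralProj e (-(ρ * τ)) ξ * g t ξ)) := by
  have hmem : ∀ t ∈ Set.Ioo 0 b, MemLp (fun ξ =>
      (Real.exp (-(2 * Real.pi * (d + sgn ρ * t) * ‖ξ‖)) : ℂ) •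
      (spectralProj e (-(ρ * τ)) ξ * g t ξ)) 2 := fun t ht =>
    memLp_exp_smul (memLp_spectralProj_mul e _ (hg t ht.1).left) (hd t ht).le
  refine ae_eq_of_forall_integral_smul_eq (hmem s hs) (hmem t ht) fun ψ hψ => ?_
  set Ψ : E3 → A := fun ξ => ψ ξ • spectralProj e (-(ρ * τ)) ξ with hΨdef
  have hΨ : MemLp Ψ 2 := by
    refine hψ.of_le_mul (c := ‖(1 : A)‖ + ∑ j, ‖e j‖) (hψ.1.smul
      (stronglyMeasurable_spectralProj e _).aestronglyMeasurable) (.of_forall fun ξ => ?_)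
    rw [norm_smul, mul_comm]
    gcongr
    exact norm_spectralProj_le e _ ξ
  have hΨe := expIntegrable_of_memLp hΨ
  set Φ : ℝ × E3 → A := fun q => hardyExt (-σ) Ψ (d + sgn ρ * q.1, q.2) with hΦdef
  obtain ⟨C₁, hC₁⟩ := hF.bounded
  obtain ⟨C₂, hC₂⟩ := exists_eLpNorm_le_of_isFourierPair A
  have hpair : ∀ t ∈ Set.Ioo 0 b, IsFourierPair (-σ)
      (fun ξ => (Real.exp (-(2 * Real.pi * (d + sgn ρ * t) * ‖ξ‖)) : ℂ) • Ψ ξ)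
      (fun x => Φ (t, x)) := fun t ht => isFourierPair_hardyExt hΨ (-σ) (hd t ht)
  have hval : ∀ t ∈ Set.Ioo 0 b, ∫ x, Φ (t, x) * timeFlip τ F (t, x) =
      ∫ ξ, ψ ξ • (Real.exp (-(2 * Real.pi * (d + sgn ρ * t) * ‖ξ‖)) : ℂ) •
        (spectralProj e (-(ρ * τ)) ξ * g t ξ) := fun t ht => by
    rw [(hpair t ht).integral_mul (hg t ht.1).symm]
    refine integral_congr_ae (.of_forall fun ξ => ?_)
    simp only [hΨdef, smul_mul_assoc]
    rw [smul_comm]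
  rw [← hval s hs, ← hval t ht]
  have hsub : strip 0 b ⊆ {p | 0 < p.1} := fun p hp => hp.1
  refine integral_slice_mul_eq (c := fun k => ((sgn τ * sgn σ : ℝ) : ℂ) • e k) (a := 0) (b := b)
    (C := max C₁ (C₂ * (eLpNorm Ψ 2 volume).toNNReal)) ?_ ?_ (fun p hp => ?_)
    (fun p hp => monogenic_timeFlip hF hp.1) (fun t ht => (hpair t ht).right) (fun t ht => ?_)
    (fun t ht => (memLp_timeFlip hF ht.1).2) (fun t ht => ?_) hs ht
  · exact ((contDiffOn_hardyExt_comp hΨe (-σ) d (sgn ρ)).mono fun p hp => hd p.1 hp).of_le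
      (by exact_mod_cast le_top)
  · exact ((contDiffOn_timeFlip hF).mono hsub).of_le (by exact_mod_cast le_top)
  · have h0 := hd p.1 hp
    have hfd := hasFDerivAt_hardyExt_comp hΨe (-σ) d (sgn ρ) h0
    rw [show fderiv ℝ Φ p = _ from hfd.fderiv]
    have := hardyExt_combination hΨe (-σ) (p := (d + sgn ρ * p.1, p.2)) h0 (sgn ρ)
      fun k => (ContinuousLinearMap.mul ℂ A).flip (((sgn τ * sgn σ : ℝ) : ℂ) • e k)
    simp only [ContinuousLinearMap.flip_apply, ContinuousLinearMap.mul_apply'] at this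
    simp only [ContinuousLinearMap.comp_apply, ContinuousLinearMap.prod_apply, smul_apply,
      ContinuousLinearMap.coe_fst', ContinuousLinearMap.coe_snd', smul_eq_mul, mul_one, mul_zero]
    rw [this]
    -- The projection in Ψ gives iΨ(ξ)ξ = -ρτ|ξ|Ψ(ξ) at every ξ, so the spatial symbol is 2πρ|ξ| and
    -- cancels the time symbol -2πρ|ξ|.
    refine hardyExt_eq_zero _ _ (.of_forall fun ξ => ?_)
    have h1 : ∑ k, (ξ k : ℂ) • (Ψ ξ * ((sgn τ * sgn σ : ℝ) : ℂ) • e k) =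
        ((sgn τ * sgn σ : ℝ) : ℂ) • (Ψ ξ * vec e ξ) := by
      rw [← sum_smul_mul_eq_vec', Finset.smul_sum]
      exact Finset.sum_congr rfl fun k _ => by rw [mul_smul_comm, smul_comm]
    have h2 : Complex.I • (Ψ ξ * vec e ξ) = ((sgn (-(ρ * τ)) * ‖ξ‖ : ℝ) : ℂ) • Ψ ξ := by
      rw [hΨdef]
      simp only [smul_mul_assoc]
      rw [smul_comm, spectralProj_mul_vec he, smul_comm]
    have h3 : (sgn σ : ℂ) * sgn σ = 1 := by exact_mod_cast sgn_mul_self σ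
    have h4 : (sgn τ : ℂ) * sgn τ = 1 := by exact_mod_cast sgn_mul_self τ
    rw [h1, smul_smul _ _ (Ψ ξ * vec e ξ), show 2 * (Real.pi : ℂ) * Complex.I * (sgn (-σ) : ℝ) *
      ((sgn τ * sgn σ : ℝ) : ℂ) = -(2 * Real.pi * sgn τ) * Complex.I by
        rw [sgn_neg]; push_cast; linear_combination -(2 * Real.pi * Complex.I * sgn τ) * h3,
      mul_smul, h2, smul_smul _ _ (Ψ ξ), ← add_smul, sgn_neg, sgn_mul]
    push_cast
    rw [show -(2 * (Real.pi : ℂ) * ‖ξ‖ * sgn ρ) +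
      -(2 * Real.pi * sgn τ) * (-(sgn ρ * sgn τ) * ‖ξ‖) = 0 by
        linear_combination (2 * Real.pi * sgn ρ * ‖ξ‖) * h4, zero_smul]
  · refine (hC₂ _ _ _ (hpair t ht)).trans ?_
    refine (mul_le_mul_right (eLpNorm_exp_smul_le (hd t ht).le) _).trans ?_
    rw [ENNReal.coe_max, ENNReal.coe_mul, ENNReal.coe_toNNReal hΨ.2.ne]
    exact le_max_right _ _
  · exact (hC₁ t ht.1).trans (by rw [ENNReal.coe_max]; exact le_max_left _ _)

end Representation

/-! ### From the evolution law to the boundary function -/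

section Representation

variable {A : Type*} [NormedRing A] [NormedAlgebra ℂ A] [FiniteDimensional ℂ A]

/-- Every monogenic Hardy function is the extension of a spectral `L²` function. -/
theorem exists_eq_hardyExt {e : Fin 3 → A} (he : IsCliffordSystem e) {σ τ : ℤˣ}
    {F : ℝ × E3 → A} (hF : IsMonogenicHardy e σ τ F) :
    ∃ g : E3 → A, MemLp g 2 ∧ IsSpectral e τ g ∧
      ∀ p ∈ halfSpace τ, F p = hardyExt σ g (sgn τ * p.1, p.2) := by
  have hpi := Real.pi_pos
  obtain ⟨C₁, hC₁⟩ := hF.bounded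
  obtain ⟨C₂, hC₂⟩ := exists_eLpNorm_le_of_isFourierPair A
  have hex : ∀ t : ℝ, ∃ g : E3 → A, 0 < t →
      IsFourierPair σ g fun x => timeFlip τ F (t, x) := by
    intro t
    by_cases ht : 0 < t
    · obtain ⟨g, hg⟩ := exists_isFourierPair (-σ) (memLp_timeFlip hF ht).2
      exact ⟨g, fun _ => by simpa using hg.symm⟩
    · exact ⟨0, fun h => absurd h ht⟩
  choose g hg using hex
  have hbound : ∀ t, 0 < t → eLpNorm (g t) 2 volume ≤ C₂ * C₁ := fun t ht =>
    (hC₂ _ _ _ (hg t ht).symm).trans (by gcongr; exact hC₁ t ht)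
  -- The growing component vanishes: it equals e^{-2πn|ξ|} times the component at time t + n, so
  -- n|ξ| times it is dominated by a function of norm bounded uniformly in n. The weight |ξ| is
  -- nonzero almost everywhere and does no harm.
  have hzero : ∀ t, 0 < t → ∀ᵐ ξ, spectralProj e (-τ) ξ * g t ξ = 0 := by
    intro t ht
    set C : ENNReal := ENNReal.ofReal (‖(1 : A)‖ + ∑ j, ‖e j‖) * (C₂ * C₁) with hC
    have hCtop : C ≠ ⊤ := ENNReal.mul_ne_top ENNReal.ofReal_ne_top
      (ENNReal.mul_ne_top ENNReal.coe_ne_top ENNReal.coe_ne_top)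
    set X := eLpNorm (fun ξ => ‖ξ‖ * ‖spectralProj e (-τ) ξ * g t ξ‖) 2 volume with hX
    have hnX : ∀ n : ℕ, n * X ≤ C := by
      intro n
      have h1 : 0 < t + n := by positivity
      have h2 := spectral_slices_ae_eq he hF hg 1 (b := t + n + 1) (d := 0)
        (fun s hs => by simpa using hs.1) (s := t) (t := t + n) ⟨ht, by linarith [(Nat.cast_nonneg n : (0 : ℝ) ≤ n)]⟩
        ⟨h1, by linarith⟩
      rw [one_mul] at h2
      refine le_trans ?_ ((eLpNorm_spectralProj_mul_le e (-τ) (g (t + n))).trans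
        (mul_le_mul_right (hbound _ h1) _))
      have h3 : (n : ENNReal) * X = eLpNorm
          ((n : ℝ) • fun ξ => ‖ξ‖ * ‖spectralProj e (-τ) ξ * g t ξ‖) 2 volume := by
        rw [eLpNorm_const_smul]
        simp [hX]
      rw [h3]
      refine eLpNorm_mono_ae ?_
      filter_upwards [h2] with ξ hξ
      have h4 := congrArg norm hξ
      simp only [norm_smul, Complex.norm_real, Real.norm_of_nonneg (Real.exp_pos _).le, sgn_one,
        zero_add, one_mul] at h4
      have h5 : ‖spectralProj e (-τ) ξ * g t ξ‖ = Real.exp (-(2 * Real.pi * n * ‖ξ‖)) *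
          ‖spectralProj e (-τ) ξ * g (t + n) ξ‖ := by
        have h6 : Real.exp (-(2 * Real.pi * (t + n) * ‖ξ‖)) =
            Real.exp (-(2 * Real.pi * t * ‖ξ‖)) * Real.exp (-(2 * Real.pi * n * ‖ξ‖)) := by
          rw [← Real.exp_add]
          ring_nf
        rw [h6, mul_assoc (Real.exp _) (Real.exp _)] at h4
        exact mul_left_cancel₀ (Real.exp_pos _).ne' h4
      rw [Pi.smul_apply, norm_smul, norm_mul, norm_norm, norm_norm, Real.norm_natCast,
        h5, ← mul_assoc, ← mul_assoc]
      refine mul_le_of_le_one_left (norm_nonneg _) ?_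
      rw [Real.exp_neg, ← div_eq_mul_inv, div_le_one (Real.exp_pos _)]
      have h7 := Real.add_one_le_exp (2 * Real.pi * n * ‖ξ‖)
      have h8 : 0 ≤ (n : ℝ) * ‖ξ‖ := by positivity
      nlinarith [Real.pi_gt_three]
    have hX0 : X = 0 := by
      by_contra hne
      obtain ⟨n, hn⟩ := ENNReal.exists_nat_mul_gt hne hCtop
      exact absurd (hnX n) (not_le.2 hn)
    have hm : AEStronglyMeasurable (fun ξ => ‖ξ‖ * ‖spectralProj e (-τ) ξ * g t ξ‖) volume :=
      continuous_norm.aestronglyMeasurable.mul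
        (memLp_spectralProj_mul e _ (hg t ht).left).1.norm
    rw [hX, eLpNorm_eq_zero_iff hm (by norm_num)] at hX0
    filter_upwards [hX0, Measure.ae_ne volume (0 : E3)] with ξ h1 h2
    simpa [h2] using h1
  have hproj : ∀ t, 0 < t → ∀ᵐ ξ, spectralProj e τ ξ * g t ξ = g t ξ := by
    intro t ht
    filter_upwards [hzero t ht] with ξ hξ
    rw [← add_zero (spectralProj e τ ξ * g t ξ), ← hξ, ← add_mul, spectralProj_add_neg, one_mul]
  -- The candidate for the transform at time 0, obtained by undoing the decay from time 1.
  set g₀ : E3 → A := fun ξ => (Real.exp (2 * Real.pi * ‖ξ‖) : ℂ) • g 1 ξ with hg₀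
  have hslice : ∀ t, 0 < t → (fun ξ => (Real.exp (-(2 * Real.pi * t * ‖ξ‖)) : ℂ) • g₀ ξ)
      =ᵐ[volume] g t := by
    intro t ht
    -- The strip of height t + 2 contains both times 1 and t. At time t the remaining exponent is d
    -- - t = 2, which explains the factor e^{4π|ξ|} used to cancel it.
    have h2 := spectral_slices_ae_eq he hF hg (-1) (b := t + 2) (d := t + 2)
        (fun s hs => by simpa using hs.2) (s := 1) (t := t) ⟨one_pos, by linarith⟩
        ⟨ht, by linarith⟩
    rw [neg_one_mul, neg_neg] at h2
    filter_upwards [h2, hproj t ht, hproj 1 one_pos] with ξ h3 h4 h5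
    rw [h4, h5] at h3
    simp only [hg₀, smul_smul, ← Complex.ofReal_mul, ← Real.exp_add]
    have h6 := congrArg (fun a => ((Real.exp (2 * Real.pi * 2 * ‖ξ‖) : ℝ) : ℂ) • a) h3
    simp only [smul_smul, ← Complex.ofReal_mul, ← Real.exp_add, sgn_neg, sgn_one] at h6
    rw [show 2 * Real.pi * 2 * ‖ξ‖ + -(2 * Real.pi * (t + 2 + -1 * t) * ‖ξ‖) = 0 by ring,
      Real.exp_zero, Complex.ofReal_one, one_smul] at h6
    rw [← h6]
    congr 3
    ring
  have hmeas₀ : AEStronglyMeasurable g₀ volume :=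
    (by fun_prop : Continuous fun ξ : E3 =>
      (Real.exp (2 * Real.pi * ‖ξ‖) : ℂ)).aestronglyMeasurable.smul (hg 1 one_pos).left.1
  -- Fatou along the times 1/(n + 1): the slices converge pointwise to g₀ and are uniformly bounded
  -- in L².
  have hmem₀ : MemLp g₀ 2 := by
    refine ⟨hmeas₀, LE.le.trans_lt (b := (C₂ * C₁ : ENNReal)) ?_
      (ENNReal.mul_lt_top ENNReal.coe_lt_top ENNReal.coe_lt_top)⟩
    have hpos : ∀ n : ℕ, (0 : ℝ) < ((n : ℝ) + 1)⁻¹ := fun n => by positivity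
    have hinv : Tendsto (fun n : ℕ => ((n : ℝ) + 1)⁻¹) atTop (𝓝 0) :=
      tendsto_inv_atTop_zero.comp (tendsto_natCast_atTop_atTop.atTop_add tendsto_const_nhds)
    refine (Lp.eLpNorm_lim_le_liminf_eLpNorm
      (f := fun (n : ℕ) ξ => (Real.exp (-(2 * Real.pi * ((n : ℝ) + 1)⁻¹ * ‖ξ‖)) : ℂ) • g₀ ξ)
      (fun n => ?_) g₀ (.of_forall fun ξ => ?_)).trans ?_
    · exact (by fun_prop : Continuous fun ξ : E3 =>
        (Real.exp (-(2 * Real.pi * ((n : ℝ) + 1)⁻¹ * ‖ξ‖)) : ℂ)).aestronglyMeasurable.smul hmeas₀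
    · have hc : Continuous fun r : ℝ => (Real.exp (-(2 * Real.pi * r * ‖ξ‖)) : ℂ) • g₀ ξ := by
        fun_prop
      have := (hc.tendsto 0).comp hinv
      simpa [Function.comp_def] using this
    · refine liminf_le_of_le (by isBoundedDefault) fun b hb => ?_
      obtain ⟨n, hn⟩ := hb.exists
      refine hn.trans ?_
      rw [eLpNorm_congr_ae (hslice _ (hpos n))]
      exact hbound _ (hpos n)
  refine ⟨g₀, hmem₀, ?_, fun p hp => ?_⟩
  · filter_upwards [hzero 1 one_pos] with ξ hξ
    refine smul_vec_mul_of_spectralProj_eq_zero ?_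
    rw [hg₀, mul_smul_comm, hξ, smul_zero]
  · have ht : 0 < sgn τ * p.1 := hp
    have h1 := isFourierPair_hardyExt hmem₀ σ ht
    have h2 := (hg _ ht).unique h1 (hslice _ ht).symm
    have hc : Continuous fun x => hardyExt σ g₀ (sgn τ * p.1, x) := by
      have : CompleteSpace A := FiniteDimensional.complete ℂ A
      exact (contDiffOn_hardyExt (expIntegrable_of_memLp hmem₀) σ).continuousOn.comp_continuous
        (by fun_prop : Continuous fun x : E3 => (sgn τ * p.1, x)) fun x => ht
    -- The two slices have the same transform, hence agree almost everywhere; being continuous, they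
    -- agree at every point.
    have h3 := (Continuous.ae_eq_iff_eq volume (memLp_timeFlip hF ht).1 hc).1 h2
    have h4 := congrFun h3 p.2
    simpa only [timeFlip, ← mul_assoc, sgn_mul_self, one_mul] using h4

/-- Every monogenic Hardy function has a boundary value, which determines it and is the Fourier
transform of a spectral function. -/
theorem IsMonogenicHardy.exists_boundary {e : Fin 3 → A} (he : IsCliffordSystem e) {σ τ : ℤˣ}
    {F : ℝ × E3 → A} (hF : IsMonogenicHardy e σ τ F) :
    ∃ (g : E3 → A) (f : Lp A 2 (volume : Measure E3)), IsSpectral e τ g ∧ IsFourierPair σ g f ∧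
      HasBoundaryValue τ F f ∧ ∀ p ∈ halfSpace τ, F p = hardyExt σ g (sgn τ * p.1, p.2) := by
  obtain ⟨g, hg, hs, hFg⟩ := exists_eq_hardyExt he hF
  obtain ⟨f, hf⟩ := exists_isFourierPair σ hg
  have hf' := hf.congr .rfl hf.right.coeFn_toLp.symm
  refine ⟨g, hf.right.toLp f, hs, hf', ?_, hFg⟩
  filter_upwards [ae_tendsto_hardyExt (τ := τ) hf'] with x hx a ha
  refine (hx a ha).congr' ?_
  filter_upwards [self_mem_nhdsWithin] with p hp using (hFg p hp.1).symm

/-- The vertical ray above x lies in the cone, so limits through cones are unique. -/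
theorem neBot_nhdsWithin_cone (τ : ℤˣ) {a : ℝ} (ha : 0 < a) (x : E3) :
    (𝓝[cone τ a x] (0, x)).NeBot := by
  have h1 : Tendsto (fun t : ℝ => (sgn τ * t, x)) (𝓝[>] 0) (𝓝[cone τ a x] (0, x)) := by
    refine tendsto_nhdsWithin_iff.2 ⟨?_, ?_⟩
    · have : Continuous fun t : ℝ => (sgn τ * t, x) := by fun_prop
      simpa using (this.tendsto 0).mono_left nhdsWithin_le_nhds
    · filter_upwards [self_mem_nhdsWithin] with t ht
      have ht : 0 < t := ht
      refine ⟨?_, ?_⟩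
      · show 0 < sgn τ * (sgn τ * t)
        rwa [← mul_assoc, sgn_mul_self, one_mul]
      · have h2 : 0 < |t| := abs_pos.2 ht.ne'
        simpa [abs_mul] using mul_pos ha h2
  exact h1.neBot

omit [NormedAlgebra ℂ A] [FiniteDimensional ℂ A] in
theorem HasBoundaryValue.unique {τ : ℤˣ} {F : ℝ × E3 → A} {f f' : Lp A 2 (volume : Measure E3)}
    (h : HasBoundaryValue τ F f) (h' : HasBoundaryValue τ F f') : f = f' := by
  refine Lp.ext ?_
  filter_upwards [h, h'] with x h1 h2
  have := neBot_nhdsWithin_cone τ one_pos x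
  exact tendsto_nhds_unique (h1 1 one_pos) (h2 1 one_pos)

/-- Inverse transformation of the common boundary function recovers the density g almost everywhere,
and the integral formula recovers the function. -/
theorem IsMonogenicHardy.eqOn_of_boundary {e : Fin 3 → A} (he : IsCliffordSystem e) {σ τ : ℤˣ}
    {F G : ℝ × E3 → A} (hF : IsMonogenicHardy e σ τ F) (hG : IsMonogenicHardy e σ τ G)
    {f : Lp A 2 (volume : Measure E3)} (hf : HasBoundaryValue τ F f)
    (hf' : HasBoundaryValue τ G f) : Set.EqOn F G (halfSpace τ) := by
  obtain ⟨g₁, f₁, -, hp₁, hb₁, hF₁⟩ := hF.exists_boundary he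
  obtain ⟨g₂, f₂, -, hp₂, hb₂, hG₂⟩ := hG.exists_boundary he
  obtain rfl := hf.unique hb₁
  obtain rfl := hf'.unique hb₂
  have hg := hp₁.symm.unique hp₂.symm .rfl
  intro p hp
  rw [hF₁ p hp, hG₂ p hp, hardyExt_eq, hardyExt_eq]
  refine integral_congr_ae ?_
  filter_upwards [hg] with ξ hξ
  rw [hξ]

/-- The boundary values of the monogenic Hardy space are the Fourier transforms of the spectral
functions. -/
theorem mem_hardyBoundarySpace_iff {e : Fin 3 → A} (he : IsCliffordSystem e) {σ τ : ℤˣ}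
    {f : Lp A 2 (volume : Measure E3)} :
    f ∈ hardyBoundarySpace e σ τ ↔
      ∃ g : E3 → A, IsSpectral e τ g ∧ IsFourierPair σ g f := by
  constructor
  · rintro ⟨F, hF, hf⟩
    obtain ⟨g, f₁, hs, hp, hb, -⟩ := hF.exists_boundary he
    obtain rfl := hf.unique hb
    exact ⟨g, hs, hp⟩
  · rintro ⟨g, hs, hp⟩
    exact ⟨_, isMonogenicHardy_hardyExt hp.left hs, ae_tendsto_hardyExt hp⟩

end Representation

/-! ### Spinor subspaces -/

section Spinor

variable {A : Type*} [NormedRing A] [NormedAlgebra ℂ A]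

theorem isFourierPair_iff_compLpL {σ : ℤˣ} {g f : Lp A 2 (volume : Measure E3)} :
    IsFourierPair σ g f ↔
      ∀ l : A →L[ℂ] ℂ, l.compLpL 2 volume f = scalarFourier σ (l.compLpL 2 volume g) := by
  have hl : ∀ (l : A →L[ℂ] ℂ) (h : MemLp (fun x => l (g x)) 2),
      h.toLp _ = l.compLpL 2 volume g := fun l h =>
    Lp.ext (h.coeFn_toLp.trans (l.coeFn_compLpL g).symm)
  constructor
  · intro h l
    have h1 := h.eq l (MemLp.clm_comp h.left l)
    rw [hl] at h1
    exact Lp.ext ((l.coeFn_compLpL f).trans h1)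
  · intro h
    refine ⟨Lp.memLp g, Lp.memLp f, fun l h1 => ?_⟩
    rw [hl, ← h l]
    exact (l.coeFn_compLpL f).symm

theorem mem_fourierImage_iff {σ : ℤˣ} {S : Submodule ℂ (Lp A 2 (volume : Measure E3))}
    {f : Lp A 2 (volume : Measure E3)} :
    f ∈ fourierImage σ S ↔ ∃ g ∈ S, IsFourierPair σ g f := by
  simp only [isFourierPair_iff_compLpL]
  rfl

theorem IsFourierPair.sum_Lp {ι : Type*} (s : Finset ι) {σ : ℤˣ} {g : ι → E3 → A}
    {f : ι → Lp A 2 (volume : Measure E3)} (h : ∀ i ∈ s, IsFourierPair σ (g i) (f i)) :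
    IsFourierPair σ (fun x => ∑ i ∈ s, g i x) (∑ i ∈ s, f i : Lp A 2 (volume : Measure E3)) := by
  classical
  induction s using Finset.induction_on with
  | empty =>
    simp only [Finset.sum_empty]
    exact (IsFourierPair.zero σ).congr .rfl (Lp.coeFn_zero A 2 volume).symm
  | insert i s hi ih =>
    simp only [Finset.sum_insert hi]
    exact ((h i (by simp)).add (ih fun j hj => h j (by simp [hj]))).congr .rfl
      (Lp.coeFn_add _ _).symm

theorem IsSpectral.add {e : Fin 3 → A} {τ : ℤˣ} {g g' : E3 → A} (h : IsSpectral e τ g)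
    (h' : IsSpectral e τ g') : IsSpectral e τ fun ξ => g ξ + g' ξ := by
  filter_upwards [h, h'] with ξ h1 h2
  rw [mul_add, smul_add, smul_add, h1, h2]

theorem IsSpectral.zero (e : Fin 3 → A) (τ : ℤˣ) : IsSpectral e τ fun _ => (0 : A) :=
  .of_forall fun ξ => by simp

theorem norm_normalize {y : E3} (hy : y ≠ 0) : ‖‖y‖⁻¹ • y‖ = 1 := by
  rw [norm_smul, norm_inv, norm_norm, inv_mul_cancel₀ (norm_ne_zero_iff.2 hy)]

theorem norm_smul_vec_normalize (e : Fin 3 → A) {y : E3} (hy : y ≠ 0) :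
    vec e y = (‖y‖ : ℂ) • vec e (‖y‖⁻¹ • y) := by
  rw [← vec_smul, smul_smul, mul_inv_cancel₀ (norm_ne_zero_iff.2 hy), one_smul]

/-- The functions `β(y) γ(y/|y|) w` with `i e₃ w = τ w` are spectral. -/
theorem isSpectral_spinor {e : Fin 3 → A} {τ : ℤˣ} {γ : E3 → A} (hγ : IsSpinSection e γ) {w : A}
    (hw : Complex.I • (e 2 * w) = (sgn τ : ℂ) • w) (β : E3 → ℂ) {g : E3 → A}
    (hg : ∀ᵐ y : E3, g y = β y • (γ (‖y‖⁻¹ • y) * w)) : IsSpectral e τ g := by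
  filter_upwards [hg, Measure.ae_ne volume (0 : E3)] with y h1 h2
  rw [h1, norm_smul_vec_normalize e h2, mul_smul_comm, smul_mul_assoc, ← mul_assoc,
    ← hγ.rotates _ (norm_normalize h2), mul_assoc, smul_comm, smul_comm Complex.I (‖y‖ : ℂ),
    ← mul_smul_comm, hw, mul_smul_comm]
  simp only [smul_smul]
  push_cast
  ring_nf

/-- The coefficients are chosen linearly, and on all of A, so that they inherit measurability and
square integrability from the function expanded; linear independence of w is not needed. -/
theorem exists_coefficients {ι : Type*} [Fintype ι] (w : ι → A) :
    ∃ c : ι → A →ₗ[ℂ] ℂ, ∀ a ∈ Submodule.span ℂ (Set.range w), a = ∑ j, c j a • w j := by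
  set L := Fintype.linearCombination ℂ w with hL
  obtain ⟨R, hR⟩ := L.rangeRestrict.exists_rightInverse_of_surjective L.range_rangeRestrict
  obtain ⟨R', hR'⟩ := LinearMap.exists_extend R
  refine ⟨fun j => (LinearMap.proj j).comp R', fun a ha => ?_⟩
  rw [← Fintype.range_linearCombination ℂ w] at ha
  have h1 := congrArg Subtype.val (LinearMap.congr_fun hR ⟨a, ha⟩)
  have h2 := LinearMap.congr_fun hR' ⟨a, ha⟩
  simp only [LinearMap.comp_apply, Submodule.subtype_apply] at h2
  simp only [LinearMap.comp_apply, LinearMap.id_apply] at h1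
  simp only [LinearMap.comp_apply, LinearMap.proj_apply, h2]
  exact h1.symm

variable [FiniteDimensional ℂ A]

/-- The sum of the transformed spinor subspaces is the space of boundary values, if the spinors
span an eigenspace of `i e₃`. -/
theorem iSup_spinorSpace_eq_hardyBoundarySpace {e : Fin 3 → A} (he : IsCliffordSystem e)
    {γ : E3 → A} (hγ : IsSpinSection e γ) (σ τ : ℤˣ) {ι : Type*} [Fintype ι] {w : ι → A}
    (hw : ∀ j, Complex.I • (e 2 * w j) = (sgn τ : ℂ) • w j)
    (hspan : ∀ a : A, Complex.I • (e 2 * a) = (sgn τ : ℂ) • a →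
      a ∈ Submodule.span ℂ (Set.range w))
    (rev : A →ₗ[ℂ] A) (hrev : ∀ u v : E3, rev (vec e u * vec e v) = vec e v * vec e u) :
    ((⨆ j, fourierImage σ (spinorSpace γ (w j)) :
      Submodule ℂ (Lp A 2 (volume : Measure E3))) : Set (Lp A 2 (volume : Measure E3))) =
      hardyBoundarySpace e σ τ := by
  ext f
  rw [SetLike.mem_coe, mem_hardyBoundarySpace_iff he]
  constructor
  · intro hf
    refine Submodule.iSup_induction _ (motive := fun f : Lp A 2 (volume : Measure E3) =>
      ∃ g : E3 → A, IsSpectral e τ g ∧ IsFourierPair σ g f) hf (fun j f hj => ?_) ?_ ?_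
    · obtain ⟨g, ⟨β, hβ⟩, hp⟩ := mem_fourierImage_iff.1 hj
      exact ⟨g, isSpectral_spinor hγ (hw j) β hβ, hp⟩
    · exact ⟨_, IsSpectral.zero e τ, (IsFourierPair.zero σ).congr .rfl
        (Lp.coeFn_zero A 2 volume).symm⟩
    · rintro f f' ⟨g, hs, hp⟩ ⟨g', hs', hp'⟩
      exact ⟨_, hs.add hs', (hp.add hp').congr .rfl (Lp.coeFn_add f f').symm⟩
  · rintro ⟨g, hs, hp⟩
    obtain ⟨c, hc⟩ := exists_coefficients w
    -- Unit vectors square to -1, so reversing uv to vu inverts it. On Spin(3) inversion thus agrees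
    -- with the linear map `rev`, which makes γ⁻¹ measurable, and both γ and γ⁻¹ are bounded.
    have hinv : ∀ s ∈ spin3 e, s * rev s = 1 ∧ rev s * s = 1 ∧
        ‖s‖ ≤ (∑ j, ‖e j‖) * (∑ j, ‖e j‖) ∧ ‖rev s‖ ≤ (∑ j, ‖e j‖) * (∑ j, ‖e j‖) := by
      rintro s ⟨u, v, hu, hv, rfl⟩
      have h1 : ∀ u : E3, ‖u‖ = 1 → vec e u * vec e u = -1 := fun u hu => by
        simp [he.vec_mul_self, hu]
      have h2 : ∀ u : E3, ‖u‖ = 1 → ‖vec e u‖ ≤ ∑ j, ‖e j‖ := fun u hu => by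
        simpa [hu] using norm_vec_le e u
      have h3 : ∀ u v : E3, ‖u‖ = 1 → ‖v‖ = 1 →
          (vec e u * vec e v) * (vec e v * vec e u) = 1 := fun u v hu hv => by
        rw [mul_assoc, ← mul_assoc (vec e v), h1 v hv, neg_one_mul, mul_neg, h1 u hu, neg_neg]
      have h4 : ∀ u v : E3, ‖u‖ = 1 → ‖v‖ = 1 →
          ‖vec e u * vec e v‖ ≤ (∑ j, ‖e j‖) * (∑ j, ‖e j‖) := fun u v hu hv =>
        (norm_mul_le _ _).trans (mul_le_mul (h2 u hu) (h2 v hv) (norm_nonneg _)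
          (Finset.sum_nonneg fun _ _ => norm_nonneg _))
      rw [hrev]
      exact ⟨h3 u v hu hv, h3 v u hv hu, h4 u v hu hv, h4 v u hv hu⟩
    set K := (∑ j, ‖e j‖) * (∑ j, ‖e j‖) with hK
    have hnorm : Measurable fun y : E3 => ‖y‖⁻¹ • y := measurable_norm.inv.smul measurable_id
    have hγm : AEStronglyMeasurable (fun y : E3 => γ (‖y‖⁻¹ • y)) volume :=
      (hγ.measurable.comp_measurable hnorm).aestronglyMeasurable
    have hrγm : AEStronglyMeasurable (fun y : E3 => rev (γ (‖y‖⁻¹ • y))) volume :=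
      (LinearMap.continuous_of_finiteDimensional rev).comp_aestronglyMeasurable hγm
    have hspin : ∀ y : E3, y ≠ 0 → γ (‖y‖⁻¹ • y) ∈ spin3 e := fun y hy =>
      hγ.mem_spin _ (norm_normalize hy)
    -- v = γ⁻¹g, which takes values in the fixed eigenspace of i e₃.
    set v : E3 → A := fun y => rev (γ (‖y‖⁻¹ • y)) * g y with hv
    have hvm : MemLp v 2 := by
      refine hp.left.of_le_mul (c := K) (hrγm.mul hp.left.1) ?_
      filter_upwards [Measure.ae_ne volume (0 : E3)] with y hy
      exact (norm_mul_le _ _).trans (by gcongr; exact (hinv _ (hspin y hy)).2.2.2)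
    have hveig : ∀ᵐ y, v y ∈ Submodule.span ℂ (Set.range w) := by
      filter_upwards [hs, Measure.ae_ne volume (0 : E3)] with y h1 h2
      refine hspan _ ?_
      obtain ⟨i1, i2, -, -⟩ := hinv _ (hspin y h2)
      set s := γ (‖y‖⁻¹ • y) with hsdef
      -- The rotation property γe₃ = ωγ with γ moved to the other side.
      have h3 : e 2 * rev s = rev s * vec e (‖y‖⁻¹ • y) := by
        have h4 : s * e 2 = vec e (‖y‖⁻¹ • y) * s := hγ.rotates _ (norm_normalize h2)
        calc e 2 * rev s = rev s * (s * e 2) * rev s := by rw [← mul_assoc, i2, one_mul]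
          _ = rev s * vec e (‖y‖⁻¹ • y) * (s * rev s) := by rw [h4]; simp only [mul_assoc]
          _ = _ := by rw [i1, mul_one]
      have h5 : (‖y‖ : ℂ) ≠ 0 := by exact_mod_cast norm_ne_zero_iff.2 h2
      have h6 : Complex.I • (vec e (‖y‖⁻¹ • y) * g y) = (sgn τ : ℂ) • g y := by
        rw [norm_smul_vec_normalize e h2, smul_mul_assoc, smul_comm, mul_comm (sgn τ),
          Complex.ofReal_mul, mul_smul] at h1
        exact smul_right_injective A h5 h1
      rw [hv]
      simp only
      rw [← mul_assoc, h3, mul_assoc, ← mul_smul_comm, h6, mul_smul_comm]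
    set β : ι → E3 → ℂ := fun j y => c j (v y) with hβ
    have hβm : ∀ j, MemLp (β j) 2 := fun j =>
      MemLp.clm_comp hvm (LinearMap.toContinuousLinearMap (c j))
    set G : ι → E3 → A := fun j y => β j y • (γ (‖y‖⁻¹ • y) * w j) with hG
    have hGm : ∀ j, MemLp (G j) 2 := by
      intro j
      refine (hβm j).of_le_mul (c := K * ‖w j‖) ((hβm j).1.smul (hγm.mul_const _)) ?_
      filter_upwards [Measure.ae_ne volume (0 : E3)] with y hy
      rw [norm_smul, mul_comm]
      refine mul_le_mul_of_nonneg_right ((norm_mul_le _ _).trans ?_) (norm_nonneg _)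
      gcongr
      exact (hinv _ (hspin y hy)).2.2.1
    have hsum : (fun y => ∑ j, G j y) =ᵐ[volume] g := by
      filter_upwards [hveig, Measure.ae_ne volume (0 : E3)] with y h1 h2
      have h3 := (hc _ h1).symm
      simp only [hG, ← mul_smul_comm, ← Finset.mul_sum]
      simp only [hβ]
      rw [h3, hv]
      simp only
      rw [← mul_assoc, (hinv _ (hspin y h2)).1, one_mul]
    choose f' hf' using fun j => exists_isFourierPair σ (hGm j)
    have hf'' : ∀ j, IsFourierPair σ (G j) ((hf' j).right.toLp (f' j)) := fun j =>
      (hf' j).congr .rfl (hf' j).right.coeFn_toLp.symm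
    have hfsum : f = ∑ j, (hf' j).right.toLp (f' j) :=
      Lp.ext (hp.unique (IsFourierPair.sum_Lp Finset.univ fun j _ => hf'' j) hsum.symm)
    rw [hfsum]
    refine Submodule.sum_mem _ fun j _ => Submodule.mem_iSup_of_mem j ?_
    refine mem_fourierImage_iff.2 ⟨(hGm j).toLp (G j), ⟨(hβm j).toLp (β j), ?_⟩,
      (hf'' j).congr (hGm j).coeFn_toLp.symm .rfl⟩
    filter_upwards [(hGm j).coeFn_toLp, (hβm j).coeFn_toLp] with y h1 h2
    rw [h1, h2]

end Spinor

/-! ### Multiplication tables of the spinors and the eigenspaces of i e₃ -/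

section Spinors

variable {A : Type*} [NormedRing A] [NormedAlgebra ℂ A] {e : Fin 3 → A}

/-- `(1 - s e₃e₁e₂)(e₁ + t i e₂)`. -/
def oddSpinor (e : Fin 3 → A) (s t : ℂ) : A :=
  (1 - s • (e 2 * e 0 * e 1)) * (e 0 + (t * Complex.I) • e 1)

/-- `(1 - s e₃e₁e₂)(1 + t i e₁e₂)`. -/
def evenSpinor (e : Fin 3 → A) (s t : ℂ) : A :=
  (1 - s • (e 2 * e 0 * e 1)) * (1 + (t * Complex.I) • (e 0 * e 1))

omit [NormedAlgebra ℂ A] in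
/-- Rewriting rules that put products of the generators into increasing order. -/
theorem IsCliffordSystem.normalForm (he : IsCliffordSystem e) :
    (∀ j, e j * e j = -1) ∧ (e 1 * e 0 = -(e 0 * e 1)) ∧ (e 2 * e 0 = -(e 0 * e 2)) ∧
    (e 2 * e 1 = -(e 1 * e 2)) ∧ (∀ j x, e j * (e j * x) = -x) ∧
    (∀ x, e 1 * (e 0 * x) = -(e 0 * (e 1 * x))) ∧ (∀ x, e 2 * (e 0 * x) = -(e 0 * (e 2 * x))) ∧
    (∀ x, e 2 * (e 1 * x) = -(e 1 * (e 2 * x))) := by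
  have h10 := he.anti 1 0 (by decide)
  have h20 := he.anti 2 0 (by decide)
  have h21 := he.anti 2 1 (by decide)
  refine ⟨he.sq, h10, h20, h21, fun j x => ?_, fun x => ?_, fun x => ?_, fun x => ?_⟩ <;>
    rw [← mul_assoc]
  · rw [he.sq, neg_one_mul]
  all_goals simp only [h10, h20, h21, neg_mul, mul_assoc]

/-- The element p = e₃e₁e₂ is central with p² = 1, so p acts on the ideal of 1 - sp as -s, that is,
e₁e₂ acts as se₃. The algebra there becomes quaternionic, and right multiplication by generators
permutes the odd and even spinors up to scalars. -/
theorem IsCliffordSystem.oddSpinor_mul (he : IsCliffordSystem e) {s t : ℂ} (hs : s * s = 1)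
    (ht : t * t = 1) :
    oddSpinor e s t * e 0 = (-1 : ℂ) • evenSpinor e s t ∧
    oddSpinor e s t * e 1 = (-(t * Complex.I)) • evenSpinor e s t ∧
    oddSpinor e s t * e 2 = (s * t * Complex.I) • oddSpinor e s t ∧
    Complex.I • (e 2 * oddSpinor e s t) = (s * t) • oddSpinor e s t := by
  obtain ⟨n1, n2, n3, n4, n5, n6, n7, n8⟩ := he.normalForm
  have hI := Complex.I_mul_I
  refine ⟨?_, ?_, ?_, ?_⟩ <;>
  simp only [oddSpinor, evenSpinor, add_mul, mul_add, sub_mul, mul_sub, one_mul, mul_one,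
      smul_mul_assoc, mul_smul_comm, mul_assoc, n1, n2, n3, n4, n5, n6, n7, n8, mul_neg, neg_mul,
      smul_neg, neg_neg, smul_add, smul_sub, smul_smul]
  · module
  · match_scalars <;> grind
  · match_scalars <;> grind
  · match_scalars <;> grind

theorem IsCliffordSystem.evenSpinor_mul (he : IsCliffordSystem e) {s t : ℂ} (hs : s * s = 1)
    (ht : t * t = 1) :
    evenSpinor e s t * e 0 = oddSpinor e s t ∧
    evenSpinor e s t * e 1 = (-(t * Complex.I)) • oddSpinor e s t ∧
    evenSpinor e s t * e 2 = (-(s * t * Complex.I)) • evenSpinor e s t ∧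
    Complex.I • (e 2 * evenSpinor e s t) = (s * t) • evenSpinor e s t := by
  obtain ⟨n1, n2, n3, n4, n5, n6, n7, n8⟩ := he.normalForm
  have hI := Complex.I_mul_I
  refine ⟨?_, ?_, ?_, ?_⟩ <;>
  simp only [oddSpinor, evenSpinor, add_mul, mul_add, sub_mul, mul_sub, one_mul, mul_one,
      smul_mul_assoc, mul_smul_comm, mul_assoc, n1, n2, n3, n4, n5, n6, n7, n8, mul_neg, neg_mul,
      smul_neg, neg_neg, smul_add, smul_sub, smul_smul]
  all_goals match_scalars <;> grind

/-- Adding the contributions of the two ideals recovers 1 + t i e₃ up to the factor 2, as p e₁e₂ =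
-e₃. -/
theorem IsCliffordSystem.evenSpinor_add_evenSpinor (he : IsCliffordSystem e) (t : ℂ) :
    evenSpinor e 1 t + evenSpinor e (-1) (-t) = (2 : ℂ) • 1 + (2 * t * Complex.I) • e 2 := by
  obtain ⟨n1, n2, n3, n4, n5, n6, n7, n8⟩ := he.normalForm
  simp only [evenSpinor, mul_add, sub_mul, one_mul, mul_one, smul_mul_assoc, mul_smul_comm,
    mul_assoc, n3, n4, n5, n6, n7, mul_neg, neg_mul, smul_neg, neg_neg, smul_sub, smul_smul]
  match_scalars <;> grind


/-- A set of eigenvectors spans the eigenspace of `i e₃` if its span is a right ideal and contains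
`1 + τ i e₃`. -/
theorem mem_span_of_eigen {ι : Type*} {w : ι → A} {τ : ℤˣ}
    (h1 : 1 + (sgn τ * Complex.I) • e 2 ∈ Submodule.span ℂ (Set.range w))
    (h2 : ∀ j a, w j * a ∈ Submodule.span ℂ (Set.range w)) {a : A}
    (ha : Complex.I • (e 2 * a) = (sgn τ : ℂ) • a) : a ∈ Submodule.span ℂ (Set.range w) := by
  have h3 : ∀ x ∈ Submodule.span ℂ (Set.range w), x * a ∈ Submodule.span ℂ (Set.range w) := by
    intro x hx
    have : Submodule.span ℂ (Set.range w) ≤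
        (Submodule.span ℂ (Set.range w)).comap (LinearMap.mulRight ℂ a) := by
      rw [Submodule.span_le]
      rintro _ ⟨j, rfl⟩
      exact h2 j a
    exact this hx
  -- On eigenvectors 1 + τ i e₃ acts as the scalar 2, which puts a in the right ideal.
  have h4 : (1 + (sgn τ * Complex.I) • e 2) * a = (2 : ℂ) • a := by
    rw [add_mul, one_mul, mul_smul, smul_mul_assoc, smul_mul_assoc, ha, smul_smul,
      ← Complex.ofReal_mul, sgn_mul_self, Complex.ofReal_one, one_smul, two_smul]
  have h5 := h3 _ h1
  rw [h4] at h5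
  exact (Submodule.smul_mem_iff _ two_ne_zero).1 h5

theorem mul_mem_span_of_generators {ι : Type*} {w : ι → A}
    (h : ∀ j k, w j * e k ∈ Submodule.span ℂ (Set.range w)) {x : A}
    (hx : x ∈ Submodule.span ℂ (Set.range w)) (k : Fin 3) :
    x * e k ∈ Submodule.span ℂ (Set.range w) := by
  have : Submodule.span ℂ (Set.range w) ≤
      (Submodule.span ℂ (Set.range w)).comap (LinearMap.mulRight ℂ (e k)) := by
    rw [Submodule.span_le]
    rintro _ ⟨j, rfl⟩
    exact h j k
  exact this hx

/-- The eigenvectors `e₁ + t i e₂`, `1 + t i e₃` of `i e₃` in a quaternion algebra. -/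
theorem IsCliffordSystem.quaternion_mul (he : IsCliffordSystem e) (h : e 0 * e 1 = e 2) {t : ℂ}
    (ht : t * t = 1) :
    (Complex.I • (e 2 * (e 0 + (t * Complex.I) • e 1)) = t • (e 0 + (t * Complex.I) • e 1) ∧
      (e 0 + (t * Complex.I) • e 1) * e 0 = (-1 : ℂ) • (1 + (t * Complex.I) • e 2) ∧
      (e 0 + (t * Complex.I) • e 1) * e 1 =
        (-(t * Complex.I)) • (1 + (t * Complex.I) • e 2) ∧
      (e 0 + (t * Complex.I) • e 1) * e 2 = (t * Complex.I) • (e 0 + (t * Complex.I) • e 1)) ∧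
    (Complex.I • (e 2 * (1 + (t * Complex.I) • e 2)) = t • (1 + (t * Complex.I) • e 2) ∧
      (1 + (t * Complex.I) • e 2) * e 0 = e 0 + (t * Complex.I) • e 1 ∧
      (1 + (t * Complex.I) • e 2) * e 1 = (-(t * Complex.I)) • (e 0 + (t * Complex.I) • e 1) ∧
      (1 + (t * Complex.I) • e 2) * e 2 = (-(t * Complex.I)) • (1 + (t * Complex.I) • e 2)) := by
  obtain ⟨n1, n2, n3, n4, n5, n6, n7, n8⟩ := he.normalForm
  have hI := Complex.I_mul_I
  rw [← h]
  refine ⟨⟨?_, ?_, ?_, ?_⟩, ?_, ?_, ?_, ?_⟩ <;>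
  simp only [add_mul, mul_add, one_mul, mul_one, smul_mul_assoc, mul_smul_comm, mul_assoc, n1, n2,
      n5, n6, mul_neg, neg_mul, smul_neg, neg_neg, smul_add, smul_smul]
  all_goals match_scalars <;> grind

end Spinors

/-! ### Complex quaternions -/

section Quaternion

open scoped Quaternion

variable {R : Type*} [CommRing R]

theorem quaternion_unit_mul_self (j : Fin 3) :
    (![⟨0, 1, 0, 0⟩, ⟨0, 0, 1, 0⟩, ⟨0, 0, 0, 1⟩] : Fin 3 → ℍ[R,-1,0,-1]) j *
      (![⟨0, 1, 0, 0⟩, ⟨0, 0, 1, 0⟩, ⟨0, 0, 0, 1⟩] : Fin 3 → ℍ[R,-1,0,-1]) j = -1 := by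
  fin_cases j <;> ext <;> simp

theorem quaternion_unit_anticomm (j k : Fin 3) (h : j ≠ k) :
    (![⟨0, 1, 0, 0⟩, ⟨0, 0, 1, 0⟩, ⟨0, 0, 0, 1⟩] : Fin 3 → ℍ[R,-1,0,-1]) j *
      (![⟨0, 1, 0, 0⟩, ⟨0, 0, 1, 0⟩, ⟨0, 0, 0, 1⟩] : Fin 3 → ℍ[R,-1,0,-1]) k =
      -((![⟨0, 1, 0, 0⟩, ⟨0, 0, 1, 0⟩, ⟨0, 0, 0, 1⟩] : Fin 3 → ℍ[R,-1,0,-1]) k *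
        (![⟨0, 1, 0, 0⟩, ⟨0, 0, 1, 0⟩, ⟨0, 0, 0, 1⟩] : Fin 3 → ℍ[R,-1,0,-1]) j) := by
  fin_cases j <;> fin_cases k <;> first | exact absurd rfl h | ext <;> simp

theorem quaternion_unit_mul :
    (⟨0, 1, 0, 0⟩ * ⟨0, 0, 1, 0⟩ : ℍ[R,-1,0,-1]) = ⟨0, 0, 0, 1⟩ := by
  ext <;> simp

theorem quaternion_eq_sum (a : ℍ[R,-1,0,-1]) :
    a = a.re • (1 : ℍ[R,-1,0,-1]) + a.imI • (⟨0, 1, 0, 0⟩ : ℍ[R,-1,0,-1]) +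
      a.imJ • (⟨0, 0, 1, 0⟩ : ℍ[R,-1,0,-1]) + a.imK • (⟨0, 0, 0, 1⟩ : ℍ[R,-1,0,-1]) := by
  ext <;> simp

end Quaternion

theorem isCliffordSystem_quatGen : IsCliffordSystem quatGen :=
  ⟨quaternion_unit_mul_self, quaternion_unit_anticomm⟩

theorem quatGen_mul : quatGen 0 * quatGen 1 = quatGen 2 := quaternion_unit_mul

theorem cquat_eq_sum (a : CQuat) :
    a = a.re • 1 + a.imI • quatGen 0 + a.imJ • quatGen 1 + a.imK • quatGen 2 :=
  quaternion_eq_sum a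

theorem quatSpinor_one : quatSpinor 1 =
    ![quatGen 0 + (((sgn 1 : ℝ) : ℂ) * Complex.I) • quatGen 1,
      1 + (((sgn 1 : ℝ) : ℂ) * Complex.I) • quatGen 2] := by
  rw [quatSpinor, if_pos rfl, sgn_one, Complex.ofReal_one, one_mul]

theorem quatSpinor_neg_one : quatSpinor (-1) =
    ![1 + (((sgn (-1) : ℝ) : ℂ) * Complex.I) • quatGen 2,
      quatGen 0 + (((sgn (-1) : ℝ) : ℂ) * Complex.I) • quatGen 1] := by
  rw [quatSpinor, if_neg (by decide), sgn_neg, sgn_one, Complex.ofReal_neg, Complex.ofReal_one,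
    neg_one_mul, neg_smul, neg_smul, ← sub_eq_add_neg, ← sub_eq_add_neg]

theorem sgn_mul_self_complex (τ : ℤˣ) : ((sgn τ : ℝ) : ℂ) * ((sgn τ : ℝ) : ℂ) = 1 := by
  rw [← Complex.ofReal_mul, sgn_mul_self, Complex.ofReal_one]

theorem quatSpinor_eigen (τ : ℤˣ) (j : Fin 2) :
    Complex.I • (quatGen 2 * quatSpinor τ j) = (sgn τ : ℂ) • quatSpinor τ j := by
  obtain ⟨⟨h1, -⟩, h2, -⟩ :=
    isCliffordSystem_quatGen.quaternion_mul quatGen_mul (sgn_mul_self_complex τ)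
  rcases Int.units_eq_one_or τ with rfl | rfl
  · rw [quatSpinor_one]
    fin_cases j
    exacts [h1, h2]
  · rw [quatSpinor_neg_one]
    fin_cases j
    exacts [h2, h1]

/-- Right multiplication by each generator maps each of the two spinors to a multiple of one of
them, so their span is a right ideal; it contains 1 + τ i e₃. -/
theorem mem_span_quatSpinor (τ : ℤˣ) (a : CQuat)
    (ha : Complex.I • (quatGen 2 * a) = (sgn τ : ℂ) • a) :
    a ∈ Submodule.span ℂ (Set.range (quatSpinor τ)) := by
  obtain ⟨⟨-, h1, h2, h3⟩, -, h4, h5, h6⟩ :=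
    isCliffordSystem_quatGen.quaternion_mul quatGen_mul (sgn_mul_self_complex τ)
  have hr : Set.range (quatSpinor τ) =
      {quatGen 0 + (((sgn τ : ℝ) : ℂ) * Complex.I) • quatGen 1,
      1 + (((sgn τ : ℝ) : ℂ) * Complex.I) • quatGen 2} := by
    rcases Int.units_eq_one_or τ with rfl | rfl
    · rw [quatSpinor_one, Matrix.range_cons, Matrix.range_cons, Matrix.range_empty,
        Set.union_empty, Set.singleton_union]
    · rw [quatSpinor_neg_one, Matrix.range_cons, Matrix.range_cons, Matrix.range_empty,
        Set.union_empty, Set.singleton_union, Set.pair_comm]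
  have hm1 : quatGen 0 + (((sgn τ : ℝ) : ℂ) * Complex.I) • quatGen 1 ∈
      Submodule.span ℂ (Set.range (quatSpinor τ)) := Submodule.subset_span (by rw [hr]; simp)
  have hm2 : 1 + (((sgn τ : ℝ) : ℂ) * Complex.I) • quatGen 2 ∈
      Submodule.span ℂ (Set.range (quatSpinor τ)) := Submodule.subset_span (by rw [hr]; simp)
  have hg : ∀ j k, quatSpinor τ j * quatGen k ∈ Submodule.span ℂ (Set.range (quatSpinor τ)) := by
    intro j k
    have hj : quatSpinor τ j ∈ Set.range (quatSpinor τ) := ⟨j, rfl⟩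
    rw [hr] at hj
    rcases hj with hj | hj
    · rw [hj]
      fin_cases k
      · exact h1 ▸ Submodule.smul_mem _ _ hm2
      · exact h2 ▸ Submodule.smul_mem _ _ hm2
      · exact h3 ▸ Submodule.smul_mem _ _ hm1
    · rw [Set.mem_singleton_iff.1 hj]
      fin_cases k
      · exact h4 ▸ hm1
      · exact h5 ▸ Submodule.smul_mem _ _ hm1
      · exact h6 ▸ Submodule.smul_mem _ _ hm2
  refine mem_span_of_eigen hm2 (fun j b => ?_) ha
  rw [cquat_eq_sum b]
  simp only [mul_add, mul_smul_comm, mul_one]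
  exact Submodule.add_mem _ (Submodule.add_mem _ (Submodule.add_mem _
    (Submodule.smul_mem _ _ (Submodule.subset_span ⟨j, rfl⟩)) (Submodule.smul_mem _ _ (hg j 0)))
    (Submodule.smul_mem _ _ (hg j 1))) (Submodule.smul_mem _ _ (hg j 2))

/-- Quaternionic conjugation, which does not conjugate the complex coefficients. -/
def quatConj : CQuat →ₗ[ℂ] CQuat where
  toFun a := a.re • 1 - a.imI • quatGen 0 - a.imJ • quatGen 1 - a.imK • quatGen 2
  map_add' a b := by
    change (a.re + b.re) • _ - (a.imI + b.imI) • _ - (a.imJ + b.imJ) • _ - (a.imK + b.imK) • _ = _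
    module
  map_smul' c a := by
    change (c * a.re) • _ - (c * a.imI) • _ - (c * a.imJ) • _ - (c * a.imK) • _ = _
    rw [RingHom.id_apply]
    module

/-- Conjugation reverses products, and the sign changes of the two vectors cancel. -/
theorem quatConj_vec_mul_vec (u v : E3) :
    quatConj (vec quatGen u * vec quatGen v) = vec quatGen v * vec quatGen u := by
  have he := isCliffordSystem_quatGen
  obtain ⟨n1, n2, n3, n4, n5, n6, n7, n8⟩ := he.normalForm
  have c0 : quatConj 1 = 1 := by
    change (1 : ℂ) • (1 : CQuat) - (0 : ℂ) • _ - (0 : ℂ) • _ - (0 : ℂ) • _ = _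
    module
  have c1 : quatConj (quatGen 0) = -quatGen 0 := by
    change (0 : ℂ) • (1 : CQuat) - (1 : ℂ) • _ - (0 : ℂ) • _ - (0 : ℂ) • _ = _
    module
  have c2 : quatConj (quatGen 1) = -quatGen 1 := by
    change (0 : ℂ) • (1 : CQuat) - (0 : ℂ) • _ - (1 : ℂ) • _ - (0 : ℂ) • _ = _
    module
  have c3 : quatConj (quatGen 2) = -quatGen 2 := by
    change (0 : ℂ) • (1 : CQuat) - (0 : ℂ) • _ - (0 : ℂ) • _ - (1 : ℂ) • _ = _
    module
  have m1 : quatGen 0 * quatGen 2 = -quatGen 1 := by rw [← quatGen_mul, n5]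
  have m2 : quatGen 1 * quatGen 2 = quatGen 0 := by
    rw [← quatGen_mul, n6, n1, mul_neg, neg_neg, mul_one]
  simp only [vec, Fin.sum_univ_three, mul_add, add_mul, smul_mul_assoc, mul_smul_comm, n1, n2, n3,
    n4, quatGen_mul, m1, m2, map_add, map_smul, map_neg, c0, c1, c2, c3]
  module

/-! ### The complexified Clifford algebra -/

theorem isCliffordSystem_cliffGen : IsCliffordSystem cliffGen where
  sq j := by
    refine (CliffordAlgebra.ι_sq_scalar cliffForm (Pi.single j 1)).trans ?_
    have h : cliffForm (Pi.single j 1) = -1 := by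
      simp [cliffForm, QuadraticMap.weightedSumSquares_apply, Pi.single_apply]
    rw [h, map_neg, map_one]
  anti j k h := by
    have h1 := CliffordAlgebra.ι_mul_ι_add_swap (Q := cliffForm) (Pi.single j 1) (Pi.single k 1)
    have h2 : QuadraticMap.polar cliffForm (Pi.single j (1 : ℂ)) (Pi.single k 1) = 0 := by
      simp [cliffForm, QuadraticMap.polar, QuadraticMap.weightedSumSquares_apply, Pi.single_apply,
        mul_add, Finset.sum_add_distrib, h, h.symm]
    rw [h2, map_zero] at h1
    exact eq_neg_of_add_eq_zero_left h1

theorem reverse_vec_mul_vec (u v : E3) :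
    CliffordAlgebra.reverse (vec cliffGen u * vec cliffGen v) =
      vec cliffGen v * vec cliffGen u := by
  have h : ∀ u : E3, CliffordAlgebra.reverse (vec cliffGen u) = vec cliffGen u := fun u => by
    simp only [vec, map_sum, map_smul, cliffGen, CliffordAlgebra.reverse_ι]
  refine (CliffordAlgebra.reverse.map_mul _ _).trans ?_
  rw [h, h]

theorem cliffSpinor_one : cliffSpinor 1 =
    ![oddSpinor cliffGen 1 1, evenSpinor cliffGen 1 1, oddSpinor cliffGen (-1) (-1),
      evenSpinor cliffGen (-1) (-1)] := by
  simp only [oddSpinor, evenSpinor, one_smul, one_mul, neg_smul, neg_one_mul, sub_neg_eq_add,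
    ← sub_eq_add_neg]
  rfl

theorem cliffSpinor_neg_one : cliffSpinor (-1) =
    ![evenSpinor cliffGen 1 (-1), oddSpinor cliffGen 1 (-1), evenSpinor cliffGen (-1) 1,
      oddSpinor cliffGen (-1) 1] := by
  simp only [oddSpinor, evenSpinor, one_smul, one_mul, neg_smul, neg_one_mul, sub_neg_eq_add,
    ← sub_eq_add_neg]
  rfl

/-- The choice t = sτ makes the eigenvalue st equal to τ in both ideals s = ±1, so the two signs τ
can be treated uniformly. -/
theorem range_cliffSpinor (τ : ℤˣ) : Set.range (cliffSpinor τ) =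
    {a | ∃ s : ℂ, s * s = 1 ∧ (a = oddSpinor cliffGen s (s * (sgn τ : ℂ)) ∨
      a = evenSpinor cliffGen s (s * (sgn τ : ℂ)))} := by
  ext a
  simp only [mul_self_eq_one_iff, Set.mem_ofPred_eq, or_and_right, exists_or, exists_eq_left]
  rcases Int.units_eq_one_or τ with rfl | rfl
  · rw [cliffSpinor_one]
    simp only [Matrix.range_cons, Matrix.range_empty, Set.mem_union, Set.mem_singleton_iff,
      Set.mem_empty_iff_false, sgn_one, Complex.ofReal_one, mul_one]
    tauto
  · rw [cliffSpinor_neg_one]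
    simp only [Matrix.range_cons, Matrix.range_empty, Set.mem_union, Set.mem_singleton_iff,
      Set.mem_empty_iff_false, sgn_neg, sgn_one, Complex.ofReal_neg, Complex.ofReal_one, mul_one,
      mul_neg, neg_neg]
    tauto

theorem cliffSpinor_eigen (τ : ℤˣ) (j : Fin 4) :
    Complex.I • (cliffGen 2 * cliffSpinor τ j) = (sgn τ : ℂ) • cliffSpinor τ j := by
  have hj : cliffSpinor τ j ∈ Set.range (cliffSpinor τ) := ⟨j, rfl⟩
  rw [range_cliffSpinor] at hj
  obtain ⟨s, hs, h⟩ := hj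
  have ht : s * (sgn τ : ℂ) * (s * (sgn τ : ℂ)) = 1 := by
    rw [mul_mul_mul_comm, hs, sgn_mul_self_complex, one_mul]
  have h1 : s * (s * (sgn τ : ℂ)) = sgn τ := by rw [← mul_assoc, hs, one_mul]
  rcases h with h | h <;> rw [h]
  · rw [(isCliffordSystem_cliffGen.oddSpinor_mul hs ht).2.2.2, h1]
  · rw [(isCliffordSystem_cliffGen.evenSpinor_mul hs ht).2.2.2, h1]

theorem mem_span_cliffSpinor (τ : ℤˣ) (a : CCl3)
    (ha : Complex.I • (cliffGen 2 * a) = (sgn τ : ℂ) • a) :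
    a ∈ Submodule.span ℂ (Set.range (cliffSpinor τ)) := by
  have he := isCliffordSystem_cliffGen
  have ho : ∀ s : ℂ, s * s = 1 → oddSpinor cliffGen s (s * (sgn τ : ℂ)) ∈
      Submodule.span ℂ (Set.range (cliffSpinor τ)) := fun s hs =>
    Submodule.subset_span (by rw [range_cliffSpinor]; exact ⟨s, hs, .inl rfl⟩)
  have hv : ∀ s : ℂ, s * s = 1 → evenSpinor cliffGen s (s * (sgn τ : ℂ)) ∈
      Submodule.span ℂ (Set.range (cliffSpinor τ)) := fun s hs =>
    Submodule.subset_span (by rw [range_cliffSpinor]; exact ⟨s, hs, .inr rfl⟩)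
  have hg : ∀ j k, cliffSpinor τ j * cliffGen k ∈
      Submodule.span ℂ (Set.range (cliffSpinor τ)) := by
    intro j k
    have hj : cliffSpinor τ j ∈ Set.range (cliffSpinor τ) := ⟨j, rfl⟩
    rw [range_cliffSpinor] at hj
    obtain ⟨s, hs, h⟩ := hj
    have ht : s * (sgn τ : ℂ) * (s * (sgn τ : ℂ)) = 1 := by
      rw [mul_mul_mul_comm, hs, sgn_mul_self_complex, one_mul]
    rcases h with h | h <;> rw [h]
    · obtain ⟨h1, h2, h3, -⟩ := he.oddSpinor_mul hs ht
      fin_cases k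
      · exact h1 ▸ Submodule.smul_mem _ _ (hv s hs)
      · exact h2 ▸ Submodule.smul_mem _ _ (hv s hs)
      · exact h3 ▸ Submodule.smul_mem _ _ (ho s hs)
    · obtain ⟨h1, h2, h3, -⟩ := he.evenSpinor_mul hs ht
      fin_cases k
      · exact h1 ▸ ho s hs
      · exact h2 ▸ Submodule.smul_mem _ _ (ho s hs)
      · exact h3 ▸ Submodule.smul_mem _ _ (hv s hs)
  have h1 : 1 + (sgn τ * Complex.I) • cliffGen 2 ∈
      Submodule.span ℂ (Set.range (cliffSpinor τ)) := by
    have h2 := Submodule.add_mem _ (hv 1 (by norm_num)) (hv (-1) (by norm_num))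
    rw [one_mul, neg_one_mul, he.evenSpinor_add_evenSpinor, mul_assoc, mul_smul, ← smul_add] at h2
    exact (Submodule.smul_mem_iff _ two_ne_zero).1 h2
  -- Induction on b with x universally quantified, because a product acts by successive right
  -- multiplications, each starting from another element of the span.
  have h2 : ∀ b : CCl3, ∀ x ∈ Submodule.span ℂ (Set.range (cliffSpinor τ)),
      x * b ∈ Submodule.span ℂ (Set.range (cliffSpinor τ)) := by
    intro b
    induction b using CliffordAlgebra.induction with
    | algebraMap r =>
      intro x hx
      have h3 : x * algebraMap ℂ CCl3 r = r • x := by rw [← Algebra.commutes, Algebra.smul_def]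
      exact h3 ▸ Submodule.smul_mem _ r hx
    | ι z =>
      intro x hx
      have h3 : CliffordAlgebra.ι cliffForm z = ∑ k, z k • cliffGen k := by
        conv_lhs => rw [pi_eq_sum_univ' z]
        simp [cliffGen]
      rw [h3, Finset.mul_sum]
      simp only [mul_smul_comm]
      exact Submodule.sum_mem _ fun k _ =>
        Submodule.smul_mem _ _ (mul_mem_span_of_generators hg hx k)
    | mul a b ha hb =>
      intro x hx
      have h3 := hb _ (ha x hx)
      rw [mul_assoc] at h3
      exact h3
    | add a b ha hb =>
      intro x hx
      have h3 := Submodule.add_mem _ (ha x hx) (hb x hx)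
      rw [← mul_add] at h3
      exact h3
  exact mem_span_of_eigen h1 (fun j b => h2 b _ (Submodule.subset_span ⟨j, rfl⟩)) ha

theorem IsMonogenicHardy.exists_hasBoundaryValue {A : Type*} [NormedRing A] [NormedAlgebra ℂ A]
    [FiniteDimensional ℂ A] {e : Fin 3 → A} (he : IsCliffordSystem e) {σ τ : ℤˣ}
    {F : ℝ × E3 → A} (hF : IsMonogenicHardy e σ τ F) :
    ∃ f : Lp A 2 (volume : Measure E3), HasBoundaryValue τ F f := by
  obtain ⟨g, f, -, -, h, -⟩ := hF.exists_boundary he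
  exact ⟨f, h⟩

end

theorem mainTheorem12 (σ τ : ℤˣ) :
    (∀ γ : E3 → CQuat, IsSpinSection quatGen γ →
      (quatH γ σ τ : Set (Lp CQuat 2 (volume : Measure E3))) = hardyBoundarySpace quatGen σ τ ∧
      (∀ F : ℝ × E3 → CQuat, IsMonogenicHardy quatGen σ τ F →
        ∃ f : Lp CQuat 2 (volume : Measure E3), HasBoundaryValue τ F f) ∧
      (∀ (F G : ℝ × E3 → CQuat) (f : Lp CQuat 2 (volume : Measure E3)),
        IsMonogenicHardy quatGen σ τ F → IsMonogenicHardy quatGen σ τ G →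
        HasBoundaryValue τ F f → HasBoundaryValue τ G f → Set.EqOn F G (halfSpace τ))) ∧
    (∀ γ : E3 → CCl3, IsSpinSection cliffGen γ →
      (cliffH γ σ τ : Set (Lp CCl3 2 (volume : Measure E3))) = hardyBoundarySpace cliffGen σ τ ∧
      (∀ F : ℝ × E3 → CCl3, IsMonogenicHardy cliffGen σ τ F →
        ∃ f : Lp CCl3 2 (volume : Measure E3), HasBoundaryValue τ F f) ∧
      (∀ (F G : ℝ × E3 → CCl3) (f : Lp CCl3 2 (volume : Measure E3)),
        IsMonogenicHardy cliffGen σ τ F → IsMonogenicHardy cliffGen σ τ G →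
        HasBoundaryValue τ F f → HasBoundaryValue τ G f → Set.EqOn F G (halfSpace τ))) := by

  have hq := isCliffordSystem_quatGen
  have hc := isCliffordSystem_cliffGen
  exact ⟨fun γ hγ => ⟨iSup_spinorSpace_eq_hardyBoundarySpace hq hγ σ τ (quatSpinor_eigen τ)
      (mem_span_quatSpinor τ) quatConj quatConj_vec_mul_vec,
      fun F hF => hF.exists_hasBoundaryValue hq,
      fun F G f hF hG hf hf' => hF.eqOn_of_boundary hq hG hf hf'⟩,
    fun γ hγ => ⟨iSup_spinorSpace_eq_hardyBoundarySpace hc hγ σ τ (cliffSpinor_eigen τ)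
      (mem_span_cliffSpinor τ) CliffordAlgebra.reverse reverse_vec_mul_vec,
      fun F hF => hF.exists_hasBoundaryValue hc,
      fun F G f hF hG hf hf' => hF.eqOn_of_boundary hc hG hf hf'⟩⟩
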